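/- Let $n\ge 0$ be an integer and let $a_1,\dots,a_n$ be real numbers with $|a_1|\ge|a_2|\ge\dots\ge|a_n|$. Let $\varepsilon_1,\dots,\varepsilon_n$ be independent random variables with $\mathbf P(\varepsilon_i=1)=\mathbf P(\varepsilon_i=-1)=\tfrac12$, and let $\mathcal E_1,\dots,\mathcal E_n$ be independent symmetric exponential random variables with variance $1$, i.e. each $\mathcal E_i$ has density $2^{-1/2}e^{-\sqrt2|x|}$ on $\mathbb R$. For $p>0$ put $\gamma_p=(\mathbf E|g|^p)^{1/p}$, where $g$ is a standard Gaussian random variable. Then for every real $p\ge 2$ the two moments below are finite and $$\gamma_p^p\Big(\sum_{i=1}^n a_i^2\Big)^{p/2}\ \ge\ \mathbf E\Big|\sum_{i=1}^n a_i\varepsilon_i\Big|^p\ \ge\ \mathbf E\Big|\sum_{i=\lceil p/2\rceil}^n a_i\mathcal E_i\Big|^p\ \ge\ \gamma_p^p\Big(\sum_{i=\lceil p/2\rceil}^n a_i^2\Big)^{p/2},$$ where a sum is $0$ when its range of indices is empty. -/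

import Mathlib

open MeasureTheory ProbabilityTheory

/-- The law of a symmetric random sign: mass `1/2` at `1` and mass `1/2` at `-1`. -/
noncomputable def signLaw : Measure ℝ :=
  bernoulliMeasure (1 : ℝ) (-1) ⟨1 / 2, by norm_num, by norm_num⟩

/-- The symmetric exponential law of variance `1`: density `2^(-1/2) * exp (-√2 * |x|)`. -/
noncomputable def symmExpLaw : Measure ℝ :=
  volume.withDensity fun x => ENNReal.ofReal ((√2)⁻¹ * Real.exp (-√2 * |x|))

/-- `gammaNorm p` is the `L^p` norm of a standard Gaussian random variable. -/
noncomputable def gammaNorm (p : ℝ) : ℝ :=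
  (∫ x, |x| ^ p ∂(gaussianReal 0 1)) ^ (1 / p)

/-!
Write `S` for the sum of random signs and `T` for the sum of exponential variables. The three
inequalities compare absolute moments, and each is proved first for `2 ≤ p < 4` by Fourier analysis and
then for larger `p` in steps of two (`induction_by_two`).

For `2 < p < 4` the kernel `cos u - 1 + u ^ 2 / 2` is nonnegative and its dilates integrate against
`u ^ (-p - 1)` to a positive multiple of `|x| ^ p`. Hence a pointwise comparison of
`𝔼 cos (t X) + t ^ 2 𝔼 X ^ 2 / 2` gives a comparison of moments (`integral_abs_rpow_le_of_charFun`).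
The functions `𝔼 cos (t X)` are explicit: `∏ cos (a i t)` for `S`, `∏ (1 + (a i t) ^ 2 / 2)⁻¹` for `T`,
and `exp (-t ^ 2 / 2)` for a Gaussian variable.

* `T` against the Gaussian: `1 + y ≤ exp y`. For `p ≥ 4` the Laplace law inverts `1 - D ^ 2 / 2`, which
  gives an exact recursion from `p - 2` to `p` (`integral_abs_rpow_sumLaw_symmExpLaw_succ`), while
  convexity of `x ^ (p / 2)` bounds the Gaussian side.
* `S` against `T`: dropping the largest coefficient costs at most `x 0 ^ 2 / 2` in the product of
  cosines (`prod_inv_le_prod_cos_add`). For `p ≥ 4` the moments of `S` grow at least as fast as the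
  recursion for `T` (`radE_abs_rpow_succ_ge`), but each step uses up one more coefficient; this is where
  the sum starting at `⌈p / 2⌉` comes from.
* `S` against the Gaussian, that is, Khintchine's inequality with the sharp constant
  (`radE_abs_rpow_le_gaussMoment_mul`). For `p ≥ 4` one uses
  `𝔼 |S| ^ p ≤ (p - 1) (∑ a i ^ 2) 𝔼 |S| ^ (p - 2)`, which is an equality for Gaussian variables. For
  `2 < p < 4` and `∑ a i ^ 2 = 1` the pointwise comparison fails. If some `a i ^ 2 ≥ 3 / 5`, then
  the third or fourth moment of `S` is small enough for interpolation with the second moment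
  (`radE_abs_rpow_le_of_large`). Otherwise the weighted arithmetic-geometric mean inequality gives
  `∏ |cos (a i t)| ≤ ∑ a i ^ 2 |cos (a i t)| ^ (1 / a i ^ 2)`, and it remains to show
  `∫ (exp (-s u ^ 2 / 2) - |cos u| ^ s) u ^ (-p - 1) du ≥ 0` for `s ≥ 5 / 3`
  (`integral_gaussCosGap_nonneg`). Up to a tiny tail the integrand changes sign once, so the case `p = 2`
  with a little room implies the others. At `p = 2`, the range `s ≥ 3` follows from
  `cos u ≤ exp (-u ^ 2 / 2 - u ^ 4 / 12)`; for `5 / 3 ≤ s ≤ 3` the power `|cos| ^ s` is bounded by a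
  cubic in `|cos|`, and the resulting trigonometric integral is evaluated through Euler's constant,
  `log 2` and `log 3` (`integral_gauss_sub_cosCubic`).
-/

/-! ### Laws of weighted sums and iterated averages over signs -/

/-- A measure on the line all of whose absolute moments are finite. -/
def HasMoments (ν : Measure ℝ) : Prop := ∀ n : ℕ, Integrable (fun x => |x| ^ n) ν

/-- Continuous functions of at most polynomial growth; these are integrable against every measure
with finite moments. -/
def PolyGrowth (F : ℝ → ℝ) : Prop :=
  Continuous F ∧ ∃ (C : ℝ) (n : ℕ), ∀ x, |F x| ≤ C * (1 + |x| ^ n)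

theorem HasMoments.integrable {ν : Measure ℝ} [IsFiniteMeasure ν] (h : HasMoments ν) {F : ℝ → ℝ}
    (hF : PolyGrowth F) : Integrable F ν := by
  obtain ⟨hc, C, n, hb⟩ := hF
  refine (((integrable_const (1 : ℝ)).add (h n)).const_mul C).mono' hc.aestronglyMeasurable ?_
  exact Filter.Eventually.of_forall fun x => by simpa using hb x

theorem pow_le_one_add_pow {t : ℝ} (ht : 0 ≤ t) {m n : ℕ} (h : m ≤ n) : t ^ m ≤ 1 + t ^ n := by
  rcases le_total t 1 with h1 | h1
  · have := pow_le_one₀ ht h1 (n := m)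
    have := pow_nonneg ht n
    linarith
  · have := pow_le_pow_right₀ h1 h
    linarith

theorem PolyGrowth.abs_rpow {q : ℝ} (hq : 0 ≤ q) : PolyGrowth fun x => |x| ^ q := by
  refine ⟨continuous_abs.rpow_const fun _ => Or.inr hq, 1, ⌈q⌉₊, fun x => ?_⟩
  rw [abs_of_nonneg (by positivity), one_mul]
  rcases le_total |x| 1 with h1 | h1
  · have := Real.rpow_le_one (abs_nonneg x) h1 hq
    have : 0 ≤ |x| ^ ⌈q⌉₊ := by positivity
    linarith
  · have := Real.rpow_le_rpow_of_exponent_le h1 (Nat.le_ceil q)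
    rw [Real.rpow_natCast] at this
    linarith

theorem PolyGrowth.of_bounded {F : ℝ → ℝ} (hF : Continuous F) {C : ℝ} (hC : ∀ x, |F x| ≤ C) :
    PolyGrowth F := by
  refine ⟨hF, C, 0, fun x => (hC x).trans ?_⟩
  have := (abs_nonneg _).trans (hC 0)
  simp only [pow_zero]; linarith

theorem PolyGrowth.const (c : ℝ) : PolyGrowth fun _ => c :=
  PolyGrowth.of_bounded continuous_const fun _ => le_rfl

theorem PolyGrowth.id : PolyGrowth fun x => x :=
  ⟨continuous_id, 1, 1, fun x => by simp⟩

theorem PolyGrowth.abs : PolyGrowth fun x => |x| :=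
  ⟨continuous_abs, 1, 1, fun x => by simp⟩

theorem PolyGrowth.mul {F G : ℝ → ℝ} (hF : PolyGrowth F) (hG : PolyGrowth G) :
    PolyGrowth fun x => F x * G x := by
  obtain ⟨hF, C, m, hC⟩ := hF
  obtain ⟨hG, D, n, hD⟩ := hG
  have hC0 : 0 ≤ C := by
    have := (abs_nonneg _).trans (hC 1); simp at this; linarith
  have hD0 : 0 ≤ D := by
    have := (abs_nonneg _).trans (hD 1); simp at this; linarith
  refine ⟨hF.mul hG, C * D * 4, m + n, fun x => ?_⟩
  rw [abs_mul]
  have h1 : |F x| * |G x| ≤ (C * (1 + |x| ^ m)) * (D * (1 + |x| ^ n)) :=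
    mul_le_mul (hC x) (hD x) (abs_nonneg _) (by positivity)
  refine h1.trans ?_
  have e1 := pow_le_one_add_pow (abs_nonneg x) (Nat.le_add_right m n)
  have e2 := pow_le_one_add_pow (abs_nonneg x) (Nat.le_add_left n m)
  have e3 : 0 ≤ |x| ^ (m + n) := by positivity
  have : (1 + |x| ^ m) * (1 + |x| ^ n) ≤ 4 * (1 + |x| ^ (m + n)) := by
    have : (1 + |x| ^ m) * (1 + |x| ^ n) = 1 + |x| ^ m + |x| ^ n + |x| ^ (m + n) := by ring
    linarith
  calc _ = C * D * ((1 + |x| ^ m) * (1 + |x| ^ n)) := by ring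
    _ ≤ C * D * (4 * (1 + |x| ^ (m + n))) := by gcongr
    _ = _ := by ring

theorem PolyGrowth.add {F G : ℝ → ℝ} (hF : PolyGrowth F) (hG : PolyGrowth G) :
    PolyGrowth fun x => F x + G x := by
  obtain ⟨hF, C, m, hC⟩ := hF
  obtain ⟨hG, D, n, hD⟩ := hG
  have hC0 : 0 ≤ C := by
    have := (abs_nonneg _).trans (hC 1); simp at this; linarith
  have hD0 : 0 ≤ D := by
    have := (abs_nonneg _).trans (hD 1); simp at this; linarith
  refine ⟨hF.add hG, 2 * (C + D), m + n, fun x => (abs_add_le _ _).trans ?_⟩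
  have e1 := pow_le_one_add_pow (abs_nonneg x) (Nat.le_add_right m n)
  have e2 := pow_le_one_add_pow (abs_nonneg x) (Nat.le_add_left n m)
  have e3 : 0 ≤ |x| ^ (m + n) := by positivity
  calc |F x| + |G x| ≤ C * (1 + |x| ^ m) + D * (1 + |x| ^ n) := add_le_add (hC x) (hD x)
    _ ≤ C * (2 * (1 + |x| ^ (m + n))) + D * (2 * (1 + |x| ^ (m + n))) := by
        gcongr <;> linarith
    _ = _ := by ring

theorem PolyGrowth.const_mul {F : ℝ → ℝ} (c : ℝ) (hF : PolyGrowth F) :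
    PolyGrowth fun x => c * F x := (PolyGrowth.const c).mul hF

theorem PolyGrowth.pow {F : ℝ → ℝ} (hF : PolyGrowth F) (n : ℕ) :
    PolyGrowth fun x => F x ^ n := by
  induction n with
  | zero => simpa using PolyGrowth.const 1
  | succ n ih => simpa only [pow_succ] using ih.mul hF

theorem PolyGrowth.comp {F G : ℝ → ℝ} (hF : PolyGrowth F) (hG : PolyGrowth G) :
    PolyGrowth fun x => F (G x) := by
  obtain ⟨hF, C, m, hC⟩ := hF
  have hC0 : 0 ≤ C := by
    have := (abs_nonneg _).trans (hC 1); simp at this; linarith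
  have hG' : PolyGrowth fun x => |G x| := by
    obtain ⟨hG, D, n, hD⟩ := hG
    exact ⟨hG.abs, D, n, by simpa using hD⟩
  obtain ⟨-, E, k, hE⟩ := ((PolyGrowth.const 1).add (hG'.pow m)).const_mul C
  exact ⟨hF.comp hG.1, E, k, fun x => (hC (G x)).trans ((le_abs_self _).trans (hE x))⟩

theorem PolyGrowth.comp_affine {F : ℝ → ℝ} (hF : PolyGrowth F) (w c : ℝ) :
    PolyGrowth fun x => F (w + c * x) :=
  hF.comp ((PolyGrowth.const w).add (PolyGrowth.id.const_mul c))

/-- The law of `∑ i < k, b i * X i` for independent variables `X i` with common law `μ`. -/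
noncomputable def sumLaw (μ : Measure ℝ) (b : ℕ → ℝ) : ℕ → Measure ℝ
  | 0 => Measure.dirac 0
  | k + 1 => ((sumLaw μ b k).prod μ).map fun z => z.1 + b k * z.2

instance sumLaw.isProbabilityMeasure (μ : Measure ℝ) [IsProbabilityMeasure μ] (b : ℕ → ℝ) :
    ∀ k, IsProbabilityMeasure (sumLaw μ b k)
  | 0 => by rw [sumLaw]; infer_instance
  | k + 1 => by
    have := sumLaw.isProbabilityMeasure μ b k
    rw [sumLaw]
    exact Measure.isProbabilityMeasure_map (by fun_prop)

theorem HasMoments.sumLaw {μ : Measure ℝ} [IsProbabilityMeasure μ] (h : HasMoments μ) (b : ℕ → ℝ) :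
    ∀ k, HasMoments (sumLaw μ b k)
  | 0 => fun n => by rw [_root_.sumLaw]; exact integrable_dirac (by simp)
  | k + 1 => fun n => by
    have ih := HasMoments.sumLaw h b k
    rw [_root_.sumLaw, integrable_map_measure (by fun_prop) (by fun_prop)]
    have h1 : Integrable (fun z : ℝ × ℝ => |z.1| ^ n) ((_root_.sumLaw μ b k).prod μ) :=
      (ih n).comp_fst μ
    have h2 : Integrable (fun z : ℝ × ℝ => |z.2| ^ n) ((_root_.sumLaw μ b k).prod μ) :=
      (h n).comp_snd _
    refine ((h1.add (h2.const_mul (|b k| ^ n))).const_mul (2 ^ (n - 1))).mono' (by fun_prop) ?_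
    refine Filter.Eventually.of_forall fun z => ?_
    simp only [Function.comp_apply, Real.norm_eq_abs, abs_pow, abs_abs, Pi.add_apply]
    calc |z.1 + b k * z.2| ^ n ≤ (|z.1| + |b k * z.2|) ^ n := by gcongr; exact abs_add_le _ _
      _ ≤ 2 ^ (n - 1) * (|z.1| ^ n + |b k * z.2| ^ n) :=
        add_pow_le (abs_nonneg _) (abs_nonneg _) n
      _ = _ := by rw [abs_mul, mul_pow]

theorem integral_sumLaw_zero (μ : Measure ℝ) (b : ℕ → ℝ) (F : ℝ → ℝ) :
    ∫ x, F x ∂(sumLaw μ b 0) = F 0 := by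
  rw [sumLaw, integral_dirac]

theorem integrable_sumLaw_prod {μ : Measure ℝ} [IsProbabilityMeasure μ] (hμ : HasMoments μ)
    (b : ℕ → ℝ) (k : ℕ) {F : ℝ → ℝ} (hF : PolyGrowth F) :
    Integrable (fun z : ℝ × ℝ => F (z.1 + b k * z.2)) ((sumLaw μ b k).prod μ) := by
  have := (hμ.sumLaw b (k + 1)).integrable hF
  rw [sumLaw, integrable_map_measure hF.1.aestronglyMeasurable (by fun_prop)] at this
  exact this

theorem integral_sumLaw_succ {μ : Measure ℝ} [IsProbabilityMeasure μ] (hμ : HasMoments μ)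
    (b : ℕ → ℝ) (k : ℕ) {F : ℝ → ℝ} (hF : PolyGrowth F) :
    ∫ x, F x ∂(sumLaw μ b (k + 1)) = ∫ x, ∫ y, F (x + b k * y) ∂μ ∂(sumLaw μ b k) := by
  rw [sumLaw, integral_map (by fun_prop) hF.1.aestronglyMeasurable,
    integral_prod _ (integrable_sumLaw_prod hμ b k hF)]

theorem integrable_integral_sumLaw {μ : Measure ℝ} [IsProbabilityMeasure μ] (hμ : HasMoments μ)
    (b : ℕ → ℝ) (k : ℕ) {F : ℝ → ℝ} (hF : PolyGrowth F) :
    Integrable (fun x => ∫ y, F (x + b k * y) ∂μ) (sumLaw μ b k) :=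
  (integrable_sumLaw_prod hμ b k hF).integral_prod_left

instance : IsProbabilityMeasure signLaw := by unfold signLaw; infer_instance

theorem integrable_signLaw (F : ℝ → ℝ) : Integrable F signLaw := by
  unfold signLaw
  rw [bernoulliMeasure_def]
  refine Integrable.add_measure ?_ ?_ <;>
  · refine Integrable.smul_measure ?_ (by simp)
    exact integrable_dirac (by simp)

theorem integral_signLaw (F : ℝ → ℝ) : ∫ x, F x ∂signLaw = (F 1 + F (-1)) / 2 := by
  unfold signLaw
  rw [integral_bernoulliMeasure]
  simp; ring

theorem hasMoments_signLaw : HasMoments signLaw := fun _ => integrable_signLaw _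

/-- `radE b k F` is the expectation of `F (∑ i < k, b i * ε i)` for independent random signs
`ε i`, written as an iterated average. -/
noncomputable def radE (b : ℕ → ℝ) : ℕ → (ℝ → ℝ) → ℝ
  | 0, F => F 0
  | k + 1, F => (radE b k (fun x => F (x + b k)) + radE b k (fun x => F (x - b k))) / 2

theorem radE_add (b : ℕ → ℝ) (k : ℕ) (F G : ℝ → ℝ) :
    radE b k (fun x => F x + G x) = radE b k F + radE b k G := by
  induction k generalizing F G with
  | zero => rfl
  | succ k ih => simp only [radE]; rw [ih, ih]; ring

theorem radE_const_mul (b : ℕ → ℝ) (k : ℕ) (c : ℝ) (F : ℝ → ℝ) :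
    radE b k (fun x => c * F x) = c * radE b k F := by
  induction k generalizing F with
  | zero => rfl
  | succ k ih => simp only [radE]; rw [ih, ih]; ring

theorem radE_const (b : ℕ → ℝ) (k : ℕ) (c : ℝ) : radE b k (fun _ => c) = c := by
  induction k with
  | zero => rfl
  | succ k ih => simp only [radE]; rw [ih]; ring

theorem radE_mono (b : ℕ → ℝ) (k : ℕ) {F G : ℝ → ℝ} (h : ∀ x, F x ≤ G x) :
    radE b k F ≤ radE b k G := by
  induction k generalizing F G with
  | zero => exact h 0
  | succ k ih =>
    simp only [radE]
    linarith [ih (fun x => h (x + b k)), ih (fun x => h (x - b k))]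

theorem radE_succ_avg (b : ℕ → ℝ) (k : ℕ) (F : ℝ → ℝ) :
    radE b (k + 1) F = radE b k (fun x => (F (x + b k) + F (x - b k)) / 2) := by
  have : (fun x => (F (x + b k) + F (x - b k)) / 2)
      = fun x => (1 / 2) * F (x + b k) + (1 / 2) * F (x - b k) := by ext x; ring
  rw [this, radE_add, radE_const_mul, radE_const_mul, radE]; ring

/-- The first sign can be averaged out instead of the last one. -/
theorem radE_succ_first (b : ℕ → ℝ) (k : ℕ) (F : ℝ → ℝ) :
    radE b (k + 1) F
      = radE (fun i => b (i + 1)) k (fun x => (F (x + b 0) + F (x - b 0)) / 2) := by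
  induction k generalizing F with
  | zero => simp [radE]
  | succ k ih =>
    rw [radE, ih, ih, radE]
    congr 1; congr 1 <;>
    · congr 1; ext x; congr 1; congr 1 <;> congr 1 <;> ring

theorem integral_sumLaw_signLaw (b : ℕ → ℝ) (k : ℕ) {F : ℝ → ℝ} (hF : PolyGrowth F) :
    ∫ x, F x ∂(sumLaw signLaw b k) = radE b k F := by
  induction k generalizing F with
  | zero => rw [integral_sumLaw_zero]; rfl
  | succ k ih =>
    rw [integral_sumLaw_succ hasMoments_signLaw b k hF, radE_succ_avg, ← ih]
    · refine integral_congr_ae (Filter.Eventually.of_forall fun x => ?_)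
      simp only [integral_signLaw]
      congr 2 ; congr 1; ring
      congr 1; ring
    · have h1 := hF.comp ((PolyGrowth.const (b k)).add PolyGrowth.id)
      have h2 := hF.comp ((PolyGrowth.const (-b k)).add PolyGrowth.id)
      have := (h1.add h2).const_mul (1 / 2)
      convert this using 2 with x
      rw [add_comm x, sub_eq_add_neg, add_comm x]; ring

/-- The tail of a weighted sum of independent variables with law `μ` has law `sumLaw`. -/
theorem hasLaw_tail_sum {Ω : Type*} [MeasurableSpace Ω] {P : Measure Ω} [IsProbabilityMeasure P]
    {μ : Measure ℝ} {n : ℕ} (A : ℕ → ℝ) {X : Fin n → Ω → ℝ}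
    (hX : ∀ i, HasLaw (X i) μ P) (hind : iIndepFun X P) (m N : ℕ) (hN : N ≤ n) :
    HasLaw (fun ω => ∑ i : Fin n with m ≤ i.val ∧ i.val < N, A i * X i ω)
      (sumLaw μ (fun j => A (m + j)) (N - m)) P := by
  induction N with
  | zero =>
    simp only [Nat.not_lt_zero, and_false, Finset.filter_false, Finset.sum_empty, zero_tsub, sumLaw]
    exact ⟨by fun_prop, by simp⟩
  | succ N ih =>
    specialize ih (by omega)
    rcases Nat.lt_or_ge N m with h | h
    · have e1 : N + 1 - m = N - m := by omega
      have e2 : (Finset.univ.filter fun i : Fin n => m ≤ i.val ∧ i.val < N + 1)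
          = Finset.univ.filter fun i : Fin n => m ≤ i.val ∧ i.val < N := by
        ext i; simp; omega
      rw [e1, e2]; exact ih
    · let j : Fin n := ⟨N, hN⟩
      set s := Finset.univ.filter fun i : Fin n => m ≤ i.val ∧ i.val < N with hs
      have hj : j ∉ s := by simp [hs, j]
      have e1 : N + 1 - m = (N - m) + 1 := by omega
      have e2 : (Finset.univ.filter fun i : Fin n => m ≤ i.val ∧ i.val < N + 1) = insert j s := by
        ext i; simp [hs, j, Fin.ext_iff]; omega
      have hAX : ∀ i : Fin n, AEMeasurable (fun ω => A i * X i ω) P :=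
        fun i => (hX i).aemeasurable.const_mul _
      have hi : iIndepFun (fun (i : Fin n) ω => A i * X i ω) P :=
        hind.comp (fun i x => A i * x) (fun i => by fun_prop)
      have hi2 : IndepFun (fun ω => ∑ i ∈ s, A i * X i ω) (X j) P := by
        have hm : iIndepFun (fun (i : Fin n) => if i = j then X i else fun ω => A i * X i ω) P := by
          have := hind.comp (fun i x => if i = j then x else A i * x)
            (fun i => by split_ifs <;> fun_prop)
          convert this using 2 with i
          ext ω; split_ifs <;> simp_all
        have := hm.indepFun_finsetSum_of_notMem₀ (fun i => by
          split_ifs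
          · exact (hX i).aemeasurable
          · exact hAX i) hj
        simp only [if_true] at this
        convert this using 1
        ext ω
        rw [Finset.sum_apply]
        refine Finset.sum_congr rfl fun i hi' => ?_
        rw [if_neg (fun h : i = j => hj (h ▸ hi'))]
      have hp := (indepFun_iff_map_prod_eq_prod_map_map ih.aemeasurable (hX j).aemeasurable).1 hi2
      rw [e1, e2, sumLaw]
      refine ⟨Finset.aemeasurable_fun_sum _ fun i _ => hAX i, ?_⟩
      rw [ih.map_eq, (hX j).map_eq] at hp
      rw [← hp, AEMeasurable.map_map_of_aemeasurable (by fun_prop)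
        (ih.aemeasurable.prodMk (hX j).aemeasurable)]
      congr 1
      ext ω
      rw [Finset.sum_insert hj]
      simp only [Function.comp_apply, j]
      rw [show m + (N - m) = N by omega]
      ring

/-! ### Moment recursions for sums of random signs -/

theorem convexOn_abs_rpow {q : ℝ} (hq : 1 ≤ q) : ConvexOn ℝ Set.univ fun x : ℝ => |x| ^ q := by
  refine ⟨convex_univ, fun x _ y _ s t hs ht hst => ?_⟩
  have h1 : |s • x + t • y| ≤ s * |x| + t * |y| := by
    refine (abs_add_le _ _).trans ?_
    simp [abs_mul, abs_of_nonneg hs, abs_of_nonneg ht]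
  refine (Real.rpow_le_rpow (abs_nonneg _) h1 (by linarith)).trans ?_
  exact (convexOn_rpow hq).2 (abs_nonneg x) (abs_nonneg y) hs ht hst

theorem abs_rpow_mul_sq {p : ℝ} (hp : 2 < p) (x : ℝ) : |x| ^ (p - 2) * x ^ 2 = |x| ^ p := by
  rcases eq_or_ne x 0 with rfl | hx
  · simp [Real.zero_rpow (by linarith : p ≠ 0)]
  · rw [← sq_abs, ← Real.rpow_natCast, ← Real.rpow_add (abs_pos.2 hx)]
    norm_num

theorem hasDerivAt_abs_rpow_mul_self (x : ℝ) {p : ℝ} (hp : 3 < p) :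
    HasDerivAt (fun x : ℝ => |x| ^ (p - 2) * x) ((p - 1) * |x| ^ (p - 2)) x := by
  have h := (hasDerivAt_abs_rpow x (p := p - 2) (by linarith)).mul (hasDerivAt_id x)
  refine h.congr_deriv ?_
  rcases eq_or_ne x 0 with rfl | hx
  · simp [Real.zero_rpow (by linarith : p - 2 ≠ 0)]
  · have h2 : |x| ^ (p - 2 - 2) * x ^ 2 = |x| ^ (p - 2) := by
      rw [← sq_abs, ← Real.rpow_natCast, ← Real.rpow_add (abs_pos.2 hx)]
      norm_num
    simp only [id, mul_one]
    linear_combination (p - 2) * h2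

theorem monotone_abs_rpow_mul_self {q : ℝ} (hq : 1 < q) :
    Monotone fun x : ℝ => q * |x| ^ (q - 2) * x := by
  have h := (convexOn_abs_rpow hq.le).monotoneOn_deriv
    (fun x _ => (hasDerivAt_abs_rpow x hq).differentiableAt)
  intro x y hxy
  have := h (Set.mem_univ x) (Set.mem_univ y) hxy
  rwa [(hasDerivAt_abs_rpow x hq).deriv, (hasDerivAt_abs_rpow y hq).deriv] at this

/-- Symmetrised second-order Taylor bound for `|·| ^ p`, whose second derivative is convex. -/
theorem taylor_le_avg_abs_rpow {p : ℝ} (hp : 4 ≤ p) (y a : ℝ) :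
    |y| ^ p + p * (p - 1) / 2 * a ^ 2 * |y| ^ (p - 2) ≤ (|y + a| ^ p + |y - a| ^ p) / 2 := by
  set φ : ℝ → ℝ := fun x => |x| ^ (p - 2) * x with hφ
  have hline : ∀ c t : ℝ, HasDerivAt (fun t => y + t * c) c t := fun c t => by
    simpa using ((hasDerivAt_id t).mul_const c).const_add y
  have hf : ∀ c t : ℝ, HasDerivAt (fun t => |y + t * c| ^ p) (p * φ (y + t * c) * c) t := by
    intro c t
    have := (hasDerivAt_abs_rpow (y + t * c) (p := p) (by linarith)).comp t (hline c t)
    simpa [hφ, mul_assoc, Function.comp_def] using this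
  have hf' : ∀ c t : ℝ, HasDerivAt (fun t => φ (y + t * c))
      ((p - 1) * |y + t * c| ^ (p - 2) * c) t := by
    intro c t
    exact (hasDerivAt_abs_rpow_mul_self (y + t * c) (p := p) (by linarith)).comp t (hline c t)
  set g : ℝ → ℝ := fun t => (|y + t * a| ^ p + |y + t * (-a)| ^ p) / 2
    - p * (p - 1) / 2 * a ^ 2 * |y| ^ (p - 2) * t ^ 2 with hg
  set g' : ℝ → ℝ := fun t => (p * φ (y + t * a) * a + p * φ (y + t * (-a)) * (-a)) / 2
    - p * (p - 1) / 2 * a ^ 2 * |y| ^ (p - 2) * (2 * t) with hg'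
  have h1 : ∀ t, HasDerivAt g (g' t) t := by
    intro t
    refine (((hf a t).add (hf (-a) t)).div_const 2).sub ?_
    simpa using (hasDerivAt_pow 2 t).const_mul (p * (p - 1) / 2 * a ^ 2 * |y| ^ (p - 2))
  have h2 : ∀ t, HasDerivAt g' ((p * ((p - 1) * |y + t * a| ^ (p - 2) * a) * a
      + p * ((p - 1) * |y + t * (-a)| ^ (p - 2) * (-a)) * (-a)) / 2
      - p * (p - 1) / 2 * a ^ 2 * |y| ^ (p - 2) * (2 * 1)) t := by
    intro t
    refine ((((hf' a t).const_mul p).mul_const a).add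
      (((hf' (-a) t).const_mul p).mul_const (-a))).div_const 2 |>.sub ?_
    exact ((hasDerivAt_id t).const_mul 2).const_mul _
  have m2 : Monotone g' := monotone_of_hasDerivAt_nonneg h2 fun t => by
    have hc := (convexOn_abs_rpow (q := p - 2) (by linarith)).2 (Set.mem_univ (y + t * a))
      (Set.mem_univ (y + t * (-a))) (by norm_num : (0:ℝ) ≤ 1/2) (by norm_num : (0:ℝ) ≤ 1/2)
      (by norm_num)
    have e : (1/2 : ℝ) • (y + t * a) + (1/2 : ℝ) • (y + t * (-a)) = y := by
      simp only [smul_eq_mul]; ring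
    rw [e] at hc
    simp only [smul_eq_mul] at hc
    have : 0 ≤ p * (p - 1) * a ^ 2 := by
      have : 0 ≤ p - 1 := by linarith
      positivity
    simp only [Pi.zero_apply]
    nlinarith [mul_le_mul_of_nonneg_left hc this]
  have h0 : g' 0 = 0 := by simp [hg']
  have m1 : MonotoneOn g (Set.Ici 0) := by
    refine monotoneOn_of_deriv_nonneg (convex_Ici 0)
      (fun t _ => (h1 t).continuousAt.continuousWithinAt)
      (fun t _ => (h1 t).differentiableAt.differentiableWithinAt) fun t ht => ?_
    rw [interior_Ici] at ht
    rw [(h1 t).deriv, ← h0]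
    exact m2 (le_of_lt ht)
  have := m1 (Set.mem_Ici.2 le_rfl) (Set.mem_Ici.2 zero_le_one) zero_le_one
  simp only [hg, zero_mul, add_zero, one_mul, one_pow, mul_one, ne_eq, OfNat.ofNat_ne_zero,
    not_false_eq_true, zero_pow, mul_zero, sub_zero] at this
  rw [← sub_eq_add_neg] at this
  linarith

/-- The trapezoid rule overestimates the integral of the convex function `|·| ^ (p - 2)`. -/
theorem abs_rpow_mul_self_sub_le {p : ℝ} (hp : 4 ≤ p) (x a : ℝ) :
    a * (|x + a| ^ (p - 2) * (x + a) - |x - a| ^ (p - 2) * (x - a))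
      ≤ (p - 1) * a ^ 2 * (|x + a| ^ (p - 2) + |x - a| ^ (p - 2)) := by
  wlog ha : 0 ≤ a generalizing a
  · have := this (-a) (by linarith)
    simp only [sub_neg_eq_add, ← sub_eq_add_neg, neg_sq] at this
    linarith
  set φ : ℝ → ℝ := fun x => |x| ^ (p - 2) * x with hφ
  set g : ℝ → ℝ := fun t => (p - 1) * (t * (|x + t| ^ (p - 2) + |x - t| ^ (p - 2)))
    - (φ (x + t) - φ (x - t)) with hg
  have hk1 : ∀ t, HasDerivAt (fun t => |x + t| ^ (p - 2))
      ((p - 2) * |x + t| ^ (p - 2 - 2) * (x + t)) t := fun t => by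
    simpa using (hasDerivAt_abs_rpow (x + t) (p := p - 2) (by linarith)).comp_const_add x t
  have hk2 : ∀ t, HasDerivAt (fun t => |x - t| ^ (p - 2))
      (-((p - 2) * |x - t| ^ (p - 2 - 2) * (x - t))) t := fun t => by
    simpa using (hasDerivAt_abs_rpow (x - t) (p := p - 2) (by linarith)).comp_const_sub x t
  have hp1 : ∀ t, HasDerivAt (fun t => φ (x + t)) ((p - 1) * |x + t| ^ (p - 2)) t := fun t =>
    (hasDerivAt_abs_rpow_mul_self (x + t) (p := p) (by linarith)).comp_const_add x t
  have hp2 : ∀ t, HasDerivAt (fun t => φ (x - t)) (-((p - 1) * |x - t| ^ (p - 2))) t := fun t =>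
    (hasDerivAt_abs_rpow_mul_self (x - t) (p := p) (by linarith)).comp_const_sub x t
  have hgd : ∀ t, HasDerivAt g ((p - 1) * t * ((p - 2) * |x + t| ^ (p - 2 - 2) * (x + t)
      - (p - 2) * |x - t| ^ (p - 2 - 2) * (x - t))) t := fun t => by
    refine ((((hasDerivAt_id t).mul ((hk1 t).add (hk2 t))).const_mul (p - 1)).sub
      ((hp1 t).sub (hp2 t))).congr_deriv ?_
    simp only [id, Pi.add_apply]; ring
  have m1 : MonotoneOn g (Set.Ici 0) := by
    refine monotoneOn_of_deriv_nonneg (convex_Ici 0)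
      (fun t _ => (hgd t).continuousAt.continuousWithinAt)
      (fun t _ => (hgd t).differentiableAt.differentiableWithinAt) fun t ht => ?_
    rw [interior_Ici] at ht
    have ht : 0 < t := ht
    rw [(hgd t).deriv]
    have := monotone_abs_rpow_mul_self (q := p - 2) (by linarith)
      (by linarith : x - t ≤ x + t)
    have h3 : 0 ≤ (p - 1) * t := mul_nonneg (by linarith) ht.le
    exact mul_nonneg h3 (by simpa using this)
  have := m1 (Set.mem_Ici.2 le_rfl) (Set.mem_Ici.2 ha) ha
  simp only [hg, zero_mul, add_zero, sub_zero, mul_zero, sub_self] at this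
  have := mul_nonneg ha this
  simp only [hφ] at this
  linarith

/-- One more sign raises a moment at least as fast as it would raise the moment of a Laplace sum, apart
from the lower moment being that of the smaller sum. -/
theorem radE_abs_rpow_succ_ge {p : ℝ} (hp : 4 ≤ p) (b : ℕ → ℝ) (k : ℕ) :
    radE b k (fun x => |x| ^ p) + p * (p - 1) / 2 * b k ^ 2 * radE b k (fun x => |x| ^ (p - 2))
      ≤ radE b (k + 1) (fun x => |x| ^ p) := by
  rw [radE_succ_avg, ← radE_const_mul, ← radE_add]
  exact radE_mono _ _ fun x => taylor_le_avg_abs_rpow hp x (b k)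

/-- The shift `z` collects the signs that have already been fixed, so that the induction on the number
of signs closes. -/
theorem radE_mul_shift_le {p : ℝ} (hp : 4 ≤ p) (b : ℕ → ℝ) (k : ℕ) (z : ℝ) :
    radE b k (fun x => x * (|z + x| ^ (p - 2) * (z + x)))
      ≤ (p - 1) * (∑ i ∈ Finset.range k, b i ^ 2) * radE b k (fun x => |z + x| ^ (p - 2)) := by
  induction k generalizing z with
  | zero => simp [radE]
  | succ k ih =>
    have h1 := ih (z + b k)
    have h2 := ih (z - b k)
    have h3 : radE b k (fun x => b k * (|z + x + b k| ^ (p - 2) * (z + x + b k)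
        - |z + x - b k| ^ (p - 2) * (z + x - b k)))
        ≤ (p - 1) * b k ^ 2 * (radE b k (fun x => |z + b k + x| ^ (p - 2))
          + radE b k (fun x => |z - b k + x| ^ (p - 2))) := by
      rw [← radE_add, ← radE_const_mul]
      refine radE_mono _ _ fun x => (abs_rpow_mul_self_sub_le hp (z + x) (b k)).trans_eq ?_
      rw [show z + x + b k = z + b k + x by ring, show z + x - b k = z - b k + x by ring]
    have e1 : radE b (k + 1) (fun x => x * (|z + x| ^ (p - 2) * (z + x)))
        = (radE b k (fun x => x * (|z + b k + x| ^ (p - 2) * (z + b k + x)))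
          + radE b k (fun x => x * (|z - b k + x| ^ (p - 2) * (z - b k + x)))
          + radE b k (fun x => b k * (|z + x + b k| ^ (p - 2) * (z + x + b k)
            - |z + x - b k| ^ (p - 2) * (z + x - b k)))) / 2 := by
      rw [radE, ← radE_add, ← radE_add, ← radE_add]
      congr 2; ext x
      rw [show z + (x + b k) = z + b k + x by ring, show z + (x - b k) = z - b k + x by ring,
        show z + x + b k = z + b k + x by ring, show z + x - b k = z - b k + x by ring]
      ring
    have e2 : radE b (k + 1) (fun x => |z + x| ^ (p - 2))
        = (radE b k (fun x => |z + b k + x| ^ (p - 2))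
          + radE b k (fun x => |z - b k + x| ^ (p - 2))) / 2 := by
      rw [radE]; congr 3 <;> ext x <;> congr 2 <;> ring
    rw [e1, e2, Finset.sum_range_succ]
    linarith

/-- Integrating by parts against each sign lowers the exponent by two. -/
theorem radE_abs_rpow_le {p : ℝ} (hp : 4 ≤ p) (b : ℕ → ℝ) (k : ℕ) :
    radE b k (fun x => |x| ^ p)
      ≤ (p - 1) * (∑ i ∈ Finset.range k, b i ^ 2) * radE b k (fun x => |x| ^ (p - 2)) := by
  have h := radE_mul_shift_le hp b k 0
  simp only [zero_add] at h
  convert h using 2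
  ext x
  rw [← abs_rpow_mul_sq (by linarith)]; ring

theorem radE_sq (b : ℕ → ℝ) (k : ℕ) :
    radE b k (fun x => x ^ 2) = ∑ i ∈ Finset.range k, b i ^ 2 := by
  induction k with
  | zero => simp [radE]
  | succ k ih =>
    rw [radE_succ_avg, Finset.sum_range_succ, ← ih, ← radE_const b k (b k ^ 2), ← radE_add]
    congr 1; ext x; ring

theorem radE_cos (b : ℕ → ℝ) (k : ℕ) (t : ℝ) :
    radE b k (fun x => Real.cos (t * x)) = ∏ i ∈ Finset.range k, Real.cos (b i * t) := by
  induction k with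
  | zero => simp [radE]
  | succ k ih =>
    rw [radE_succ_avg, Finset.prod_range_succ, ← ih, mul_comm, ← radE_const_mul]
    congr 1; ext x
    rw [mul_add, mul_sub, Real.cos_add, Real.cos_sub, mul_comm t (b k)]; ring

theorem radE_pow_four_le (b : ℕ → ℝ) (k : ℕ) :
    radE b k (fun x => x ^ 4) ≤ 3 * (∑ i ∈ Finset.range k, b i ^ 2) ^ 2 := by
  have h := radE_abs_rpow_le le_rfl b k
  have e4 : (fun x : ℝ => |x| ^ (4 : ℝ)) = fun x => x ^ 4 := by
    ext x; rw [show (4:ℝ) = ((4:ℕ):ℝ) by norm_num, Real.rpow_natCast, Even.pow_abs (by decide)]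
  have e2 : (fun x : ℝ => |x| ^ ((4 : ℝ) - 2)) = fun x => x ^ 2 := by
    ext x; rw [show (4:ℝ) - 2 = ((2:ℕ):ℝ) by norm_num, Real.rpow_natCast, sq_abs]
  rw [e4, e2, radE_sq] at h
  linarith

theorem radE_pow_six_le (b : ℕ → ℝ) (k : ℕ) :
    radE b k (fun x => x ^ 6) ≤ 15 * (∑ i ∈ Finset.range k, b i ^ 2) ^ 3 := by
  have h := radE_abs_rpow_le (by norm_num : (4:ℝ) ≤ 6) b k
  have e4 : (fun x : ℝ => |x| ^ (6 : ℝ)) = fun x => x ^ 6 := by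
    ext x; rw [show (6:ℝ) = ((6:ℕ):ℝ) by norm_num, Real.rpow_natCast, Even.pow_abs (by decide)]
  have e2 : (fun x : ℝ => |x| ^ ((6 : ℝ) - 2)) = fun x => x ^ 4 := by
    ext x
    rw [show (6:ℝ) - 2 = ((4:ℕ):ℝ) by norm_num, Real.rpow_natCast, Even.pow_abs (by decide)]
  rw [e4, e2] at h
  have h4 := radE_pow_four_le b k
  have h0 : 0 ≤ ∑ i ∈ Finset.range k, b i ^ 2 := Finset.sum_nonneg fun _ _ => sq_nonneg _
  nlinarith [mul_le_mul_of_nonneg_left h4 h0]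

/-! ### The symmetric exponential law -/

theorem integrable_of_integrableOn_Ioi {G : ℝ → ℝ} (h1 : IntegrableOn G (Set.Ioi 0))
    (h2 : IntegrableOn (fun x => G (-x)) (Set.Ioi 0)) : Integrable G := by
  have h3 : IntegrableOn G (Set.Iic 0) := by
    rw [← Measure.map_neg_eq_self (volume : Measure ℝ)]
    let m : MeasurableEmbedding fun x : ℝ => -x := (Homeomorph.neg ℝ).measurableEmbedding
    rw [m.integrableOn_map_iff]
    simp_rw [Function.comp_def, Set.neg_preimage, Set.neg_Iic, neg_zero]
    exact Iff.mpr integrableOn_Ici_iff_integrableOn_Ioi h2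
  rw [← integrableOn_univ, ← Set.Iic_union_Ioi (a := (0:ℝ))]
  exact h3.union h1

theorem integral_eq_integral_Ioi_add_neg {G : ℝ → ℝ} (hG : Integrable G) :
    ∫ x, G x = (∫ x in Set.Ioi 0, G x) + ∫ x in Set.Ioi 0, G (-x) := by
  rw [integral_comp_neg_Ioi, neg_zero, add_comm, ← setIntegral_union (Set.Iic_disjoint_Ioi le_rfl)
    measurableSet_Ioi hG.integrableOn hG.integrableOn, Set.Iic_union_Ioi, setIntegral_univ]

theorem PolyGrowth.integrableOn_mul_exp_neg {F : ℝ → ℝ} (hF : PolyGrowth F) {c : ℝ} (hc : 0 < c) :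
    IntegrableOn (fun x => F x * Real.exp (-c * x)) (Set.Ioi 0) := by
  obtain ⟨hF, C, n, hC⟩ := hF
  have h : ∀ m : ℕ, IntegrableOn (fun x : ℝ => x ^ m * Real.exp (-c * x)) (Set.Ioi 0) := by
    intro m
    have := integrableOn_rpow_mul_exp_neg_mul_rpow (p := 1) (s := m) (b := c)
      (by have : (0:ℝ) ≤ m := m.cast_nonneg
          linarith) one_pos hc
    simpa using this
  refine (((h 0).add (h n)).const_mul C).mono' (by fun_prop) ?_
  filter_upwards [ae_restrict_mem measurableSet_Ioi] with x hx
  have hx : 0 < x := hx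
  rw [Real.norm_eq_abs, abs_mul, abs_of_pos (Real.exp_pos _)]
  have := hC x
  rw [abs_of_pos hx] at this
  calc _ ≤ C * (1 + x ^ n) * Real.exp (-c * x) := by gcongr
    _ = _ := by simp; ring

theorem PolyGrowth.tendsto_mul_exp_neg {F : ℝ → ℝ} (hF : PolyGrowth F) {c : ℝ} (hc : 0 < c) :
    Filter.Tendsto (fun x => F x * Real.exp (-c * x)) Filter.atTop (nhds 0) := by
  obtain ⟨hF, C, n, hC⟩ := hF
  have h : ∀ m : ℕ, Filter.Tendsto (fun x : ℝ => x ^ m * Real.exp (-c * x))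
      Filter.atTop (nhds 0) := by
    intro m
    have h1 := ((Real.tendsto_pow_mul_exp_neg_atTop_nhds_zero m).comp
      (Filter.tendsto_id.const_mul_atTop hc)).const_mul ((c ^ m)⁻¹)
    rw [mul_zero] at h1
    refine h1.congr fun x => ?_
    simp only [Function.comp_apply, _root_.id, mul_pow, neg_mul]
    field_simp
  have h2 := ((h 0).add (h n)).const_mul C
  rw [add_zero, mul_zero] at h2
  refine squeeze_zero_norm' ?_ h2
  filter_upwards [Filter.eventually_gt_atTop 0] with x hx
  rw [Real.norm_eq_abs, abs_mul, abs_of_pos (Real.exp_pos _)]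
  have := hC x
  rw [abs_of_pos hx] at this
  calc _ ≤ C * (1 + x ^ n) * Real.exp (-c * x) := by gcongr
    _ = _ := by simp; ring

theorem PolyGrowth.neg {F : ℝ → ℝ} (hF : PolyGrowth F) : PolyGrowth fun x => F (-x) := by
  simpa using hF.comp_affine 0 (-1)

theorem PolyGrowth.integrable_mul_exp_neg_abs {F : ℝ → ℝ} (hF : PolyGrowth F) {c : ℝ}
    (hc : 0 < c) : Integrable fun x => F x * Real.exp (-c * |x|) := by
  refine integrable_of_integrableOn_Ioi ?_ ?_
  · refine (hF.integrableOn_mul_exp_neg hc).congr_fun (fun x hx => ?_) measurableSet_Ioi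
    simp only [abs_of_pos (show 0 < x from hx)]
  · refine (hF.neg.integrableOn_mul_exp_neg hc).congr_fun (fun x hx => ?_) measurableSet_Ioi
    simp only [abs_neg, abs_of_pos (show 0 < x from hx)]

theorem integral_symmExpLaw_eq (F : ℝ → ℝ) :
    ∫ x, F x ∂symmExpLaw = ∫ x, (√2)⁻¹ * (F x * Real.exp (-√2 * |x|)) := by
  unfold symmExpLaw
  rw [integral_withDensity_eq_integral_toReal_smul (by fun_prop)
    (Filter.Eventually.of_forall fun x => ENNReal.ofReal_lt_top)]
  refine integral_congr_ae (Filter.Eventually.of_forall fun x => ?_)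
  simp only [smul_eq_mul]
  rw [ENNReal.toReal_ofReal (by positivity)]; ring

theorem PolyGrowth.integrable_symmExpLaw {F : ℝ → ℝ} (hF : PolyGrowth F) :
    Integrable F symmExpLaw := by
  unfold symmExpLaw
  rw [integrable_withDensity_iff_integrable_smul' (by fun_prop)
    (Filter.Eventually.of_forall fun x => ENNReal.ofReal_lt_top)]
  refine ((hF.integrable_mul_exp_neg_abs (c := √2) (by positivity)).const_mul (√2)⁻¹).congr
    (Filter.Eventually.of_forall fun x => ?_)
  simp only [smul_eq_mul]
  rw [ENNReal.toReal_ofReal (by positivity)]; ring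

theorem integral_symmExpLaw {F : ℝ → ℝ} (hF : PolyGrowth F) :
    ∫ x, F x ∂symmExpLaw = (√2)⁻¹ * ((∫ x in Set.Ioi 0, F x * Real.exp (-√2 * x))
      + ∫ x in Set.Ioi 0, F (-x) * Real.exp (-√2 * x)) := by
  rw [integral_symmExpLaw_eq, integral_const_mul,
    integral_eq_integral_Ioi_add_neg (hF.integrable_mul_exp_neg_abs (by positivity))]
  congr 2 <;> refine setIntegral_congr_fun measurableSet_Ioi fun x hx => ?_
  · simp only [abs_of_pos (show 0 < x from hx)]
  · simp only [abs_neg, abs_of_pos (show 0 < x from hx)]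

/-- Two integrations by parts against the exponential weight. -/
theorem integral_Ioi_mul_exp_neg_eq {h h' h'' : ℝ → ℝ} (d1 : ∀ x, HasDerivAt h (h' x) x)
    (d2 : ∀ x, HasDerivAt h' (h'' x) x) (g0 : PolyGrowth h) (g1 : PolyGrowth h')
    (g2 : PolyGrowth h'') {c : ℝ} (hc : 0 < c) :
    ∫ x in Set.Ioi 0, h x * Real.exp (-c * x)
      = h 0 / c + h' 0 / c ^ 2 + (∫ x in Set.Ioi 0, h'' x * Real.exp (-c * x)) / c ^ 2 := by
  have hd : ∀ x ∈ Set.Ici (0:ℝ), HasDerivAt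
      (fun x => (-(1 / c)) * (h x * Real.exp (-c * x)) + (-(1 / c ^ 2)) * (h' x * Real.exp (-c * x)))
      (h x * Real.exp (-c * x) - (1 / c ^ 2) * (h'' x * Real.exp (-c * x))) x := by
    intro x _
    have he : HasDerivAt (fun x => Real.exp (-c * x)) (Real.exp (-c * x) * (-c)) x := by
      simpa using ((hasDerivAt_id x).const_mul (-c)).exp
    refine ((((d1 x).mul he).const_mul (-(1 / c))).add
      (((d2 x).mul he).const_mul (-(1 / c ^ 2)))).congr_deriv ?_
    field_simp; ring
  have hi1 := g0.integrableOn_mul_exp_neg hc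
  have hi2 := (g2.integrableOn_mul_exp_neg hc).const_mul (1 / c ^ 2)
  have ht : Filter.Tendsto
      (fun x => (-(1 / c)) * (h x * Real.exp (-c * x)) + (-(1 / c ^ 2)) * (h' x * Real.exp (-c * x)))
      Filter.atTop (nhds 0) := by
    have := ((g0.tendsto_mul_exp_neg hc).const_mul (-(1 / c))).add
      ((g1.tendsto_mul_exp_neg hc).const_mul (-(1 / c ^ 2)))
    rwa [mul_zero, mul_zero, add_zero] at this
  have := integral_Ioi_of_hasDerivAt_of_tendsto' hd (hi1.sub hi2) ht
  rw [integral_sub hi1 hi2, integral_const_mul] at this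
  simp only [mul_zero, Real.exp_zero, mul_one] at this
  rw [sub_eq_iff_eq_add] at this
  rw [this]; ring

/-- The Laplace density is the resolvent kernel of `1 - D² / 2`, so averaging against it trades a
function for its second derivative. -/
theorem integral_symmExpLaw_affine {f f' f'' : ℝ → ℝ} (d1 : ∀ x, HasDerivAt f (f' x) x)
    (d2 : ∀ x, HasDerivAt f' (f'' x) x) (g0 : PolyGrowth f) (g1 : PolyGrowth f')
    (g2 : PolyGrowth f'') (w a : ℝ) :
    ∫ y, f (w + a * y) ∂symmExpLaw
      = f w + a ^ 2 / 2 * ∫ y, f'' (w + a * y) ∂symmExpLaw := by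
  have key : ∀ b : ℝ, ∫ x in Set.Ioi 0, f (w + b * x) * Real.exp (-√2 * x)
      = f w / √2 + (b * f' w) / (√2) ^ 2
        + b ^ 2 * (∫ x in Set.Ioi 0, f'' (w + b * x) * Real.exp (-√2 * x)) / (√2) ^ 2 := by
    intro b
    have hl : ∀ x : ℝ, HasDerivAt (fun x => w + b * x) b x := fun x => by
      simpa using ((hasDerivAt_id x).const_mul b).const_add w
    have h := integral_Ioi_mul_exp_neg_eq (h := fun x => f (w + b * x))
      (h' := fun x => b * f' (w + b * x)) (h'' := fun x => b ^ 2 * f'' (w + b * x))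
      (fun x => ((d1 _).comp x (hl x)).congr_deriv (mul_comm _ _))
      (fun x => (((d2 _).comp x (hl x)).const_mul b).congr_deriv (by ring))
      (g0.comp_affine w b) ((g1.comp_affine w b).const_mul b)
      ((g2.comp_affine w b).const_mul (b ^ 2)) (c := √2) (by positivity)
    rw [h]
    simp only [mul_zero, add_zero, mul_assoc, integral_const_mul]
  rw [integral_symmExpLaw (g0.comp_affine w a), integral_symmExpLaw (g2.comp_affine w a), key a]
  have e : ∀ F : ℝ → ℝ, (fun x => F (w + a * -x) * Real.exp (-√2 * x))
      = fun x => F (w + (-a) * x) * Real.exp (-√2 * x) := by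
    intro F; ext x; rw [show a * -x = -a * x by ring]
  simp only [e f, e f'']
  rw [key (-a)]
  have h2 : √2 ^ 2 = 2 := Real.sq_sqrt (by norm_num)
  have h3 : √2 ≠ 0 := by positivity
  have h4 : (√2)⁻¹ * (f w / √2) = f w / 2 := by
    field_simp; rw [h2]; ring
  rw [h2]
  linear_combination 2 * h4

instance : IsProbabilityMeasure symmExpLaw := by
  have h := integral_symmExpLaw (PolyGrowth.const 1)
  have h1 := integral_Ioi_mul_exp_neg_eq (h := fun _ => 1) (h' := fun _ => 0) (h'' := fun _ => 0)
    (fun x => hasDerivAt_const x 1) (fun x => hasDerivAt_const x 0) (PolyGrowth.const 1)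
    (PolyGrowth.const 0) (PolyGrowth.const 0) (c := √2) (by positivity)
  rw [h1] at h
  have hfin : IsFiniteMeasure symmExpLaw :=
    (integrable_const_iff_isFiniteMeasure (c := (1:ℝ)) one_ne_zero).1
      (PolyGrowth.const 1).integrable_symmExpLaw
  refine ⟨?_⟩
  have h2 : √2 ^ 2 = 2 := Real.sq_sqrt (by norm_num)
  have h3 : √2 ≠ 0 := by positivity
  have h5 : (symmExpLaw.real Set.univ) = 1 := by
    simp only [integral_const, smul_eq_mul, mul_one, zero_mul, zero_div, mul_zero, add_zero] at h
    rw [h]; field_simp; rw [h2]; norm_num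
  rw [Measure.real, ENNReal.toReal_eq_one_iff] at h5
  exact h5

theorem hasMoments_symmExpLaw : HasMoments symmExpLaw := fun n =>
  (PolyGrowth.abs.pow n).integrable_symmExpLaw

theorem integral_cos_symmExpLaw (t w a : ℝ) :
    ∫ y, Real.cos (t * (w + a * y)) ∂symmExpLaw
      = Real.cos (t * w) / (1 + (a * t) ^ 2 / 2) := by
  have hl : ∀ x : ℝ, HasDerivAt (fun x => t * x) t x := fun x => by
    simpa using (hasDerivAt_id x).const_mul t
  have b0 : PolyGrowth fun x => Real.cos (t * x) :=
    PolyGrowth.of_bounded (by fun_prop) fun x => Real.abs_cos_le_one _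
  have b1 : PolyGrowth fun x => Real.sin (t * x) :=
    PolyGrowth.of_bounded (by fun_prop) fun x => Real.abs_sin_le_one _
  have h := integral_symmExpLaw_affine (f := fun x => Real.cos (t * x))
    (f' := fun x => (-t) * Real.sin (t * x)) (f'' := fun x => (-t ^ 2) * Real.cos (t * x))
    (fun x => (hl x).cos.congr_deriv (by ring))
    (fun x => ((hl x).sin.const_mul (-t)).congr_deriv (by ring))
    b0 (b1.const_mul _) (b0.const_mul _) w a
  rw [integral_const_mul] at h
  rw [eq_div_iff (by positivity)]
  linear_combination h

theorem integral_sq_symmExpLaw (w a : ℝ) :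
    ∫ y, (w + a * y) ^ 2 ∂symmExpLaw = w ^ 2 + a ^ 2 := by
  have h := integral_symmExpLaw_affine (f := fun x => x ^ 2)
    (f' := fun x => 2 * x) (f'' := fun x => 2)
    (fun x => by simpa using hasDerivAt_pow 2 x)
    (fun x => by simpa using (hasDerivAt_id x).const_mul 2)
    (PolyGrowth.id.pow 2) (PolyGrowth.id.const_mul 2) (PolyGrowth.const 2) w a
  rw [h]; simp

theorem integral_cos_sumLaw_symmExpLaw (b : ℕ → ℝ) (k : ℕ) (t : ℝ) :
    ∫ x, Real.cos (t * x) ∂(sumLaw symmExpLaw b k)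
      = ∏ i ∈ Finset.range k, (1 + (b i * t) ^ 2 / 2)⁻¹ := by
  induction k with
  | zero => rw [integral_sumLaw_zero]; simp
  | succ k ih =>
    rw [integral_sumLaw_succ hasMoments_symmExpLaw b k (F := fun x => Real.cos (t * x))
      (PolyGrowth.of_bounded (by fun_prop) fun x => Real.abs_cos_le_one _)]
    simp only [integral_cos_symmExpLaw]
    rw [integral_div, div_eq_mul_inv, ih, Finset.prod_range_succ]

theorem integral_sq_sumLaw_symmExpLaw (b : ℕ → ℝ) (k : ℕ) :
    ∫ x, x ^ 2 ∂(sumLaw symmExpLaw b k) = ∑ i ∈ Finset.range k, b i ^ 2 := by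
  induction k with
  | zero => rw [integral_sumLaw_zero]; simp
  | succ k ih =>
    rw [integral_sumLaw_succ hasMoments_symmExpLaw b k (PolyGrowth.id.pow 2)]
    simp only [integral_sq_symmExpLaw]
    rw [integral_add ((hasMoments_symmExpLaw.sumLaw b k).integrable (PolyGrowth.id.pow 2))
      (integrable_const _), ih, Finset.sum_range_succ]
    simp

/-- Adding an independent Laplace variable raises a moment by a multiple of the moment, two
orders lower, of the enlarged sum. -/
theorem integral_abs_rpow_sumLaw_symmExpLaw_succ {p : ℝ} (hp : 4 ≤ p) (b : ℕ → ℝ) (k : ℕ) :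
    ∫ x, |x| ^ p ∂(sumLaw symmExpLaw b (k + 1)) = ∫ x, |x| ^ p ∂(sumLaw symmExpLaw b k)
      + p * (p - 1) / 2 * b k ^ 2 * ∫ x, |x| ^ (p - 2) ∂(sumLaw symmExpLaw b (k + 1)) := by
  have g0 : PolyGrowth fun x => |x| ^ p := PolyGrowth.abs_rpow (by linarith)
  have g2 : PolyGrowth fun x => |x| ^ (p - 2) := PolyGrowth.abs_rpow (by linarith)
  have h := integral_symmExpLaw_affine (f := fun x => |x| ^ p)
    (f' := fun x => p * (|x| ^ (p - 2) * x)) (f'' := fun x => (p * (p - 1)) * |x| ^ (p - 2))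
    (fun x => (hasDerivAt_abs_rpow x (by linarith)).congr_deriv (by ring))
    (fun x => ((hasDerivAt_abs_rpow_mul_self x (by linarith)).const_mul p).congr_deriv (by ring))
    g0 ((g2.mul PolyGrowth.id).const_mul p) (g2.const_mul _)
  rw [integral_sumLaw_succ hasMoments_symmExpLaw b k g0,
    integral_sumLaw_succ hasMoments_symmExpLaw b k g2]
  simp only [h]
  simp only [integral_const_mul]
  rw [integral_add ((hasMoments_symmExpLaw.sumLaw b k).integrable g0)
    (((integrable_integral_sumLaw hasMoments_symmExpLaw b k g2).const_mul _).const_mul _),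
    integral_const_mul, integral_const_mul]
  ring

/-! ### Fourier representation of moments of order between two and four -/

theorem integrableOn_mul_rpow {φ : ℝ → ℝ} (hm : Measurable φ) {C p : ℝ} {m n : ℕ}
    (h0 : ∀ u, 0 < u → u ≤ 1 → |φ u| ≤ C * u ^ m) (h1 : ∀ u, 1 < u → |φ u| ≤ C * u ^ n)
    (hn : n < p) (hm' : p < m) :
    IntegrableOn (fun u => φ u * u ^ (-p - 1)) (Set.Ioi 0) := by
  have hmeas : Measurable fun u : ℝ => φ u * u ^ (-p - 1) := by fun_prop
  rw [← Set.Ioc_union_Ioi_eq_Ioi (zero_le_one' ℝ)]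
  refine IntegrableOn.union ?_ ?_
  · have hi : IntegrableOn (fun u : ℝ => C * u ^ ((m : ℝ) - p - 1)) (Set.Ioc 0 1) := by
      refine Integrable.const_mul ?_ _
      have := (intervalIntegral.intervalIntegrable_rpow' (a := 0) (b := 1)
        (r := (m : ℝ) - p - 1) (by linarith)).1
      exact this
    refine hi.mono' hmeas.aestronglyMeasurable ?_
    filter_upwards [ae_restrict_mem measurableSet_Ioc] with u hu
    rw [Real.norm_eq_abs, abs_mul, abs_of_pos (Real.rpow_pos_of_pos hu.1 _)]
    calc |φ u| * u ^ (-p - 1) ≤ C * u ^ m * u ^ (-p - 1) := by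
          have := Real.rpow_pos_of_pos hu.1 (-p - 1)
          gcongr
          exact h0 u hu.1 hu.2
      _ = C * u ^ ((m : ℝ) - p - 1) := by
          rw [mul_assoc, ← Real.rpow_natCast, ← Real.rpow_add hu.1]; congr 2; ring
  · have hi : IntegrableOn (fun u : ℝ => C * u ^ ((n : ℝ) - p - 1)) (Set.Ioi 1) :=
      (integrableOn_Ioi_rpow_of_lt (by linarith) one_pos).const_mul _
    refine hi.mono' hmeas.aestronglyMeasurable ?_
    filter_upwards [ae_restrict_mem measurableSet_Ioi] with u hu
    have hu0 : 0 < u := lt_trans one_pos hu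
    rw [Real.norm_eq_abs, abs_mul, abs_of_pos (Real.rpow_pos_of_pos hu0 _)]
    calc |φ u| * u ^ (-p - 1) ≤ C * u ^ n * u ^ (-p - 1) := by
          have := Real.rpow_pos_of_pos hu0 (-p - 1)
          gcongr
          exact h1 u hu
      _ = C * u ^ ((n : ℝ) - p - 1) := by
          rw [mul_assoc, ← Real.rpow_natCast, ← Real.rpow_add hu0]; congr 2; ring

/-- The nonnegative kernel `cos u - 1 + u² / 2`: integrating its dilates against `u ^ (-p - 1)`
produces `|·| ^ p` for `2 < p < 4`. -/
noncomputable def cosKernel (u : ℝ) : ℝ := Real.cos u - 1 + u ^ 2 / 2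

theorem cosKernel_nonneg (u : ℝ) : 0 ≤ cosKernel u := by
  have := Real.one_sub_sq_div_two_le_cos (x := u)
  unfold cosKernel; linarith

theorem cosKernel_le_sq (u : ℝ) : cosKernel u ≤ u ^ 2 := by
  have := Real.cos_le_one u
  have := sq_nonneg u
  unfold cosKernel; linarith

theorem cosKernel_le_pow_four {u : ℝ} (h0 : 0 ≤ u) (h1 : u ≤ 1) : cosKernel u ≤ u ^ 4 := by
  have h := Real.cos_bound (x := u) (by rwa [abs_of_nonneg h0])
  rw [abs_of_nonneg h0] at h
  have h2 := (abs_le.1 h).2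
  have : 0 ≤ u ^ 4 := by positivity
  unfold cosKernel; linarith

theorem continuous_cosKernel : Continuous cosKernel := by unfold cosKernel; fun_prop

theorem integrableOn_cosKernel {p : ℝ} (h2 : 2 < p) (h4 : p < 4) :
    IntegrableOn (fun u => cosKernel u * u ^ (-p - 1)) (Set.Ioi 0) := by
  refine integrableOn_mul_rpow (C := 1) (m := 4) (n := 2) continuous_cosKernel.measurable ?_ ?_
    (by exact_mod_cast h2) (by exact_mod_cast h4)
  · intro u h0 h1
    rw [abs_of_nonneg (cosKernel_nonneg u), one_mul]
    exact cosKernel_le_pow_four h0.le h1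
  · intro u _
    rw [abs_of_nonneg (cosKernel_nonneg u), one_mul]
    exact cosKernel_le_sq u

/-- The normalising constant of the Fourier representation of `|·| ^ p`. -/
noncomputable def cosConst (p : ℝ) : ℝ := ∫ u in Set.Ioi 0, cosKernel u * u ^ (-p - 1)

theorem cosConst_pos {p : ℝ} (h2 : 2 < p) (h4 : p < 4) : 0 < cosConst p := by
  unfold cosConst
  rw [setIntegral_pos_iff_support_of_nonneg_ae _ (integrableOn_cosKernel h2 h4)]
  · refine lt_of_lt_of_le ?_ (measure_mono (s := Set.Ioi 0) ?_)
    · simp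
    · intro u hu
      have hu : 0 < u := hu
      refine ⟨?_, hu⟩
      have := Real.one_sub_sq_div_two_lt_cos hu.ne'
      have h3 : 0 < cosKernel u := by unfold cosKernel; linarith
      exact (mul_pos h3 (Real.rpow_pos_of_pos hu _)).ne'
  · filter_upwards [ae_restrict_mem measurableSet_Ioi] with u hu
    exact mul_nonneg (cosKernel_nonneg u) (Real.rpow_nonneg (le_of_lt hu) _)

theorem integral_comp_mul_rpow (φ : ℝ → ℝ) {c : ℝ} (hc : 0 < c) (p : ℝ) :
    ∫ u in Set.Ioi 0, φ (c * u) * u ^ (-p - 1)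
      = c ^ p * ∫ u in Set.Ioi 0, φ u * u ^ (-p - 1) := by
  have h := integral_comp_mul_left_Ioi' (fun u => φ u * u ^ (-p - 1)) 0 hc
  rw [mul_zero] at h
  rw [← h, smul_eq_mul, ← mul_assoc, ← integral_const_mul]
  refine setIntegral_congr_fun measurableSet_Ioi fun u hu => ?_
  have hu : 0 < u := hu
  rw [Real.mul_rpow hc.le hu.le]
  have : c ^ p * c * c ^ (-p - 1) = 1 := by
    rw [← Real.rpow_add_one hc.ne', ← Real.rpow_add hc]; ring_nf; exact Real.rpow_zero c
  linear_combination (-(φ (c * u) * u ^ (-p - 1))) * this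

theorem integral_cosKernel_mul {p : ℝ} (hp : p ≠ 0) (x : ℝ) :
    ∫ u in Set.Ioi 0, cosKernel (x * u) * u ^ (-p - 1) = cosConst p * |x| ^ p := by
  have he : ∀ u, cosKernel (x * u) = cosKernel (|x| * u) := fun u => by
    unfold cosKernel
    rw [mul_pow, mul_pow, sq_abs, ← Real.cos_abs (x * u), ← Real.cos_abs (|x| * u), abs_mul,
      abs_mul, abs_abs]
  simp only [he]
  rcases eq_or_ne x 0 with rfl | hx
  · simp [cosKernel, Real.zero_rpow hp]
  · rw [integral_comp_mul_rpow _ (abs_pos.2 hx), mul_comm]; rfl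

theorem integrableOn_cosKernel_mul {p : ℝ} (h2 : 2 < p) (h4 : p < 4) (x : ℝ) :
    IntegrableOn (fun u => cosKernel (x * u) * u ^ (-p - 1)) (Set.Ioi 0) := by
  refine integrableOn_mul_rpow (φ := fun u => cosKernel (x * u)) (C := x ^ 2 + |x| ^ 4 + 1) (m := 4) (n := 2)
    (continuous_cosKernel.measurable.comp (by fun_prop)) ?_ ?_
    (by exact_mod_cast h2) (by exact_mod_cast h4)
  · intro u h0 h1
    rw [abs_of_nonneg (cosKernel_nonneg _)]
    rcases le_total (|x| * u) 1 with h | h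
    · have := cosKernel_le_pow_four (u := |x| * u) (by positivity) h
      have e : cosKernel (x * u) = cosKernel (|x| * u) := by
        unfold cosKernel
        rw [mul_pow, mul_pow, sq_abs, ← Real.cos_abs (x * u), ← Real.cos_abs (|x| * u), abs_mul,
          abs_mul, abs_abs]
      rw [e]
      rw [mul_pow] at this
      have : 0 ≤ (x ^ 2 + 1) * u ^ 4 := by positivity
      nlinarith
    · have := cosKernel_le_sq (x * u)
      have h3 : 1 ≤ (|x| * u) ^ 2 := one_le_pow₀ h
      have h5 : (x * u) ^ 2 = (|x| * u) ^ 2 := by rw [mul_pow, mul_pow, sq_abs]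
      have h6 : (|x| * u) ^ 2 ≤ (|x| * u) ^ 2 * (|x| * u) ^ 2 := le_mul_of_one_le_left (by positivity) h3
      have : 0 ≤ (x ^ 2 + 1) * u ^ 4 := by positivity
      calc _ ≤ (|x| * u) ^ 2 * (|x| * u) ^ 2 := by linarith
        _ = |x| ^ 4 * u ^ 4 := by ring
        _ ≤ _ := by linarith
  · intro u _
    rw [abs_of_nonneg (cosKernel_nonneg _)]
    have := cosKernel_le_sq (x * u)
    have : 0 ≤ (|x| ^ 4 + 1) * u ^ 2 := by positivity
    rw [mul_pow] at *
    linarith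

section Fourier
variable {ν : Measure ℝ} [IsProbabilityMeasure ν] {p : ℝ}

theorem integrable_prod_cosKernel (hν : HasMoments ν) (h2 : 2 < p) (h4 : p < 4) :
    Integrable (fun z : ℝ × ℝ => cosKernel (z.1 * z.2) * z.2 ^ (-p - 1))
      (ν.prod (volume.restrict (Set.Ioi 0))) := by
  have hm : Measurable fun z : ℝ × ℝ => cosKernel (z.1 * z.2) * z.2 ^ (-p - 1) :=
    (continuous_cosKernel.measurable.comp (by fun_prop)).mul (by fun_prop)
  rw [integrable_prod_iff hm.aestronglyMeasurable]
  refine ⟨Filter.Eventually.of_forall fun x => integrableOn_cosKernel_mul h2 h4 x, ?_⟩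
  have : ∀ x : ℝ, ∫ u in Set.Ioi 0, ‖cosKernel (x * u) * u ^ (-p - 1)‖ = cosConst p * |x| ^ p := by
    intro x
    rw [← integral_cosKernel_mul (by linarith)]
    refine setIntegral_congr_fun measurableSet_Ioi fun u hu => ?_
    exact Real.norm_of_nonneg
      (mul_nonneg (cosKernel_nonneg _) (Real.rpow_nonneg (le_of_lt hu) _))
  simp only [this]
  exact (hν.integrable (PolyGrowth.abs_rpow (by linarith))).const_mul _

theorem integral_cosKernel_measure (hν : HasMoments ν) (t : ℝ) :
    ∫ x, cosKernel (x * t) ∂ν = (∫ x, Real.cos (t * x) ∂ν) - 1 + (∫ x, x ^ 2 ∂ν) * t ^ 2 / 2 := by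
  have i1 : Integrable (fun x => Real.cos (t * x)) ν := hν.integrable
    (PolyGrowth.of_bounded (by fun_prop) fun x => Real.abs_cos_le_one _)
  have i2 : Integrable (fun x : ℝ => x ^ 2) ν := hν.integrable (PolyGrowth.id.pow 2)
  have e : ∀ x, cosKernel (x * t) = Real.cos (t * x) - 1 + t ^ 2 / 2 * x ^ 2 := fun x => by
    unfold cosKernel; rw [mul_comm x t]; ring
  simp only [e]
  rw [integral_add (f := fun x => Real.cos (t * x) - 1) (i1.sub (integrable_const _)) (i2.const_mul _),
    integral_sub i1 (integrable_const _), integral_const_mul]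
  simp; ring

/-- Fourier representation of the moment of order `p`, `2 < p < 4`. -/
theorem cosConst_mul_integral_abs_rpow (hν : HasMoments ν) (h2 : 2 < p) (h4 : p < 4) :
    cosConst p * ∫ x, |x| ^ p ∂ν = ∫ t in Set.Ioi 0,
      ((∫ x, Real.cos (t * x) ∂ν) - 1 + (∫ x, x ^ 2 ∂ν) * t ^ 2 / 2) * t ^ (-p - 1) := by
  rw [← integral_const_mul]
  simp only [← integral_cosKernel_mul (show p ≠ 0 by linarith)]
  rw [integral_integral_swap (integrable_prod_cosKernel hν h2 h4)]
  refine setIntegral_congr_fun measurableSet_Ioi fun t _ => ?_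
  simp only [integral_mul_const, integral_cosKernel_measure hν]

theorem integrableOn_charFun_kernel (hν : HasMoments ν) (h2 : 2 < p) (h4 : p < 4) :
    IntegrableOn (fun t => ((∫ x, Real.cos (t * x) ∂ν) - 1 + (∫ x, x ^ 2 ∂ν) * t ^ 2 / 2)
      * t ^ (-p - 1)) (Set.Ioi 0) := by
  refine (integrable_prod_cosKernel hν h2 h4).integral_prod_right.congr ?_
  refine Filter.Eventually.of_forall fun t => ?_
  simp only [integral_mul_const, integral_cosKernel_measure hν]

/-- For `2 < p < 4` moments are monotone in the Fourier data. -/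
theorem integral_abs_rpow_le_of_charFun {ν' : Measure ℝ} [IsProbabilityMeasure ν']
    (hν : HasMoments ν) (hν' : HasMoments ν') (h2 : 2 < p) (h4 : p < 4)
    (h : ∀ t, 0 < t → (∫ x, Real.cos (t * x) ∂ν) + (∫ x, x ^ 2 ∂ν) * t ^ 2 / 2
      ≤ (∫ x, Real.cos (t * x) ∂ν') + (∫ x, x ^ 2 ∂ν') * t ^ 2 / 2) :
    ∫ x, |x| ^ p ∂ν ≤ ∫ x, |x| ^ p ∂ν' := by
  refine le_of_mul_le_mul_left ?_ (cosConst_pos h2 h4)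
  rw [cosConst_mul_integral_abs_rpow hν h2 h4, cosConst_mul_integral_abs_rpow hν' h2 h4]
  refine setIntegral_mono_on (integrableOn_charFun_kernel hν h2 h4)
    (integrableOn_charFun_kernel hν' h2 h4) measurableSet_Ioi fun t ht => ?_
  refine mul_le_mul_of_nonneg_right ?_ (Real.rpow_nonneg (le_of_lt ht) _)
  linarith [h t ht]

end Fourier

/-- The `p`-th absolute moment of a standard Gaussian variable. -/
noncomputable def gaussMoment (p : ℝ) : ℝ := ∫ x, |x| ^ p ∂(gaussianReal 0 1)

theorem gaussMoment_eq {p : ℝ} (hp : -1 < p) :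
    gaussMoment p = 2 ^ (p / 2) * Real.Gamma ((p + 1) / 2) / √Real.pi := by
  unfold gaussMoment
  rw [integral_gaussianReal_eq_integral_smul one_ne_zero]
  have e : ∀ x : ℝ, gaussianPDFReal 0 1 x • |x| ^ p
      = (fun y => (√(2 * Real.pi))⁻¹ * (y ^ p * Real.exp (-(1 / 2) * y ^ (2:ℝ)))) |x| := by
    intro x
    simp only [gaussianPDFReal, smul_eq_mul, NNReal.coe_one, mul_one, sub_zero]
    rw [show (|x| ^ (2:ℝ)) = x ^ 2 by rw [Real.rpow_two, sq_abs]]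
    rw [show -(1 / 2) * x ^ 2 = -x ^ 2 / 2 by ring]
    ring
  simp only [e]
  rw [integral_comp_abs (f := fun y => (√(2 * Real.pi))⁻¹
    * (y ^ p * Real.exp (-(1 / 2) * y ^ (2:ℝ)))), integral_const_mul,
    integral_rpow_mul_exp_neg_mul_rpow two_pos hp (by norm_num)]
  have h2 : ((1:ℝ) / 2) ^ (-(p + 1) / 2) = 2 ^ (p / 2) * √2 := by
    rw [one_div, Real.inv_rpow two_pos.le, ← Real.rpow_neg two_pos.le, Real.sqrt_eq_rpow,
      ← Real.rpow_add two_pos]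
    congr 1; ring
  rw [h2, Real.sqrt_mul two_pos.le]
  field_simp

theorem hasMoments_gaussianReal : HasMoments (gaussianReal 0 1) := by
  intro n
  have h : Integrable (fun x : ℝ => |x| ^ (n : ℝ)) (gaussianReal 0 1) := by
    by_contra hc
    have h0 : gaussMoment n = 0 := integral_undef hc
    have hn : (0:ℝ) ≤ n := n.cast_nonneg
    rw [gaussMoment_eq (by linarith)] at h0
    have : 0 < Real.Gamma (((n:ℝ) + 1) / 2) := Real.Gamma_pos_of_pos (by positivity)
    have : 0 < 2 ^ ((n:ℝ) / 2) * Real.Gamma (((n:ℝ) + 1) / 2) / √Real.pi := by positivity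
    linarith
  simpa using h

theorem gaussMoment_pos {p : ℝ} (hp : -1 < p) : 0 < gaussMoment p := by
  rw [gaussMoment_eq hp]
  have : 0 < Real.Gamma ((p + 1) / 2) := Real.Gamma_pos_of_pos (by linarith)
  positivity

theorem gaussMoment_eq_mul {p : ℝ} (hp : 1 < p) :
    gaussMoment p = (p - 1) * gaussMoment (p - 2) := by
  rw [gaussMoment_eq (by linarith), gaussMoment_eq (by linarith),
    show (p + 1) / 2 = (p - 2 + 1) / 2 + 1 by ring, Real.Gamma_add_one (by linarith),
    show p / 2 = (p - 2) / 2 + 1 by ring, Real.rpow_add_one two_ne_zero]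
  ring

theorem gaussMoment_two : gaussMoment 2 = 1 := by
  rw [gaussMoment_eq_mul (by norm_num), sub_self]
  simp [gaussMoment]; norm_num

theorem gaussMoment_three : gaussMoment 3 = 2 * √2 / √Real.pi := by
  rw [gaussMoment_eq (by norm_num), show ((3:ℝ) + 1) / 2 = 2 by norm_num, Real.Gamma_two,
    show (3:ℝ) / 2 = 1 + 1 / 2 by norm_num, Real.rpow_add two_pos, Real.rpow_one,
    ← Real.sqrt_eq_rpow, mul_one]

theorem gammaNorm_rpow {p : ℝ} (hp : 0 < p) : gammaNorm p ^ p = gaussMoment p := by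
  change (gaussMoment p ^ (1 / p)) ^ p = _
  rw [← Real.rpow_mul (gaussMoment_pos (by linarith)).le, one_div_mul_cancel hp.ne', Real.rpow_one]

theorem integral_cos_gaussianReal (t : ℝ) :
    ∫ x, Real.cos (t * x) ∂(gaussianReal 0 1) = Real.exp (-t ^ 2 / 2) := by
  have h := charFun_gaussianReal (μ := 0) (v := 1) t
  rw [charFun_apply_real] at h
  have h2 := congrArg Complex.re h
  have hi : Integrable (fun x : ℝ => Complex.exp (t * x * Complex.I)) (gaussianReal 0 1) := by
    refine (integrable_const (1:ℝ)).mono' (by fun_prop) (Filter.Eventually.of_forall fun x => ?_)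
    rw [← Complex.ofReal_mul, Complex.norm_exp_ofReal_mul_I]
  have h3 : ∀ x : ℝ, Real.cos (t * x) = (Complex.exp (t * x * Complex.I)).re := fun x => by
    rw [← Complex.ofReal_mul, Complex.exp_ofReal_mul_I_re]
  simp only [h3]
  rw [show (∫ x, (Complex.exp (t * x * Complex.I)).re ∂(gaussianReal 0 1))
    = (∫ x, Complex.exp (t * x * Complex.I) ∂(gaussianReal 0 1)).re from
      integral_re hi, h2]
  have : (t * (0:ℝ) * Complex.I - ((1:NNReal):ℝ) * t ^ 2 / 2 : ℂ) = ((-t ^ 2 / 2 : ℝ) : ℂ) := by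
    push_cast; ring
  rw [this, Complex.exp_ofReal_re]

theorem integral_sq_gaussianReal : ∫ x, x ^ 2 ∂(gaussianReal 0 1) = 1 := by
  rw [← gaussMoment_two]
  unfold gaussMoment
  simp

theorem cosConst_mul_gaussMoment {p : ℝ} (h2 : 2 < p) (h4 : p < 4) :
    cosConst p * gaussMoment p
      = ∫ t in Set.Ioi 0, (Real.exp (-t ^ 2 / 2) - 1 + t ^ 2 / 2) * t ^ (-p - 1) := by
  have := cosConst_mul_integral_abs_rpow hasMoments_gaussianReal h2 h4
  simp only [integral_cos_gaussianReal, integral_sq_gaussianReal, one_mul] at this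
  exact this

/-! ### Comparison with exponential sums -/

/-- Induction on a real exponent in steps of two, with the base interval `[2, 4)`. -/
theorem induction_by_two {Φ : ℝ → Prop} (h0 : ∀ p, 2 ≤ p → p < 4 → Φ p)
    (h1 : ∀ p, 4 ≤ p → Φ (p - 2) → Φ p) (p : ℝ) (hp : 2 ≤ p) : Φ p := by
  have key : ∀ (k : ℕ) (p : ℝ), 2 ≤ p → p < 4 + 2 * k → Φ p := by
    intro k
    induction k with
    | zero => intro p h h'; exact h0 p h (by simpa using h')
    | succ k ih =>
      intro p h h'
      rcases lt_or_ge p 4 with h4 | h4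
      · exact h0 p h h4
      · push_cast at h'
        exact h1 p h4 (ih (p - 2) (by linarith) (by linarith))
  obtain ⟨k, hk⟩ := exists_nat_gt p
  exact key k p hp (by linarith [(k.cast_nonneg : (0:ℝ) ≤ k)])

theorem integral_abs_rpow_nonneg (ν : Measure ℝ) (p : ℝ) : 0 ≤ ∫ x, |x| ^ p ∂ν :=
  integral_nonneg fun x => by positivity

theorem prod_inv_one_add_mem {y : ℕ → ℝ} (hy : ∀ i, 0 ≤ y i) (k : ℕ) :
    0 ≤ ∏ i ∈ Finset.range k, (1 + y i)⁻¹ ∧ ∏ i ∈ Finset.range k, (1 + y i)⁻¹ ≤ 1 := by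
  have h : ∀ i, 0 ≤ (1 + y i)⁻¹ := fun i => by have := hy i; positivity
  exact ⟨Finset.prod_nonneg fun i _ => h i, Finset.prod_le_one (fun i _ => h i) fun i _ =>
    inv_le_one_of_one_le₀ (by linarith [hy i])⟩

theorem prod_inv_one_add_add_sum_le {y z : ℕ → ℝ} (hy : ∀ i, 0 ≤ y i) (hyz : ∀ i, y i ≤ z i)
    (k : ℕ) :
    ∏ i ∈ Finset.range k, (1 + y i)⁻¹ + ∑ i ∈ Finset.range k, y i
      ≤ ∏ i ∈ Finset.range k, (1 + z i)⁻¹ + ∑ i ∈ Finset.range k, z i := by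
  induction k with
  | zero => simp
  | succ k ih =>
    have hz : ∀ i, 0 ≤ z i := fun i => (hy i).trans (hyz i)
    have hle : ∏ i ∈ Finset.range (k + 1), (1 + z i)⁻¹
        ≤ ∏ i ∈ Finset.range (k + 1), (1 + y i)⁻¹ := by
      refine Finset.prod_le_prod (fun i _ => by have := hz i; positivity) fun i _ => ?_
      have := hy i
      have := hyz i
      gcongr
    have h1 := (prod_inv_one_add_mem hz (k + 1)).2
    have h2 := (prod_inv_one_add_mem hy (k + 1)).2
    rw [Finset.prod_range_succ, Finset.prod_range_succ] at *
    rw [Finset.sum_range_succ, Finset.sum_range_succ]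
    set P := ∏ i ∈ Finset.range k, (1 + y i)⁻¹
    set Q := ∏ i ∈ Finset.range k, (1 + z i)⁻¹
    have hy1 : P = P * (1 + y k)⁻¹ * (1 + y k) := by
      have : 1 + y k ≠ 0 := by linarith [hy k]
      field_simp
    have hz1 : Q = Q * (1 + z k)⁻¹ * (1 + z k) := by
      have : 1 + z k ≠ 0 := by linarith [hz k]
      field_simp
    have h3 : y k * (1 - P * (1 + y k)⁻¹) ≤ z k * (1 - Q * (1 + z k)⁻¹) :=
      mul_le_mul (hyz k) (by linarith) (by linarith) (hz k)
    nlinarith [ih]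

/-- Moments of Laplace sums increase with the moduli of the coefficients. -/
theorem integral_abs_rpow_sumLaw_symmExpLaw_mono {b c : ℕ → ℝ} (hcb : ∀ i, |c i| ≤ |b i|)
    (p : ℝ) (hp : 2 ≤ p) : ∀ k, ∫ x, |x| ^ p ∂(sumLaw symmExpLaw c k)
      ≤ ∫ x, |x| ^ p ∂(sumLaw symmExpLaw b k) := by
  have hsq : ∀ i, c i ^ 2 ≤ b i ^ 2 := fun i => sq_le_sq.2 (hcb i)
  refine induction_by_two (Φ := fun p => ∀ k, ∫ x, |x| ^ p ∂(sumLaw symmExpLaw c k)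
      ≤ ∫ x, |x| ^ p ∂(sumLaw symmExpLaw b k)) ?_ ?_ p hp
  · intro p h2 h4 k
    rcases h2.eq_or_lt with rfl | h2
    · simp only [Real.rpow_two, sq_abs, integral_sq_sumLaw_symmExpLaw]
      exact Finset.sum_le_sum fun i _ => hsq i
    · refine integral_abs_rpow_le_of_charFun (hasMoments_symmExpLaw.sumLaw _ _)
        (hasMoments_symmExpLaw.sumLaw _ _) h2 h4 fun t _ => ?_
      simp only [integral_cos_sumLaw_symmExpLaw, integral_sq_sumLaw_symmExpLaw]
      have := prod_inv_one_add_add_sum_le (y := fun i => (c i * t) ^ 2 / 2)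
        (z := fun i => (b i * t) ^ 2 / 2) (fun i => by positivity) (fun i => by
          have := hsq i
          simp only [mul_pow]; gcongr) k
      simp only [Finset.sum_mul, Finset.sum_div]
      simpa only [mul_pow] using this
  · intro p h4 ih k
    induction k with
    | zero => simp [integral_sumLaw_zero]
    | succ k ihk =>
      rw [integral_abs_rpow_sumLaw_symmExpLaw_succ h4, integral_abs_rpow_sumLaw_symmExpLaw_succ h4]
      have h1 := ih (k + 1)
      have h2 := hsq k
      have h3 := integral_abs_rpow_nonneg (sumLaw symmExpLaw c (k + 1)) (p - 2)
      have : 0 ≤ p - 1 := by linarith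
      gcongr

theorem add_rpow_le_rpow_add_mul {A B r : ℝ} (hA : 0 ≤ A) (hB : 0 ≤ B) (hr : 1 ≤ r) :
    (A + B) ^ r ≤ A ^ r + r * B * (A + B) ^ (r - 1) := by
  rcases (add_nonneg hA hB).eq_or_lt with h | h
  · have hA0 : A = 0 := by linarith
    have hB0 : B = 0 := by linarith
    simp [hA0, hB0]
  · have h1 := one_add_mul_self_le_rpow_one_add (s := -(B / (A + B)))
      (by rw [neg_le_neg_iff, div_le_one h]; linarith) hr
    have h2 : 1 + -(B / (A + B)) = A / (A + B) := by field_simp; ring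
    rw [h2, Real.div_rpow hA h.le, le_div_iff₀ (Real.rpow_pos_of_pos h r)] at h1
    have h3 : (A + B) ^ r = (A + B) ^ (r - 1) * (A + B) := by
      rw [Real.rpow_sub_one h.ne']; field_simp
    have h4 : (1 + r * -(B / (A + B))) * (A + B) ^ r
        = (A + B) ^ r - r * B * (A + B) ^ (r - 1) := by
      rw [h3]; field_simp; ring
    linarith

/-- A Laplace sum dominates the Gaussian variable of the same variance. -/
theorem gaussMoment_mul_le_integral_symmExpLaw (b : ℕ → ℝ) (p : ℝ) (hp : 2 ≤ p) :
    ∀ k, gaussMoment p * (∑ i ∈ Finset.range k, b i ^ 2) ^ (p / 2)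
      ≤ ∫ x, |x| ^ p ∂(sumLaw symmExpLaw b k) := by
  refine induction_by_two (Φ := fun p => ∀ k,
    gaussMoment p * (∑ i ∈ Finset.range k, b i ^ 2) ^ (p / 2)
      ≤ ∫ x, |x| ^ p ∂(sumLaw symmExpLaw b k)) ?_ ?_ p hp
  · intro p h2 h4 k
    rcases h2.eq_or_lt with rfl | h2
    · simp only [Real.rpow_two, sq_abs, integral_sq_sumLaw_symmExpLaw, gaussMoment_two]
      simp
    · set A := ∑ i ∈ Finset.range k, b i ^ 2 with hA
      have hA0 : 0 ≤ A := Finset.sum_nonneg fun i _ => sq_nonneg _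
      have e : gaussMoment p * A ^ (p / 2)
          = ∫ x, |x| ^ p ∂((gaussianReal 0 1).map fun x => √A * x) := by
        rw [integral_map (by fun_prop)
          ((PolyGrowth.abs_rpow (by linarith)).1.aestronglyMeasurable)]
        simp only [abs_mul, Real.mul_rpow (abs_nonneg _) (abs_nonneg _), integral_const_mul]
        rw [mul_comm, abs_of_nonneg (Real.sqrt_nonneg A), Real.sqrt_eq_rpow, ← Real.rpow_mul hA0]
        congr 2; ring
      have hm : HasMoments ((gaussianReal 0 1).map fun x => √A * x) := fun n => by
        rw [integrable_map_measure (by fun_prop) (by fun_prop)]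
        refine ((hasMoments_gaussianReal n).const_mul (|√A| ^ n)).congr
          (Filter.Eventually.of_forall fun x => ?_)
        simp only [Function.comp_apply, abs_mul, mul_pow]
      have : IsProbabilityMeasure ((gaussianReal 0 1).map fun x => √A * x) :=
        Measure.isProbabilityMeasure_map (by fun_prop)
      rw [e]
      refine integral_abs_rpow_le_of_charFun hm (hasMoments_symmExpLaw.sumLaw _ _) h2 h4
        fun t _ => ?_
      rw [integral_cos_sumLaw_symmExpLaw, integral_sq_sumLaw_symmExpLaw,
        integral_map (by fun_prop) (by fun_prop), integral_map (by fun_prop) (by fun_prop)]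
      have e1 : ∀ x : ℝ, Real.cos (t * (√A * x)) = Real.cos (t * √A * x) := fun x => by
        rw [mul_assoc]
      simp only [e1, integral_cos_gaussianReal, mul_pow, integral_const_mul,
        integral_sq_gaussianReal, Real.sq_sqrt hA0]
      rw [mul_one]
      refine add_le_add_left ?_ _
      have e2 : -(t ^ 2 * A) / 2 = ∑ i ∈ Finset.range k, -(b i ^ 2 * t ^ 2 / 2) := by
        rw [Finset.sum_neg_distrib, ← Finset.sum_div, ← Finset.sum_mul]; ring
      rw [e2, Real.exp_sum]
      refine Finset.prod_le_prod (fun i _ => (Real.exp_pos _).le) fun i _ => ?_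
      rw [Real.exp_neg]
      have : 0 ≤ b i ^ 2 * t ^ 2 / 2 := by positivity
      have := Real.add_one_le_exp (b i ^ 2 * t ^ 2 / 2)
      gcongr
      linarith
  · intro p h4 ih k
    induction k with
    | zero =>
      rw [integral_sumLaw_zero]
      simp [Real.zero_rpow (by linarith : p ≠ 0), Real.zero_rpow (by linarith : p / 2 ≠ 0)]
    | succ k ihk =>
      rw [integral_abs_rpow_sumLaw_symmExpLaw_succ h4]
      have h1 := ih (k + 1)
      set A := ∑ i ∈ Finset.range k, b i ^ 2 with hA
      rw [Finset.sum_range_succ, ← hA] at *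
      have hA0 : 0 ≤ A := Finset.sum_nonneg fun i _ => sq_nonneg _
      have h2 := add_rpow_le_rpow_add_mul hA0 (sq_nonneg (b k)) (by linarith : 1 ≤ p / 2)
      have h3 : gaussMoment p = (p - 1) * gaussMoment (p - 2) := gaussMoment_eq_mul (by linarith)
      have hg := gaussMoment_pos (p := p) (by linarith)
      have h5 : p * (p - 1) / 2 * b k ^ 2 * (gaussMoment (p - 2) * (A + b k ^ 2) ^ ((p - 2) / 2))
          ≤ p * (p - 1) / 2 * b k ^ 2 * ∫ x, |x| ^ (p - 2) ∂(sumLaw symmExpLaw b (k + 1)) := by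
        have : 0 ≤ p - 1 := by linarith
        gcongr
      have h6 := mul_le_mul_of_nonneg_left h2 hg.le
      rw [show (p - 2) / 2 = p / 2 - 1 by ring] at h5
      have h7 : gaussMoment p * (p / 2 * b k ^ 2 * (A + b k ^ 2) ^ (p / 2 - 1))
          = p * (p - 1) / 2 * b k ^ 2 * (gaussMoment (p - 2) * (A + b k ^ 2) ^ (p / 2 - 1)) := by
        rw [h3]; ring
      linarith

/-- If no `x i` exceeds `x 0` in modulus, then dropping the factor `cos (x 0)` from a product of
cosines costs at most `x 0 ^ 2 / 2`, even after replacing each `cos x` by `(1 + x² / 2)⁻¹`. -/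
theorem prod_inv_le_prod_cos_add {x : ℕ → ℝ} (hx : ∀ i, |x i| ≤ |x 0|) (k : ℕ) :
    ∏ i ∈ Finset.range k, (1 + x (i + 1) ^ 2 / 2)⁻¹
      ≤ ∏ i ∈ Finset.range (k + 1), Real.cos (x i) + x 0 ^ 2 / 2 := by
  set β := x 0 ^ 2 / 2 with hβ
  have hcos : ∀ i, 1 - x i ^ 2 / 2 ≤ Real.cos (x i) := fun i => Real.one_sub_sq_div_two_le_cos
  have hxβ : ∀ i, x i ^ 2 / 2 ≤ β := fun i => by
    have := sq_le_sq.2 (hx i); rw [hβ]; linarith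
  have hL := (prod_inv_one_add_mem (y := fun i => x (i + 1) ^ 2 / 2) (fun i => by positivity) k).2
  -- A negative factor dominates the modulus of the product, and `-cos (x j) ≤ β - 1`.
  by_cases hneg : ∃ j ∈ Finset.range (k + 1), Real.cos (x j) < 0
  · obtain ⟨j, hj, hcj⟩ := hneg
    have h1 : |∏ i ∈ Finset.range (k + 1), Real.cos (x i)| ≤ -Real.cos (x j) := by
      rw [Finset.abs_prod, ← Finset.mul_prod_erase _ _ hj, ← abs_of_neg hcj]
      refine mul_le_of_le_one_right (abs_nonneg _) ?_
      exact Finset.prod_le_one (fun _ _ => abs_nonneg _) fun _ _ => Real.abs_cos_le_one _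
    have h2 := (abs_le.1 h1).1
    have := hcos j
    have := hxβ j
    linarith
  push Not at hneg
  rcases le_total 1 β with h1 | h1
  · have := Finset.prod_nonneg hneg
    linarith
  · clear hL
    have hP : ∀ m, m ≤ k → 0 ≤ ∏ i ∈ Finset.range m, Real.cos (x (i + 1)) ∧
        ∏ i ∈ Finset.range m, Real.cos (x (i + 1)) ≤ 1 := fun m hm =>
      ⟨Finset.prod_nonneg fun i hi => hneg _ (by simp at hi ⊢; omega), Finset.prod_le_one
        (fun i hi => hneg _ (by simp at hi ⊢; omega)) fun i _ => Real.cos_le_one _⟩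
    have key : ∀ m, m ≤ k → ∏ i ∈ Finset.range m, (1 + x (i + 1) ^ 2 / 2)⁻¹
        ≤ β + (1 - β) * ∏ i ∈ Finset.range m, Real.cos (x (i + 1)) := by
      intro m
      induction m with
      | zero => simp
      | succ m ih =>
        intro hm
        specialize ih (by omega)
        rw [Finset.prod_range_succ, Finset.prod_range_succ]
        obtain ⟨hB0, hB1⟩ := hP m (by omega)
        set B := ∏ i ∈ Finset.range m, Real.cos (x (i + 1))
        set y := x (m + 1) ^ 2 / 2 with hy
        have hy0 : 0 ≤ y := by positivity
        have hyβ : y ≤ β := hxβ _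
        have hc : 1 - y ≤ Real.cos (x (m + 1)) := hcos _
        have h2 : (β + (1 - β) * B) * (1 + y)⁻¹ ≤ β + (1 - β) * (B * (1 - y)) := by
          rw [← div_eq_mul_inv, div_le_iff₀ (by linarith)]
          have : (1 - β) * B * y ^ 2 ≤ β * y := by
            have h3 : (1 - β) * B ≤ 1 := by nlinarith
            have h4 : y ^ 2 ≤ β * y := by nlinarith
            nlinarith [sq_nonneg y]
          nlinarith
        refine (mul_le_mul_of_nonneg_right ih (by positivity)).trans (h2.trans ?_)
        have : B * (1 - y) ≤ B * Real.cos (x (m + 1)) := mul_le_mul_of_nonneg_left hc hB0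
        have h5 : 0 ≤ 1 - β := by linarith
        nlinarith [mul_le_mul_of_nonneg_left this h5]
    have h2 := key k le_rfl
    rw [Finset.prod_range_succ']
    have h3 := mul_le_mul_of_nonneg_left (hcos 0) (hP k le_rfl).1
    have : x 0 ^ 2 / 2 = β := rfl
    rw [this] at h3
    linarith

/-- A Rademacher sum dominates the Laplace sum that misses its first `⌈p / 2⌉ - 1` terms. -/
theorem integral_symmExpLaw_le_radE {a : ℕ → ℝ} (ha : ∀ i j, i ≤ j → |a j| ≤ |a i|)
    (p : ℝ) (hp : 2 ≤ p) : ∀ N, ∫ x, |x| ^ p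
        ∂(sumLaw symmExpLaw (fun j => a (⌈p / 2⌉₊ - 1 + j)) (N - (⌈p / 2⌉₊ - 1)))
      ≤ radE a N (fun x => |x| ^ p) := by
  refine induction_by_two (Φ := fun p => ∀ N, ∫ x, |x| ^ p
        ∂(sumLaw symmExpLaw (fun j => a (⌈p / 2⌉₊ - 1 + j)) (N - (⌈p / 2⌉₊ - 1)))
      ≤ radE a N (fun x => |x| ^ p)) ?_ ?_ p hp
  · intro p h2 h4 N
    rcases h2.eq_or_lt with rfl | h2
    · simp [integral_sq_sumLaw_symmExpLaw, radE_sq]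
    · have hc : ⌈p / 2⌉₊ = 2 := by
        rw [Nat.ceil_eq_iff (by norm_num)]; constructor <;> norm_num <;> linarith
      rw [hc]
      cases N with
      | zero =>
        simp only [Nat.zero_sub]
        rw [integral_sumLaw_zero]; rfl
      | succ k =>
        rw [← integral_sumLaw_signLaw a (k + 1) (PolyGrowth.abs_rpow (by linarith))]
        refine integral_abs_rpow_le_of_charFun (hasMoments_symmExpLaw.sumLaw _ _)
          (hasMoments_signLaw.sumLaw _ _) h2 h4 fun t _ => ?_
        rw [integral_cos_sumLaw_symmExpLaw, integral_sq_sumLaw_symmExpLaw,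
          integral_sumLaw_signLaw a (k + 1) (F := fun x => Real.cos (t * x))
            (PolyGrowth.of_bounded (by fun_prop) fun x => Real.abs_cos_le_one _),
          integral_sumLaw_signLaw a (k + 1) (PolyGrowth.id.pow 2), radE_cos, radE_sq,
          Finset.sum_range_succ']
        have := prod_inv_le_prod_cos_add (x := fun i => a i * t) (fun i => by
          rw [abs_mul, abs_mul]
          exact mul_le_mul_of_nonneg_right (ha 0 i (Nat.zero_le i)) (abs_nonneg t)) k
        simp only [show 2 - 1 = 1 from rfl, Nat.add_sub_cancel, add_comm 1]
        rw [mul_pow] at this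
        linarith
  · intro p h4 ih N
    have hc : ⌈(p - 2) / 2⌉₊ = ⌈p / 2⌉₊ - 1 := by
      rw [show (p - 2) / 2 = p / 2 - 1 by ring, Nat.ceil_sub_one]
    have hc2 : 1 < ⌈p / 2⌉₊ := by
      rw [Nat.lt_ceil]; push_cast; linarith
    obtain ⟨m, hm⟩ : ∃ m, ⌈p / 2⌉₊ = m + 2 := ⟨⌈p / 2⌉₊ - 2, by omega⟩
    rw [hc] at ih
    rw [hm] at ih ⊢
    simp only [show m + 2 - 1 = m + 1 by omega, show m + 1 - 1 = m by omega] at ih ⊢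
    induction N with
    | zero =>
      simp only [Nat.zero_sub]
      rw [integral_sumLaw_zero]; rfl
    | succ N ihN =>
      refine le_trans ?_ (radE_abs_rpow_succ_ge h4 a N)
      have hp1 : 0 ≤ p * (p - 1) / 2 * a N ^ 2 := by
        have : 0 ≤ p - 1 := by linarith
        positivity
      have hnn : 0 ≤ radE a N (fun x => |x| ^ (p - 2)) := by
        rw [← radE_const a N 0]
        exact radE_mono _ _ fun x => by positivity
      -- Both sums gain a term at the same rate. The induction hypothesis for `p - 2` drops one index
      -- fewer, and shifting it is allowed by monotonicity in the coefficients.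
      rcases lt_or_ge N (m + 1) with h | h
      · rw [show N + 1 - (m + 1) = N - (m + 1) by omega]
        nlinarith [mul_nonneg hp1 hnn]
      · rw [show N + 1 - (m + 1) = (N - (m + 1)) + 1 by omega,
          integral_abs_rpow_sumLaw_symmExpLaw_succ h4, show m + 1 + (N - (m + 1)) = N by omega]
        refine add_le_add ihN (mul_le_mul_of_nonneg_left ?_ hp1)
        refine le_trans ?_ (ih N)
        rw [show N - m = N - (m + 1) + 1 by omega]
        exact integral_abs_rpow_sumLaw_symmExpLaw_mono (fun i => ha _ _ (by omega)) (p - 2)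
          (by linarith) _

/-! ### Gaussian moments near two, and sums with a dominant coefficient -/

/-- The upper bound `H₆₄ - log 64` for Euler's constant. It is within `0.008` of the true value, which
the numerical margins of the comparison below absorb. -/
theorem eulerMascheroniConstant_lt : Real.eulerMascheroniConstant < 0.58515 := by
  have h := Real.eulerMascheroniConstant_lt_eulerMascheroniSeq' 64
  have h2 : Real.eulerMascheroniSeq' 64 = (harmonic 64 : ℝ) - Real.log 64 := by
    rw [Real.eulerMascheroniSeq', if_neg (by norm_num)]; rfl
  have h3 : (harmonic 64 : ℚ) < 4.74392 := by
    norm_num [harmonic, Finset.sum_range_succ]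
  have h3' : ((harmonic 64 : ℚ) : ℝ) < 4.74392 := by
    have : ((harmonic 64 : ℚ) : ℝ) < ((4.74392 : ℚ) : ℝ) := by exact_mod_cast h3
    norm_num at this ⊢
  have h4 : Real.log 64 = 6 * Real.log 2 := by
    rw [show (64:ℝ) = 2 ^ 6 by norm_num, Real.log_pow]; norm_num
  have := Real.log_two_gt_d9
  rw [h2, h4] at h
  linarith

/-- The derivative at `2` of the Gaussian moments. -/
noncomputable def gaussSlope : ℝ := (2 - Real.eulerMascheroniConstant - Real.log 2) / 2

theorem gaussSlope_gt : 0.36085 < gaussSlope := by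
  have := eulerMascheroniConstant_lt
  have := Real.log_two_lt_d9
  unfold gaussSlope; linarith

theorem hasDerivAt_gaussMoment_two : HasDerivAt gaussMoment gaussSlope 2 := by
  have hG : HasDerivAt Real.Gamma (√Real.pi - √Real.pi * (Real.eulerMascheroniConstant + 2 * Real.log 2) / 2) (3 / 2) := by
    have h1 := (hasDerivAt_id (1 / 2 : ℝ)).mul Real.hasDerivAt_Gamma_one_half
    have h2 : HasDerivAt (fun s => Real.Gamma (s + 1))
        (√Real.pi - √Real.pi * (Real.eulerMascheroniConstant + 2 * Real.log 2) / 2) (1 / 2) := by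
      have h3 : (fun s => Real.Gamma (s + 1)) =ᶠ[nhds (1 / 2)] fun s => id s * Real.Gamma s := by
        filter_upwards [lt_mem_nhds (show (0:ℝ) < 1 / 2 by norm_num)] with s hs
        exact Real.Gamma_add_one hs.ne'
      refine (h1.congr_of_eventuallyEq h3).congr_deriv ?_
      rw [Real.Gamma_one_half_eq]; simp only [id]; ring
    have h4 : HasDerivAt (fun s : ℝ => s - 1) 1 (3 / 2) := (hasDerivAt_id _).sub_const 1
    have h5 := HasDerivAt.comp (3 / 2 : ℝ) (h₂ := fun s => Real.Gamma (s + 1))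
      (h := fun s : ℝ => s - 1)
      (by rw [show (3 / 2 : ℝ) - 1 = 1 / 2 by norm_num]; exact h2) h4
    simpa [Function.comp_def] using h5
  have hG' : HasDerivAt (fun p : ℝ => Real.Gamma ((p + 1) / 2))
      ((√Real.pi - √Real.pi * (Real.eulerMascheroniConstant + 2 * Real.log 2) / 2) * (1 / 2)) 2 := by
    have h4 : HasDerivAt (fun p : ℝ => (p + 1) / 2) (1 / 2) 2 :=
      ((hasDerivAt_id _).add_const 1).div_const 2
    exact HasDerivAt.comp (2 : ℝ) (by rw [show ((2:ℝ) + 1) / 2 = 3 / 2 by norm_num]; exact hG) h4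
  have hP : HasDerivAt (fun p : ℝ => (2:ℝ) ^ (p / 2)) (Real.log 2 * (1 / 2) * 2 ^ ((2:ℝ) / 2)) 2 :=
    ((hasDerivAt_id (2:ℝ)).div_const 2).const_rpow two_pos
  have h := (hP.mul hG').div_const √Real.pi
  have he : gaussMoment =ᶠ[nhds 2] fun p => 2 ^ (p / 2) * Real.Gamma ((p + 1) / 2) / √Real.pi := by
    filter_upwards [lt_mem_nhds (show (-1:ℝ) < 2 by norm_num)] with p hp
    exact gaussMoment_eq hp
  refine (h.congr_of_eventuallyEq he).congr_deriv ?_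
  have h3 : Real.Gamma ((2 + 1) / 2) = √Real.pi / 2 := by
    rw [show ((2:ℝ) + 1) / 2 = 1 / 2 + 1 by norm_num, Real.Gamma_add_one (by norm_num),
      Real.Gamma_one_half_eq]; ring
  have hpi : √Real.pi ≠ 0 := by positivity
  rw [h3, div_self two_ne_zero, Real.rpow_one, gaussSlope]
  field_simp; ring

theorem convexOn_log_gaussMoment :
    ConvexOn ℝ (Set.Ioi (-1)) fun p => Real.log (gaussMoment p) := by
  have he : ∀ p : ℝ, -1 < p → Real.log (gaussMoment p)
      = p / 2 * Real.log 2 + Real.log (Real.Gamma ((p + 1) / 2)) - Real.log √Real.pi := by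
    intro p hp
    have : 0 < Real.Gamma ((p + 1) / 2) := Real.Gamma_pos_of_pos (by linarith)
    rw [gaussMoment_eq hp, Real.log_div (by positivity) (by positivity),
      Real.log_mul (by positivity) (by positivity), Real.log_rpow two_pos]
  refine ⟨convex_Ioi _, fun x hx y hy s t hs ht hst => ?_⟩
  have hx' : -1 < x := hx
  have hy' : -1 < y := hy
  have hxy : -1 < s • x + t • y := (convex_Ioi (-1:ℝ)) hx hy hs ht hst
  have h := Real.convexOn_log_Gamma.2 (show (x + 1) / 2 ∈ Set.Ioi (0:ℝ) from by
    simp only [Set.mem_Ioi]; linarith) (show (y + 1) / 2 ∈ Set.Ioi (0:ℝ) from by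
    simp only [Set.mem_Ioi]; linarith) hs ht hst
  have e : s • ((x + 1) / 2) + t • ((y + 1) / 2) = (s • x + t • y + 1) / 2 := by
    simp only [smul_eq_mul]; linear_combination (1 / 2) * hst
  rw [e] at h
  simp only [Function.comp_apply] at h
  simp only
  rw [he _ hx', he _ hy', he _ hxy]
  simp only [smul_eq_mul] at *
  linear_combination h + (1:ℝ) * Real.log √Real.pi * hst

/-- The tangent at `2` lies below the convex function `log ∘ gaussMoment`. -/
theorem exp_gaussSlope_mul_le {p : ℝ} (hp : 2 < p) :
    Real.exp gaussSlope ^ (p - 2) ≤ gaussMoment p := by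
  have hd : HasDerivAt (fun p => Real.log (gaussMoment p)) gaussSlope 2 := by
    have := hasDerivAt_gaussMoment_two.log (by rw [gaussMoment_two]; norm_num)
    rwa [gaussMoment_two, div_one] at this
  have h := convexOn_log_gaussMoment.le_slope_of_hasDerivAt (x := 2) (y := p)
    (by simp; norm_num) (by simp; linarith) hp hd
  rw [slope_def_field, gaussMoment_two, Real.log_one, sub_zero, le_div_iff₀ (by linarith)] at h
  rw [← Real.exp_mul, ← Real.exp_log (gaussMoment_pos (p := p) (by linarith))]
  exact Real.exp_le_exp.2 h

/-- Log-convexity again, now through the chord from `2` to `p`. -/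
theorem gaussMoment_three_rpow_le {p : ℝ} (hp : 3 ≤ p) :
    gaussMoment 3 ^ (p - 2) ≤ gaussMoment p := by
  have h0 : 0 < p - 2 := by linarith
  have h := convexOn_log_gaussMoment.2 (show (2:ℝ) ∈ Set.Ioi (-1:ℝ) by simp; norm_num)
    (show p ∈ Set.Ioi (-1:ℝ) by simp; linarith)
    (show 0 ≤ (p - 3) / (p - 2) by apply div_nonneg <;> linarith)
    (show 0 ≤ 1 / (p - 2) by positivity) (by field_simp; ring)
  have e : ((p - 3) / (p - 2)) • (2:ℝ) + (1 / (p - 2)) • p = 3 := by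
    simp only [smul_eq_mul]; field_simp; ring
  simp only at h
  rw [e, gaussMoment_two, Real.log_one, smul_zero, zero_add, smul_eq_mul, one_div, inv_mul_eq_div, le_div_iff₀ h0, mul_comm] at h
  rw [Real.rpow_def_of_pos (gaussMoment_pos (by norm_num)), mul_comm,
    ← Real.exp_log (gaussMoment_pos (p := p) (by linarith))]
  exact Real.exp_le_exp.2 h

/-- Interpolation between the second moment and the moment of order `r`. -/
theorem radE_abs_rpow_le_of_moment {b : ℕ → ℝ} {k : ℕ} {p r M : ℝ} (h2 : 2 < p) (hr : p ≤ r)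
    (hM : 0 < M) (hsq : radE b k (fun x => x ^ 2) = 1) (hm : radE b k (fun x => |x| ^ r) ≤ M) :
    radE b k (fun x => |x| ^ p) ≤ M ^ ((p - 2) / (r - 2)) := by
  set θ := (p - 2) / (r - 2) with hθ
  have hr0 : 0 < r - 2 := by linarith
  have hθ0 : 0 ≤ θ := by apply div_nonneg <;> linarith
  have hθ1 : θ ≤ 1 := by rw [hθ, div_le_one hr0]; linarith
  have hpt : ∀ x : ℝ, |x| ^ p ≤ M ^ θ * (1 - θ) * x ^ 2 + M ^ θ * θ / M * |x| ^ r := by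
    intro x
    have h := rpow_one_add_le_one_add_mul_self (s := |x| ^ (r - 2) / M - 1)
      (by have : 0 ≤ |x| ^ (r - 2) / M := by positivity
          linarith) hθ0 hθ1
    rw [add_sub_cancel, Real.div_rpow (by positivity) hM.le, ← Real.rpow_mul (abs_nonneg x),
      hθ, mul_div_cancel₀ _ hr0.ne', ← hθ, div_le_iff₀ (by positivity)] at h
    rw [← abs_rpow_mul_sq h2, ← abs_rpow_mul_sq (show 2 < r by linarith)]
    calc |x| ^ (p - 2) * x ^ 2 ≤ (1 + θ * (|x| ^ (r - 2) / M - 1)) * M ^ θ * x ^ 2 := by gcongr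
      _ = _ := by ring
  refine (radE_mono b k hpt).trans ?_
  rw [radE_add, radE_const_mul, radE_const_mul, hsq]
  have h3 : M ^ θ * θ / M * radE b k (fun x => |x| ^ r) ≤ M ^ θ * θ / M * M := by gcongr
  have h4 : M ^ θ * θ / M * M = M ^ θ * θ := by field_simp
  linarith

/-- For `|y| ≤ a` the average is exactly `a ^ 3 + 3 * a * y ^ 2`; the sixth power pays for the rest. -/
theorem avg_abs_cube_le (y : ℝ) {a : ℝ} (ha : 0 < a) :
    (|y + a| ^ 3 + |y - a| ^ 3) / 2 ≤ a ^ 3 + 3 * a * y ^ 2 + y ^ 6 / (64 * a ^ 3) := by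
  wlog hy : 0 ≤ y generalizing y
  · have := this (-y) (by linarith)
    have e1 : |-y + a| = |y - a| := by rw [← abs_neg]; congr 1; ring
    have e2 : |-y - a| = |y + a| := by rw [← abs_neg]; congr 1; ring
    rw [e1, e2, neg_sq, Even.neg_pow (by decide)] at this
    linarith
  rw [abs_of_nonneg (show 0 ≤ y + a by linarith)]
  have h6 : 0 ≤ y ^ 6 / (64 * a ^ 3) := by positivity
  rcases le_total y a with h | h
  · rw [abs_of_nonpos (by linarith)]
    nlinarith
  · rw [abs_of_nonneg (by linarith)]
    -- The excess is `(y - a) ^ 3`, and `4 * a * (y - a) ≤ y ^ 2`.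
    have h1 : (4 * a * (y - a)) ^ 3 ≤ (y ^ 2) ^ 3 := by
      have : 0 ≤ 4 * a * (y - a) := mul_nonneg (by linarith) (by linarith)
      gcongr
      nlinarith [sq_nonneg (y - 2 * a)]
    have h2 : (y - a) ^ 3 ≤ y ^ 6 / (64 * a ^ 3) := by
      rw [le_div_iff₀ (by positivity)]
      nlinarith
    nlinarith

/-- The sharp Khintchine bound when one squared coefficient carries at least `3 / 5` of the
variance. -/
theorem radE_abs_rpow_le_of_large {b : ℕ → ℝ} {k : ℕ} {p : ℝ} (h2 : 2 < p) (h4 : p < 4)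
    (hsum : ∑ i ∈ Finset.range (k + 1), b i ^ 2 = 1) (hlarge : 3 / 5 ≤ b 0 ^ 2) :
    radE b (k + 1) (fun x => |x| ^ p) ≤ gaussMoment p := by
  have hsq : radE b (k + 1) (fun x => x ^ 2) = 1 := by rw [radE_sq, hsum]
  set c : ℕ → ℝ := fun i => b (i + 1) with hc
  set A := b 0 ^ 2 with hA
  have hrest : ∑ i ∈ Finset.range k, c i ^ 2 = 1 - A := by
    rw [Finset.sum_range_succ'] at hsum; rw [hc]; linarith
  have hA1 : A ≤ 1 := by
    have : 0 ≤ ∑ i ∈ Finset.range k, c i ^ 2 := Finset.sum_nonneg fun i _ => sq_nonneg _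
    linarith
  rcases lt_or_ge p 3 with h3 | h3
  · set a := |b 0| with ha
    have ha2 : a ^ 2 = A := by rw [ha, sq_abs]
    have ha1 : 0.7745 ≤ a := by
      refine abs_le_of_sq_le_sq' ?_ (abs_nonneg _) |>.2
      rw [ha2]; norm_num at hlarge ⊢; linarith
    -- `exp gaussSlope > 1.43`, and `gaussMoment p ≥ exp (gaussSlope * (p - 2))`.
    have hm : radE b (k + 1) (fun x => |x| ^ (3:ℝ)) ≤ 1.43 := by
      rw [radE_succ_first]
      have hpt : ∀ x : ℝ, (|x + b 0| ^ (3:ℝ) + |x - b 0| ^ (3:ℝ)) / 2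
          ≤ a ^ 3 + ((3 * a) * x ^ 2 + (1 / (64 * a ^ 3)) * x ^ 6) := by
        intro x
        have e : ∀ z : ℝ, |z| ^ (3:ℝ) = |z| ^ 3 := fun z => by
          rw [show (3:ℝ) = ((3:ℕ):ℝ) by norm_num, Real.rpow_natCast]
        have h := avg_abs_cube_le x (a := a) (by linarith)
        rw [e, e]
        rw [← one_div_mul_eq_div (64 * a ^ 3)] at h
        rcases abs_choice (b 0) with h' | h'
        · rw [show b 0 = a by rw [ha, h']]; linarith
        · have : b 0 = -a := by rw [ha, h']; ring
          rw [this, sub_neg_eq_add, ← sub_eq_add_neg]; linarith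
      refine (radE_mono _ _ hpt).trans ?_
      rw [radE_add, radE_add, radE_const_mul, radE_const_mul, radE_const, radE_sq, hrest]
      have h6 := radE_pow_six_le c k
      rw [hrest] at h6
      have ha3 : 0.4645 ≤ a ^ 3 := by
        calc (0.4645:ℝ) ≤ 0.7745 ^ 3 := by norm_num
          _ ≤ a ^ 3 := by gcongr
      have h7 : 1 / (64 * a ^ 3) * radE c k (fun x => x ^ 6) ≤ 0.0323 := by
        rw [one_div, inv_mul_eq_div, div_le_iff₀ (by positivity)]
        have : (1 - A) ^ 3 ≤ (2 / 5) ^ 3 := by gcongr <;> linarith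
        norm_num at *; linarith
      -- `3 * a - 2 * a ^ 3` decreases beyond `a = √(1 / 2)`.
      have h8 : 3 * a - 2 * a ^ 3 ≤ 3 * 0.7745 - 2 * 0.7745 ^ 3 := by
        have h9 : 0 ≤ (a - 0.7745) * (2 * (a ^ 2 + 0.7745 * a + 0.7745 ^ 2) - 3) := by
          refine mul_nonneg ?_ ?_ <;> (norm_num at *; nlinarith)
        nlinarith
      rw [← ha2]
      norm_num at *
      nlinarith
    have h := radE_abs_rpow_le_of_moment h2 h3.le (by norm_num) hsq hm
    rw [show (3:ℝ) - 2 = 1 by norm_num, div_one] at h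
    refine h.trans (le_trans ?_ (exp_gaussSlope_mul_le h2))
    refine Real.rpow_le_rpow (by norm_num) ?_ (by linarith)
    have h5 := Real.quadratic_le_exp_of_nonneg (x := 0.36085 / 2) (by norm_num)
    have h6 : Real.exp 0.36085 ≤ Real.exp gaussSlope := Real.exp_le_exp.2 gaussSlope_gt.le
    have h7 : Real.exp 0.36085 = Real.exp (0.36085 / 2) * Real.exp (0.36085 / 2) := by
      rw [← Real.exp_add]; congr 1; ring
    rw [h7] at h6
    norm_num at *
    nlinarith
  · -- The fourth moment is at most `3 - 2 * A ^ 2 ≤ 2.28 < 8 / π = gaussMoment 3 ^ 2`.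
    have hm : radE b (k + 1) (fun x => |x| ^ (4:ℝ)) ≤ 2.28 := by
      have e : (fun x : ℝ => |x| ^ (4:ℝ)) = fun x => x ^ 4 := by
        ext x
        rw [show (4:ℝ) = ((4:ℕ):ℝ) by norm_num, Real.rpow_natCast, Even.pow_abs (by decide)]
      rw [e, radE_succ_first]
      have hpt : (fun x : ℝ => ((x + b 0) ^ 4 + (x - b 0) ^ 4) / 2)
          = fun x => A ^ 2 + ((6 * A) * x ^ 2 + x ^ 4) := by
        ext x; rw [hA]; ring
      rw [hpt, radE_add, radE_add, radE_const_mul, radE_const, radE_sq, hrest]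
      have h6 := radE_pow_four_le c k
      rw [hrest] at h6
      norm_num at *
      nlinarith
    have h := radE_abs_rpow_le_of_moment h2 h4.le (by norm_num) hsq hm
    refine h.trans (le_trans ?_ (gaussMoment_three_rpow_le h3))
    have h5 : (2.28 : ℝ) ≤ gaussMoment 3 ^ (2:ℝ) := by
      rw [Real.rpow_two, gaussMoment_three, div_pow, mul_pow, Real.sq_sqrt two_pos.le,
        Real.sq_sqrt Real.pi_pos.le, le_div_iff₀ Real.pi_pos]
      have := Real.pi_lt_d2
      norm_num at *; linarith
    calc (2.28:ℝ) ^ ((p - 2) / (4 - 2)) ≤ (gaussMoment 3 ^ (2:ℝ)) ^ ((p - 2) / (4 - 2)) := by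
          apply Real.rpow_le_rpow (by norm_num) h5
          apply div_nonneg <;> linarith
      _ = gaussMoment 3 ^ (p - 2) := by
          rw [← Real.rpow_mul (gaussMoment_pos (by norm_num)).le]; congr 1; ring

/-! ### Estimates for cosine integrals -/

theorem mul_cos_le_sin {u : ℝ} (h0 : 0 ≤ u) (h1 : u ≤ Real.pi / 2) :
    u * Real.cos u ≤ Real.sin u := by
  have hm : MonotoneOn (fun u => Real.sin u - u * Real.cos u) (Set.Icc 0 (Real.pi / 2)) := by
    refine monotoneOn_of_deriv_nonneg (convex_Icc _ _) (by fun_prop) (by fun_prop) fun x hx => ?_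
    rw [interior_Icc] at hx
    have hd : HasDerivAt (fun u => Real.sin u - u * Real.cos u) (x * Real.sin x) x := by
      refine ((Real.hasDerivAt_sin x).sub
        ((hasDerivAt_id x).mul (Real.hasDerivAt_cos x))).congr_deriv ?_
      simp only [id]; ring
    rw [hd.deriv]
    exact mul_nonneg hx.1.le (Real.sin_nonneg_of_nonneg_of_le_pi hx.1.le (by linarith [hx.2]))
  have := hm ⟨le_rfl, h0.trans h1⟩ ⟨h0, h1⟩ h0
  simp at this; linarith

theorem add_cube_mul_cos_le_sin {u : ℝ} (h0 : 0 ≤ u) (h1 : u ≤ Real.pi / 2) :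
    (u + u ^ 3 / 3) * Real.cos u ≤ Real.sin u := by
  have hm : MonotoneOn (fun u => Real.sin u - (u + u ^ 3 / 3) * Real.cos u)
      (Set.Icc 0 (Real.pi / 2)) := by
    refine monotoneOn_of_deriv_nonneg (convex_Icc _ _) (by fun_prop) (by fun_prop) fun x hx => ?_
    rw [interior_Icc] at hx
    have hd : HasDerivAt (fun u => Real.sin u - (u + u ^ 3 / 3) * Real.cos u)
        (x * (Real.sin x - x * Real.cos x) + x ^ 3 / 3 * Real.sin x) x := by
      refine ((Real.hasDerivAt_sin x).sub
        (((hasDerivAt_id x).add ((hasDerivAt_pow 3 x).div_const 3)).mul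
          (Real.hasDerivAt_cos x))).congr_deriv ?_
      simp only [id, Pi.add_apply]; norm_num; ring
    rw [hd.deriv]
    have h2 := mul_cos_le_sin hx.1.le hx.2.le
    have h3 := Real.sin_nonneg_of_nonneg_of_le_pi hx.1.le (by linarith [hx.2])
    have h4 := hx.1
    have : 0 ≤ Real.sin x - x * Real.cos x := by linarith
    positivity
  have := hm ⟨le_rfl, h0.trans h1⟩ ⟨h0, h1⟩ h0
  simp at this; linarith

/-- The Taylor expansion of `log cos` to fourth order, as an upper bound. -/
theorem cos_le_exp_neg_sq_add_pow_four {u : ℝ} (h0 : 0 ≤ u) (h1 : u ≤ Real.pi / 2) :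
    Real.cos u ≤ Real.exp (-(u ^ 2 / 2 + u ^ 4 / 12)) := by
  have hm : AntitoneOn (fun u => Real.cos u * Real.exp (u ^ 2 / 2 + u ^ 4 / 12))
      (Set.Icc 0 (Real.pi / 2)) := by
    refine antitoneOn_of_deriv_nonpos (convex_Icc _ _) (by fun_prop) (by fun_prop) fun x hx => ?_
    rw [interior_Icc] at hx
    have hd : HasDerivAt (fun u => Real.cos u * Real.exp (u ^ 2 / 2 + u ^ 4 / 12))
        (Real.exp (x ^ 2 / 2 + x ^ 4 / 12) * ((x + x ^ 3 / 3) * Real.cos x - Real.sin x)) x := by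
      refine ((Real.hasDerivAt_cos x).mul (((hasDerivAt_pow 2 x).div_const 2).add
        ((hasDerivAt_pow 4 x).div_const 12)).exp).congr_deriv ?_
      norm_num; ring
    rw [hd.deriv]
    have h2 := add_cube_mul_cos_le_sin hx.1.le hx.2.le
    exact mul_nonpos_of_nonneg_of_nonpos (Real.exp_pos _).le (by linarith)
  have := hm ⟨le_rfl, h0.trans h1⟩ ⟨h0, h1⟩ h0
  simp only [Real.cos_zero, ne_eq, OfNat.ofNat_ne_zero, not_false_eq_true, zero_pow, zero_div,
    add_zero, Real.exp_zero, mul_one] at this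
  rw [Real.exp_neg, ← one_div, le_div_iff₀ (Real.exp_pos _)]
  exact this

/-- Replacing `cos u ^ 2` by its mean `1 / 2` gives the value on the right; starting from a zero of
`cos`, the oscillating part contributes nothing positive. -/
theorem integral_Ioi_cos_sq_div_cube_le {x₀ : ℝ} (h0 : 0 < x₀) (hc : Real.cos x₀ = 0) :
    ∫ u in Set.Ioi x₀, Real.cos u ^ 2 * (u ^ 3)⁻¹ ≤ 1 / (4 * x₀ ^ 2) := by
  -- Two integrations by parts of the oscillating part; the remainder has a sign.
  set F : ℝ → ℝ := fun u => -(1 / 4) * (u ^ 2)⁻¹ + (1 / 2) * (Real.sin u * Real.cos u) * (u ^ 3)⁻¹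
    - (3 / 4) * Real.cos u ^ 2 * (u ^ 4)⁻¹ with hF
  set F' : ℝ → ℝ := fun u => Real.cos u ^ 2 * (u ^ 3)⁻¹ + 3 * Real.cos u ^ 2 * (u ^ 5)⁻¹ with hF'
  have hd : ∀ u ∈ Set.Ici x₀, HasDerivAt F (F' u) u := by
    intro u hu
    have hu0 : 0 < u := h0.trans_le hu
    have hi : ∀ n : ℕ, HasDerivAt (fun u : ℝ => (u ^ n)⁻¹) (-(n * u ^ (n - 1)) / (u ^ n) ^ 2) u :=
      fun n => (hasDerivAt_pow n u).inv (by positivity)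
    have hs := Real.hasDerivAt_sin u
    have hcu := Real.hasDerivAt_cos u
    have h := (((hi 2).const_mul (-(1 / 4))).add (((hs.mul hcu).const_mul (1 / 2)).mul (hi 3))).sub
      (((hcu.pow 2).const_mul (3 / 4)).mul (hi 4))
    refine h.congr_deriv ?_
    have hsq := Real.sin_sq_add_cos_sq u
    have hsq' : Real.sin u ^ 2 = 1 - Real.cos u ^ 2 := by linarith
    simp only [hF', Pi.mul_apply]
    norm_num
    field_simp
    ring_nf
    rw [hsq']; ring
  have hi : ∀ n : ℕ, 2 ≤ n → IntegrableOn (fun u : ℝ => (u ^ n)⁻¹) (Set.Ioi x₀) := by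
    intro n hn
    have hn' : (2:ℝ) ≤ n := by exact_mod_cast hn
    refine (integrableOn_Ioi_rpow_of_lt (a := -n) (by linarith) h0).congr_fun (fun u hu => ?_)
      measurableSet_Ioi
    simp only
    rw [Real.rpow_neg (h0.trans hu).le, Real.rpow_natCast]
  have hj : ∀ n : ℕ, 2 ≤ n → IntegrableOn (fun u : ℝ => Real.cos u ^ 2 * (u ^ n)⁻¹)
      (Set.Ioi x₀) := by
    intro n hn
    refine (hi n hn).mono' (by fun_prop) ?_
    filter_upwards [ae_restrict_mem measurableSet_Ioi] with u hu
    have hu0 : 0 < u := h0.trans hu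
    rw [Real.norm_of_nonneg (by positivity)]
    exact mul_le_of_le_one_left (by positivity) (Real.cos_sq_le_one u)
  have hF'i : IntegrableOn F' (Set.Ioi x₀) := by
    have h5 : IntegrableOn (fun u : ℝ => 3 * Real.cos u ^ 2 * (u ^ 5)⁻¹) (Set.Ioi x₀) := by
      have h := (hj 5 (by norm_num)).const_mul 3
      simp only [← mul_assoc] at h
      exact h
    exact (hj 3 (by norm_num)).add h5
  have hz : ∀ n : ℕ, n ≠ 0 → Filter.Tendsto (fun u : ℝ => (u ^ n)⁻¹) Filter.atTop (nhds 0) :=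
    fun n hn => (Filter.tendsto_pow_atTop hn).inv_tendsto_atTop
  have ht : Filter.Tendsto F Filter.atTop (nhds 0) := by
    have h1 := (hz 2 (by norm_num)).const_mul (-(1 / 4) : ℝ)
    have h2 : Filter.Tendsto (fun u : ℝ => (1 / 2) * (Real.sin u * Real.cos u) * (u ^ 3)⁻¹)
        Filter.atTop (nhds 0) := by
      refine squeeze_zero_norm' ?_ (hz 3 (by norm_num))
      filter_upwards [Filter.eventually_gt_atTop 0] with u hu
      rw [norm_mul, Real.norm_of_nonneg (show (0:ℝ) ≤ (u ^ 3)⁻¹ by positivity)]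
      refine mul_le_of_le_one_left (by positivity) ?_
      rw [Real.norm_eq_abs, abs_le]
      constructor <;> nlinarith [Real.sin_sq_add_cos_sq u, sq_nonneg (Real.sin u + Real.cos u),
        sq_nonneg (Real.sin u - Real.cos u)]
    have h3 : Filter.Tendsto (fun u : ℝ => (3 / 4) * Real.cos u ^ 2 * (u ^ 4)⁻¹)
        Filter.atTop (nhds 0) := by
      refine squeeze_zero_norm' ?_ (hz 4 (by norm_num))
      filter_upwards [Filter.eventually_gt_atTop 0] with u hu
      rw [Real.norm_of_nonneg (by positivity)]
      refine mul_le_of_le_one_left (by positivity) ?_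
      linarith [Real.cos_sq_le_one u]
    have h := (h1.add h2).sub h3
    rwa [mul_zero, add_zero, sub_zero] at h
  have h := integral_Ioi_of_hasDerivAt_of_tendsto' hd hF'i ht
  calc ∫ u in Set.Ioi x₀, Real.cos u ^ 2 * (u ^ 3)⁻¹ ≤ ∫ u in Set.Ioi x₀, F' u := by
        refine setIntegral_mono_on (hj 3 (by norm_num)) hF'i measurableSet_Ioi fun u hu => ?_
        have hu0 : 0 < u := h0.trans hu
        have : 0 ≤ 3 * Real.cos u ^ 2 * (u ^ 5)⁻¹ := by positivity
        simp only [hF']; linarith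
    _ = 1 / (4 * x₀ ^ 2) := by
        rw [h]; simp only [hF, hc]; field_simp; ring

theorem integral_Ioi_inv_cube {x₀ : ℝ} (h0 : 0 < x₀) :
    ∫ u in Set.Ioi x₀, (u ^ 3)⁻¹ = 1 / (2 * x₀ ^ 2) := by
  have h := integral_Ioi_rpow_of_lt (a := -3) (by norm_num) h0
  rw [show -(x₀ ^ ((-3:ℝ) + 1)) / (-3 + 1) = 1 / (2 * x₀ ^ 2) by
    rw [show (-3:ℝ) + 1 = -(2:ℕ) by norm_num, Real.rpow_neg h0.le, Real.rpow_natCast]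
    field_simp; norm_num] at h
  rw [← h]
  refine setIntegral_congr_fun measurableSet_Ioi fun u hu => ?_
  rw [show (-3:ℝ) = -((3:ℕ):ℝ) by norm_num, Real.rpow_neg (h0.trans hu).le, Real.rpow_natCast]

theorem integrableOn_Ioi_inv_cube {x₀ : ℝ} (h0 : 0 < x₀) :
    IntegrableOn (fun u : ℝ => (u ^ 3)⁻¹) (Set.Ioi x₀) := by
  refine (integrableOn_Ioi_rpow_of_lt (a := -3) (by norm_num) h0).congr_fun (fun u hu => ?_)
    measurableSet_Ioi
  beta_reduce
  rw [show (-3:ℝ) = -((3:ℕ):ℝ) by norm_num, Real.rpow_neg (h0.trans hu).le, Real.rpow_natCast]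

/-- Folding a bump centred at `π` about its centre. -/
theorem integral_bump_eq {f : ℝ → ℝ} (hf : Continuous f) (heven : ∀ v, f (-v) = f v) :
    ∫ u in (Real.pi / 2)..(3 * Real.pi / 2), f (u - Real.pi) * (u ^ 3)⁻¹
      = ∫ v in (0:ℝ)..(Real.pi / 2),
          f v * (((Real.pi + v) ^ 3)⁻¹ + ((Real.pi - v) ^ 3)⁻¹) := by
  have hpi := Real.pi_pos
  have e1 : ∫ u in (Real.pi / 2)..(3 * Real.pi / 2), f (u - Real.pi) * (u ^ 3)⁻¹
      = ∫ v in (-(Real.pi / 2))..(Real.pi / 2), f v * ((Real.pi + v) ^ 3)⁻¹ := by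
    have h := intervalIntegral.integral_comp_sub_right (a := Real.pi / 2) (b := 3 * Real.pi / 2)
      (fun v => f v * ((Real.pi + v) ^ 3)⁻¹) Real.pi
    rw [show Real.pi / 2 - Real.pi = -(Real.pi / 2) by ring,
      show 3 * Real.pi / 2 - Real.pi = Real.pi / 2 by ring] at h
    rw [← h]
    refine intervalIntegral.integral_congr fun u _ => ?_
    simp only [add_sub_cancel]
  have hcont : ContinuousOn (fun v => f v * ((Real.pi + v) ^ 3)⁻¹)
      (Set.Icc (-(Real.pi / 2)) (Real.pi / 2)) := by
    refine hf.continuousOn.mul (ContinuousOn.inv₀ (by fun_prop) fun v hv => ?_)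
    have : 0 < Real.pi + v := by linarith [hv.1]
    positivity
  have hcont2 : ContinuousOn (fun v => f v * ((Real.pi - v) ^ 3)⁻¹)
      (Set.Icc (-(Real.pi / 2)) (Real.pi / 2)) := by
    refine hf.continuousOn.mul (ContinuousOn.inv₀ (by fun_prop) fun v hv => ?_)
    have : 0 < Real.pi - v := by linarith [hv.2]
    positivity
  have i1 : IntervalIntegrable (fun v => f v * ((Real.pi + v) ^ 3)⁻¹) volume (-(Real.pi / 2)) 0 :=
    (hcont.mono (Set.Icc_subset_Icc_right (by positivity))).intervalIntegrable_of_Icc (by linarith)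
  have i2 : IntervalIntegrable (fun v => f v * ((Real.pi + v) ^ 3)⁻¹) volume 0 (Real.pi / 2) :=
    (hcont.mono (Set.Icc_subset_Icc_left (by linarith))).intervalIntegrable_of_Icc (by linarith)
  have i3 : IntervalIntegrable (fun v => f v * ((Real.pi - v) ^ 3)⁻¹) volume 0 (Real.pi / 2) :=
    (hcont2.mono (Set.Icc_subset_Icc_left (by linarith))).intervalIntegrable_of_Icc (by linarith)
  have e2 : ∫ v in (-(Real.pi / 2))..0, f v * ((Real.pi + v) ^ 3)⁻¹
      = ∫ v in (0:ℝ)..(Real.pi / 2), f v * ((Real.pi - v) ^ 3)⁻¹ := by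
    have h := intervalIntegral.integral_comp_neg (a := 0) (b := Real.pi / 2)
      (fun v => f v * ((Real.pi + v) ^ 3)⁻¹)
    rw [neg_zero] at h
    rw [← h]
    refine intervalIntegral.integral_congr fun v _ => ?_
    simp only [heven, sub_eq_add_neg]
  rw [e1, ← intervalIntegral.integral_add_adjacent_intervals i1 i2, e2, add_comm,
    ← intervalIntegral.integral_add i2 i3]
  refine intervalIntegral.integral_congr fun v _ => ?_
  ring

/-- The constant `53 / 2` makes the quartic upper bound just hold at the endpoint `v = π / 2`. -/
theorem inv_cube_add_inv_cube_bounds {v : ℝ} (h0 : 0 ≤ v) (h1 : v ≤ Real.pi / 2) :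
    2 / Real.pi ^ 3 * (1 + 6 / Real.pi ^ 2 * v ^ 2)
        ≤ ((Real.pi + v) ^ 3)⁻¹ + ((Real.pi - v) ^ 3)⁻¹ ∧
      ((Real.pi + v) ^ 3)⁻¹ + ((Real.pi - v) ^ 3)⁻¹
        ≤ 2 / Real.pi ^ 3 * (1 + 6 / Real.pi ^ 2 * v ^ 2 + 53 / 2 / Real.pi ^ 4 * v ^ 4) := by
  have hpi := Real.pi_pos
  obtain ⟨z, rfl⟩ : ∃ z, v = Real.pi * z := ⟨v / Real.pi, by field_simp⟩
  have hz0 : 0 ≤ z := nonneg_of_mul_nonneg_right h0 hpi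
  have hz1 : z ≤ 1 / 2 := by
    by_contra h; push Not at h; nlinarith
  obtain ⟨w, hw⟩ : ∃ w, w = z ^ 2 := ⟨_, rfl⟩
  have hw0 : 0 ≤ w := hw ▸ sq_nonneg z
  have hw1 : w ≤ 1 / 4 := by rw [hw]; nlinarith
  have hz2 : 0 < 1 - z := by linarith
  have e : ((Real.pi + Real.pi * z) ^ 3)⁻¹ + ((Real.pi - Real.pi * z) ^ 3)⁻¹
      = (Real.pi ^ 3)⁻¹ * ((2 + 6 * w) / (1 - w) ^ 3) := by
    have h1 : Real.pi + Real.pi * z ≠ 0 := by positivity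
    have h2 : Real.pi - Real.pi * z = Real.pi * (1 - z) := by ring
    have h3 : (1 - w) = (1 - z) * (1 + z) := by rw [hw]; ring
    rw [h3, h2, show Real.pi + Real.pi * z = Real.pi * (1 + z) by ring, hw]
    field_simp
    ring
  have hw2 : 0 < (1 - w) ^ 3 := by have : 0 < 1 - w := by linarith
                                   positivity
  rw [e]
  constructor
  · rw [show 2 / Real.pi ^ 3 * (1 + 6 / Real.pi ^ 2 * (Real.pi * z) ^ 2)
      = (Real.pi ^ 3)⁻¹ * (2 + 12 * w) by rw [hw]; field_simp; ring]
    refine mul_le_mul_of_nonneg_left ?_ (by positivity)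
    rw [le_div_iff₀ hw2]
    nlinarith [mul_nonneg hw0 hw0, mul_nonneg (mul_nonneg hw0 hw0) (sub_nonneg.2 hw1),
      mul_nonneg (mul_nonneg (mul_nonneg hw0 hw0) hw0) (sub_nonneg.2 hw1),
      pow_nonneg hw0 3, pow_nonneg hw0 4]
  · rw [show 2 / Real.pi ^ 3 * (1 + 6 / Real.pi ^ 2 * (Real.pi * z) ^ 2
        + 53 / 2 / Real.pi ^ 4 * (Real.pi * z) ^ 4)
      = (Real.pi ^ 3)⁻¹ * (2 + 12 * w + 53 * w ^ 2) by rw [hw]; field_simp; ring]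
    refine mul_le_mul_of_nonneg_left ?_ (by positivity)
    rw [div_le_iff₀ hw2]
    have h : 0 ≤ w ^ 2 * (23 - 125 * w + 147 * w ^ 2 - 53 * w ^ 3) := by
      refine mul_nonneg (sq_nonneg w) ?_
      nlinarith [mul_nonneg hw0 (sub_nonneg.2 hw1), mul_nonneg (sq_nonneg w) (sub_nonneg.2 hw1),
        sq_nonneg (w - 1 / 4)]
    linarith [h, show (2 + 12 * w + 53 * w ^ 2) * (1 - w) ^ 3 - (2 + 6 * w)
      = w ^ 2 * (23 - 125 * w + 147 * w ^ 2 - 53 * w ^ 3) by ring]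

theorem integral_cos_mul_even_quartic (A B C : ℝ) :
    ∫ v in (0:ℝ)..(Real.pi / 2), Real.cos v * (A + B * v ^ 2 + C * v ^ 4)
      = A + B * (Real.pi ^ 2 / 4 - 2) + C * (Real.pi ^ 4 / 16 - 3 * Real.pi ^ 2 + 24) := by
  have hd : ∀ v ∈ Set.uIcc (0:ℝ) (Real.pi / 2), HasDerivAt (fun v => Real.sin v *
      (A + B * (v ^ 2 - 2) + C * (v ^ 4 - 12 * v ^ 2 + 24))
        + Real.cos v * (B * (2 * v) + C * (4 * v ^ 3 - 24 * v)))
      (Real.cos v * (A + B * v ^ 2 + C * v ^ 4)) v := by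
    intro v _
    have h2 := hasDerivAt_pow 2 v
    have h3 := hasDerivAt_pow 3 v
    have h4 := hasDerivAt_pow 4 v
    refine (((Real.hasDerivAt_sin v).mul ((((h2.sub_const 2).const_mul B).const_add A).add
      (((h4.sub (h2.const_mul 12)).add_const 24).const_mul C))).add
      ((Real.hasDerivAt_cos v).mul ((((hasDerivAt_id v).const_mul 2).const_mul B).add
      (((h3.const_mul 4).sub ((hasDerivAt_id v).const_mul 24)).const_mul C)))).congr_deriv ?_
    simp only [id, Pi.add_apply]; norm_num; ring
  rw [intervalIntegral.integral_eq_sub_of_hasDerivAt hd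
    (Continuous.intervalIntegrable (by fun_prop) _ _)]
  simp; ring

theorem integral_cos_cube_mul_even_quartic (A B C : ℝ) :
    ∫ v in (0:ℝ)..(Real.pi / 2), Real.cos v ^ 3 * (A + B * v ^ 2 + C * v ^ 4)
      = 2 / 3 * A + B * (Real.pi ^ 2 / 6 - 40 / 27)
        + C * (Real.pi ^ 4 / 24 - 20 * Real.pi ^ 2 / 9 + 1456 / 81) := by
  have hd : ∀ v ∈ Set.uIcc (0:ℝ) (Real.pi / 2), HasDerivAt (fun v =>
      Real.sin v * (A + B * (v ^ 2 - 14 / 9) + C * (v ^ 4 - 28 / 3 * v ^ 2 + 488 / 27))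
        - Real.sin v ^ 3 * (A / 3 + B * (v ^ 2 / 3 - 2 / 27)
          + C * (v ^ 4 / 3 - 4 / 9 * v ^ 2 + 8 / 81))
        + Real.cos v * (B * (4 / 3 * v) + C * (8 / 3 * v ^ 3 - 160 / 9 * v))
        + Real.cos v ^ 3 * (B * (2 / 9 * v) + C * (4 / 9 * v ^ 3 - 8 / 27 * v)))
      (Real.cos v ^ 3 * (A + B * v ^ 2 + C * v ^ 4)) v := by
    intro v _
    have h1 := hasDerivAt_id v
    have h2 := hasDerivAt_pow 2 v
    have h3 := hasDerivAt_pow 3 v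
    have h4 := hasDerivAt_pow 4 v
    have hs := Real.hasDerivAt_sin v
    have hc := Real.hasDerivAt_cos v
    refine ((((hs.mul ((((h2.sub_const (14 / 9)).const_mul B).const_add A).add
      (((h4.sub (h2.const_mul (28 / 3))).add_const (488 / 27)).const_mul C))).sub
      ((hs.pow 3).mul (((((h2.div_const 3).sub_const (2 / 27)).const_mul B).const_add (A / 3)).add
      ((((h4.div_const 3).sub (h2.const_mul (4 / 9))).add_const (8 / 81)).const_mul C)))).add
      (hc.mul (((h1.const_mul (4 / 3)).const_mul B).add
      (((h3.const_mul (8 / 3)).sub (h1.const_mul (160 / 9))).const_mul C)))).add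
      ((hc.pow 3).mul (((h1.const_mul (2 / 9)).const_mul B).add
      (((h3.const_mul (4 / 9)).sub (h1.const_mul (8 / 27))).const_mul C)))).congr_deriv ?_
    have hsq' : Real.sin v ^ 2 = 1 - Real.cos v ^ 2 := by linarith [Real.sin_sq_add_cos_sq v]
    have hsq3 : Real.sin v ^ 3 = Real.sin v * (1 - Real.cos v ^ 2) := by rw [← hsq']; ring
    simp only [id, Pi.add_apply, Pi.sub_apply, Pi.pow_apply]
    norm_num
    rw [hsq', hsq3]
    ring
  rw [intervalIntegral.integral_eq_sub_of_hasDerivAt hd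
    (Continuous.intervalIntegrable (by fun_prop) _ _)]
  simp; ring

theorem pi_inv_bounds : 0.3183098 < Real.pi⁻¹ ∧ Real.pi⁻¹ < 0.31831 := by
  have h1 := Real.pi_gt_d6
  have h2 := Real.pi_lt_d6
  constructor
  · rw [lt_inv_comm₀ (by norm_num) Real.pi_pos]; norm_num at h2 ⊢; linarith
  · rw [inv_lt_comm₀ Real.pi_pos (by norm_num)]; norm_num at h1 ⊢; linarith

theorem intervalIntegrable_bump {f : ℝ → ℝ} (hf : Continuous f) :
    IntervalIntegrable (fun v => f v * (((Real.pi + v) ^ 3)⁻¹ + ((Real.pi - v) ^ 3)⁻¹)) volume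
      0 (Real.pi / 2) := by
  have hpi := Real.pi_pos
  refine ContinuousOn.intervalIntegrable_of_Icc (by positivity)
    (hf.continuousOn.mul (ContinuousOn.add
      (ContinuousOn.inv₀ (by fun_prop) fun v hv => ?_)
      (ContinuousOn.inv₀ (by fun_prop) fun v hv => ?_)))
  · have : 0 < Real.pi + v := by linarith [hv.1]
    positivity
  · have : 0 < Real.pi - v := by linarith [hv.2]
    positivity

/-- The first negative bump of `cos`, against `u⁻³`. -/
theorem integral_bump_cos_le :
    ∫ u in (Real.pi / 2)..(3 * Real.pi / 2), Real.cos (u - Real.pi) * (u ^ 3)⁻¹ ≤ 73 / 800 := by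
  have hpi := Real.pi_pos
  rw [integral_bump_eq Real.continuous_cos Real.cos_neg]
  calc ∫ v in (0:ℝ)..(Real.pi / 2), Real.cos v * (((Real.pi + v) ^ 3)⁻¹ + ((Real.pi - v) ^ 3)⁻¹)
      ≤ ∫ v in (0:ℝ)..(Real.pi / 2), Real.cos v * (2 / Real.pi ^ 3
          + 12 / Real.pi ^ 5 * v ^ 2 + 53 / Real.pi ^ 7 * v ^ 4) := by
        refine intervalIntegral.integral_mono_on (by positivity)
          (intervalIntegrable_bump Real.continuous_cos)
          (Continuous.intervalIntegrable (by fun_prop) _ _) fun v hv => ?_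
        refine mul_le_mul_of_nonneg_left ?_
          (Real.cos_nonneg_of_mem_Icc ⟨by linarith [hv.1], hv.2⟩)
        refine (inv_cube_add_inv_cube_bounds hv.1 hv.2).2.trans_eq ?_
        field_simp; ring
    _ ≤ 73 / 800 := by
        rw [integral_cos_mul_even_quartic]
        obtain ⟨h1, h2⟩ := pi_inv_bounds
        set y := Real.pi⁻¹ with hy
        have hy0 : 0 < y := by positivity
        rw [show 2 / Real.pi ^ 3 + 12 / Real.pi ^ 5 * (Real.pi ^ 2 / 4 - 2)
          + 53 / Real.pi ^ 7 * (Real.pi ^ 4 / 16 - 3 * Real.pi ^ 2 + 24)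
          = 133 / 16 * y ^ 3 - 183 * y ^ 5 + 1272 * y ^ 7 by rw [hy]; field_simp; ring]
        have k3 := pow_le_pow_left₀ hy0.le h2.le 3
        have k5 := pow_le_pow_left₀ (by norm_num) h1.le 5
        have k7 := pow_le_pow_left₀ hy0.le h2.le 7
        norm_num at k3 k5 k7
        linarith

theorem integral_bump_cos_cube_bounds :
    247 / 5000 ≤ ∫ u in (Real.pi / 2)..(3 * Real.pi / 2), Real.cos (u - Real.pi) ^ 3 * (u ^ 3)⁻¹ ∧
      ∫ u in (Real.pi / 2)..(3 * Real.pi / 2), Real.cos (u - Real.pi) ^ 3 * (u ^ 3)⁻¹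
        ≤ 32 / 625 := by
  have hpi := Real.pi_pos
  have hc : Continuous fun v => Real.cos v ^ 3 := by fun_prop
  rw [integral_bump_eq (f := fun v => Real.cos v ^ 3) hc fun v => by rw [Real.cos_neg]]
  obtain ⟨h1, h2⟩ := pi_inv_bounds
  set y := Real.pi⁻¹ with hy
  have hy0 : 0 < y := by positivity
  have k3 := pow_le_pow_left₀ hy0.le h2.le 3
  have k5 := pow_le_pow_left₀ (by norm_num) h1.le 5
  have k7 := pow_le_pow_left₀ hy0.le h2.le 7
  have l3 := pow_le_pow_left₀ (by norm_num) h1.le 3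
  have l5 := pow_le_pow_left₀ hy0.le h2.le 5
  norm_num at k3 k5 k7 l3 l5
  have hpos : ∀ v ∈ Set.Icc (0:ℝ) (Real.pi / 2), 0 ≤ Real.cos v ^ 3 := fun v hv =>
    pow_nonneg (Real.cos_nonneg_of_mem_Icc ⟨by linarith [hv.1], hv.2⟩) 3
  constructor
  · calc (247:ℝ) / 5000 ≤ ∫ v in (0:ℝ)..(Real.pi / 2), Real.cos v ^ 3 * (2 / Real.pi ^ 3
          + 12 / Real.pi ^ 5 * v ^ 2 + 0 * v ^ 4) := by
          rw [integral_cos_cube_mul_even_quartic,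
            show 2 / 3 * (2 / Real.pi ^ 3) + 12 / Real.pi ^ 5 * (Real.pi ^ 2 / 6 - 40 / 27)
              + 0 * (Real.pi ^ 4 / 24 - 20 * Real.pi ^ 2 / 9 + 1456 / 81)
              = 10 / 3 * y ^ 3 - 160 / 9 * y ^ 5 by rw [hy]; field_simp; ring]
          linarith
      _ ≤ _ := by
          refine intervalIntegral.integral_mono_on (by positivity)
            (Continuous.intervalIntegrable (by fun_prop) _ _) (intervalIntegrable_bump hc)
            fun v hv => ?_
          refine mul_le_mul_of_nonneg_left ?_ (hpos v hv)
          refine Eq.trans_le ?_ (inv_cube_add_inv_cube_bounds hv.1 hv.2).1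
          field_simp; ring
  · calc _ ≤ ∫ v in (0:ℝ)..(Real.pi / 2), Real.cos v ^ 3 * (2 / Real.pi ^ 3
          + 12 / Real.pi ^ 5 * v ^ 2 + 53 / Real.pi ^ 7 * v ^ 4) := by
          refine intervalIntegral.integral_mono_on (by positivity)
            (intervalIntegrable_bump hc)
            (Continuous.intervalIntegrable (by fun_prop) _ _) fun v hv => ?_
          refine mul_le_mul_of_nonneg_left ?_ (hpos v hv)
          refine (inv_cube_add_inv_cube_bounds hv.1 hv.2).2.trans_eq ?_
          field_simp; ring
      _ ≤ 32 / 625 := by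
          rw [integral_cos_cube_mul_even_quartic,
            show 2 / 3 * (2 / Real.pi ^ 3) + 12 / Real.pi ^ 5 * (Real.pi ^ 2 / 6 - 40 / 27)
              + 53 / Real.pi ^ 7 * (Real.pi ^ 4 / 24 - 20 * Real.pi ^ 2 / 9 + 1456 / 81)
              = 133 / 24 * y ^ 3 - 1220 / 9 * y ^ 5 + 77168 / 81 * y ^ 7 by
                rw [hy]; field_simp; ring]
          linarith

/-! ### The gap between a Gaussian and a power of the cosine: reduction to exponent two -/

section GaussCosGap

theorem exp_neg_le_quadratic {x : ℝ} (hx : 0 ≤ x) : Real.exp (-x) ≤ 1 - x + x ^ 2 / 2 := by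
  have h := Real.quadratic_le_exp_of_nonneg hx
  have h0 : 0 < 1 - x + x ^ 2 / 2 := by nlinarith [sq_nonneg (x - 1)]
  rw [Real.exp_neg, inv_le_iff_one_le_mul₀ (Real.exp_pos x)]
  nlinarith [mul_le_mul_of_nonneg_left h h0.le, sq_nonneg (x ^ 2)]

theorem rpow_neg_two_sub_one {u : ℝ} (hu : 0 < u) : u ^ (-(2:ℝ) - 1) = (u ^ 3)⁻¹ := by
  rw [show -(2:ℝ) - 1 = -((3:ℕ):ℝ) by norm_num, Real.rpow_neg hu.le, Real.rpow_natCast]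

/-- The difference between the characteristic function of a centred Gaussian variable of variance `s`
and `|cos u| ^ s`. With `s = 1 / b ^ 2` and `u = b * t` the first term is `exp (-t ^ 2 / 2)` for every
`b`. -/
noncomputable def gaussCosGap (s u : ℝ) : ℝ := Real.exp (-(s * u ^ 2 / 2)) - |Real.cos u| ^ s

variable {s : ℝ}

theorem measurable_gaussCosGap : Measurable (gaussCosGap s) := by
  unfold gaussCosGap; fun_prop

theorem gaussCosGap_nonneg_of_le {u : ℝ} (hs : 0 ≤ s)
    (h : |Real.cos u| ≤ Real.exp (-(u ^ 2 / 2))) : 0 ≤ gaussCosGap s u := by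
  have := Real.rpow_le_rpow (abs_nonneg _) h hs
  rw [← Real.exp_mul, show -(u ^ 2 / 2) * s = -(s * u ^ 2 / 2) by ring] at this
  exact sub_nonneg.2 this

theorem gaussCosGap_nonpos_of_ge {u : ℝ} (hs : 0 ≤ s)
    (h : Real.exp (-(u ^ 2 / 2)) ≤ |Real.cos u|) : gaussCosGap s u ≤ 0 := by
  have := Real.rpow_le_rpow (Real.exp_pos _).le h hs
  rw [← Real.exp_mul, show -(u ^ 2 / 2) * s = -(s * u ^ 2 / 2) by ring] at this
  exact sub_nonpos.2 this

theorem abs_cos_le_exp {u : ℝ} (h0 : 0 ≤ u) (h1 : u ≤ Real.pi / 2) :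
    |Real.cos u| ≤ Real.exp (-(u ^ 2 / 2)) := by
  rw [abs_of_nonneg (Real.cos_nonneg_of_mem_Icc ⟨by linarith [Real.pi_pos], h1⟩)]
  refine (cos_le_exp_neg_sq_add_pow_four h0 h1).trans (Real.exp_le_exp.2 ?_)
  have : 0 ≤ u ^ 4 := by positivity
  linarith

theorem abs_gaussCosGap_le_one (hs : 0 ≤ s) (u : ℝ) : |gaussCosGap s u| ≤ 1 := by
  have h1 : |Real.cos u| ^ s ≤ 1 :=
    Real.rpow_le_one (abs_nonneg _) (Real.abs_cos_le_one u) hs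
  have h2 : 0 ≤ |Real.cos u| ^ s := Real.rpow_nonneg (abs_nonneg _) _
  have h3 : Real.exp (-(s * u ^ 2 / 2)) ≤ 1 := Real.exp_le_one_iff.2 (by
    have := mul_nonneg hs (sq_nonneg u); linarith)
  have h4 := Real.exp_pos (-(s * u ^ 2 / 2))
  unfold gaussCosGap
  rw [abs_le]; constructor <;> linarith

theorem abs_gaussCosGap_le_pow_four (hs : 1 ≤ s) {u : ℝ} (h0 : 0 < u) (h1 : u ≤ 1) :
    |gaussCosGap s u| ≤ s ^ 2 * u ^ 4 := by
  have hpi := Real.pi_gt_three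
  rw [abs_of_nonneg (gaussCosGap_nonneg_of_le (by linarith)
    (abs_cos_le_exp h0.le (by linarith)))]
  have e1 := exp_neg_le_quadratic (x := s * u ^ 2 / 2) (by positivity)
  have hu2 : u ^ 2 ≤ 1 := by nlinarith
  have e2 := one_add_mul_self_le_rpow_one_add (s := -(u ^ 2 / 2)) (by linarith) hs
  have e3 : (1 + -(u ^ 2 / 2)) ^ s ≤ |Real.cos u| ^ s := by
    refine Real.rpow_le_rpow (by linarith) ?_ (by linarith)
    have := Real.one_sub_sq_div_two_le_cos (x := u)
    exact le_trans (by linarith) (le_abs_self _)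
  have : 0 ≤ s ^ 2 * u ^ 4 := by positivity
  unfold gaussCosGap
  nlinarith

theorem integrableOn_gaussCosGap_mul_rpow (hs : 1 ≤ s) {p : ℝ} (h0 : 0 < p) (h4 : p < 4) :
    IntegrableOn (fun u => gaussCosGap s u * u ^ (-p - 1)) (Set.Ioi 0) := by
  refine integrableOn_mul_rpow (C := s ^ 2) (m := 4) (n := 0) measurable_gaussCosGap
    (fun u => abs_gaussCosGap_le_pow_four hs) (fun u _ => ?_) (by exact_mod_cast h0)
    (by exact_mod_cast h4)
  have := abs_gaussCosGap_le_one (s := s) (by linarith) u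
  rw [pow_zero, mul_one]; nlinarith

theorem integrableOn_gaussCosGap (hs : 1 ≤ s) :
    IntegrableOn (fun u => gaussCosGap s u * (u ^ 3)⁻¹) (Set.Ioi 0) := by
  refine IntegrableOn.congr_fun
    (integrableOn_gaussCosGap_mul_rpow hs two_pos (by norm_num)) (fun u hu => ?_) measurableSet_Ioi
  rw [rpow_neg_two_sub_one hu]

/-- `|cos|` crosses the Gaussian `exp (-u ^ 2 / 2)` exactly once on `[0, π]`. -/
theorem exists_cos_crossing : ∃ c, 0 < c ∧ c < Real.pi ∧
    (∀ u, 0 ≤ u → u ≤ c → |Real.cos u| ≤ Real.exp (-(u ^ 2 / 2))) ∧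
    ∀ u, c ≤ u → u ≤ Real.pi → Real.exp (-(u ^ 2 / 2)) ≤ |Real.cos u| := by
  have hpi := Real.pi_pos
  set h : ℝ → ℝ := fun u => Real.exp (-(u ^ 2 / 2)) + Real.cos u with hh
  have hanti : AntitoneOn h (Set.Icc 0 Real.pi) := by
    refine AntitoneOn.add (fun x hx y hy hxy => Real.exp_le_exp.2 ?_)
      Real.strictAntiOn_cos.antitoneOn
    have := pow_le_pow_left₀ hx.1 hxy 2
    linarith
  obtain ⟨c, hc, hc0⟩ : (0:ℝ) ∈ h '' Set.Icc (Real.pi / 2) Real.pi := by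
    refine intermediate_value_Icc' (by linarith) (by fun_prop) ⟨?_, ?_⟩
    · have : Real.exp (-(Real.pi ^ 2 / 2)) ≤ 1 := Real.exp_le_one_iff.2 (by
        have := sq_nonneg Real.pi; linarith)
      simp only [hh, Real.cos_pi]; linarith
    · simp only [hh, Real.cos_pi_div_two, add_zero]; positivity
  have hcpi : c < Real.pi := by
    refine lt_of_le_of_ne hc.2 fun e => ?_
    have : Real.exp (-(Real.pi ^ 2 / 2)) < 1 := by
      rw [← Real.exp_zero, Real.exp_lt_exp]
      have : 0 < Real.pi ^ 2 := by positivity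
      linarith
    simp only [hh, e, Real.cos_pi] at hc0; linarith
  have hc1 : 0 < c := by linarith [hc.1]
  refine ⟨c, hc1, hcpi, fun u h0 hu => ?_, fun u hu h1 => ?_⟩
  · rcases le_total u (Real.pi / 2) with h2 | h2
    · exact abs_cos_le_exp h0 h2
    · have := hanti ⟨h0, hu.trans hcpi.le⟩ ⟨hc1.le, hcpi.le⟩ hu
      rw [abs_of_nonpos (Real.cos_nonpos_of_pi_div_two_le_of_le h2 (by linarith))]
      simp only [hh] at this hc0; linarith
  · have := hanti ⟨hc1.le, hcpi.le⟩ ⟨by linarith, h1⟩ hu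
    rw [abs_of_nonpos (Real.cos_nonpos_of_pi_div_two_le_of_le (by linarith [hc.1]) (by linarith))]
    simp only [hh] at this hc0; linarith

theorem integrableOn_exp_neg_mul_inv_cube (hs : 0 ≤ s) :
    IntegrableOn (fun u : ℝ => Real.exp (-(s * u ^ 2 / 2)) * (u ^ 3)⁻¹) (Set.Ioi Real.pi) := by
  have hpi := Real.pi_pos
  refine (integrableOn_Ioi_inv_cube hpi).mono' (by fun_prop) ?_
  filter_upwards [ae_restrict_mem measurableSet_Ioi] with u hu
  have hu0 : 0 < u := hpi.trans hu
  rw [Real.norm_of_nonneg (by positivity)]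
  refine mul_le_of_le_one_left (by positivity) (Real.exp_le_one_iff.2 ?_)
  have := mul_nonneg hs (sq_nonneg u); linarith

/-- After removal of the Gaussian tail beyond `π`, the gap changes sign exactly once, from `+` to `-`,
so passing from the weight `u ^ (-3)` to the faster decreasing `u ^ (-p - 1)` preserves positivity. -/
theorem integral_gaussCosGap_mul_rpow_nonneg (hs : 1 ≤ s)
    (h : ∫ u in Set.Ioi Real.pi, Real.exp (-(s * u ^ 2 / 2)) * (u ^ 3)⁻¹
      ≤ ∫ u in Set.Ioi 0, gaussCosGap s u * (u ^ 3)⁻¹) {p : ℝ} (h2 : 2 < p) (h4 : p < 4) :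
    0 ≤ ∫ u in Set.Ioi 0, gaussCosGap s u * u ^ (-p - 1) := by
  have hpi := Real.pi_pos
  have hs0 : 0 ≤ s := by linarith
  obtain ⟨c, hc0, hcpi, hle, hge⟩ := exists_cos_crossing
  set T : ℝ → ℝ := (Set.Ioi Real.pi).indicator fun u => Real.exp (-(s * u ^ 2 / 2)) * (u ^ 3)⁻¹
    with hT
  have hTi := integrableOn_exp_neg_mul_inv_cube hs0
  have hTi' : Integrable T := hTi.integrable_indicator measurableSet_Ioi
  have hTint : ∫ u in Set.Ioi 0, T u
      = ∫ u in Set.Ioi Real.pi, Real.exp (-(s * u ^ 2 / 2)) * (u ^ 3)⁻¹ := by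
    rw [hT, setIntegral_indicator measurableSet_Ioi, Set.inter_eq_right.2 (Set.Ioi_subset_Ioi hpi.le)]
  have hgi := integrableOn_gaussCosGap hs
  have key : ∀ u ∈ Set.Ioi (0:ℝ), c ^ (-(p - 2)) * (gaussCosGap s u * (u ^ 3)⁻¹ - T u)
      ≤ gaussCosGap s u * u ^ (-p - 1) := by
    intro u hu
    have hu0 : 0 < u := hu
    have e : u ^ (-p - 1) = (u ^ 3)⁻¹ * u ^ (-(p - 2)) := by
      rw [← rpow_neg_two_sub_one hu0, ← Real.rpow_add hu0]; congr 1; ring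
    rw [e]
    have hu3 : 0 < (u ^ 3)⁻¹ := by positivity
    have hup : 0 < u ^ (-(p - 2)) := Real.rpow_pos_of_pos hu0 _
    have hcp : 0 < c ^ (-(p - 2)) := Real.rpow_pos_of_pos hc0 _
    rcases le_or_gt u c with huc | huc
    · have hT0 : T u = 0 := Set.indicator_of_notMem (by simp; linarith) _
      have hg := gaussCosGap_nonneg_of_le hs0 (hle u hu0.le huc)
      have hm : c ^ (-(p - 2)) ≤ u ^ (-(p - 2)) :=
        Real.rpow_le_rpow_of_nonpos hu0 huc (by linarith)
      rw [hT0, sub_zero]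
      nlinarith [mul_le_mul_of_nonneg_left hm (mul_nonneg hg hu3.le)]
    · have hm : u ^ (-(p - 2)) ≤ c ^ (-(p - 2)) :=
        Real.rpow_le_rpow_of_nonpos hc0 huc.le (by linarith)
      rcases le_or_gt u Real.pi with hup' | hup'
      · have hT0 : T u = 0 := Set.indicator_of_notMem (by simp; linarith) _
        have hg := gaussCosGap_nonpos_of_ge hs0 (hge u huc.le hup')
        rw [hT0, sub_zero]
        nlinarith [mul_le_mul_of_nonneg_left hm (mul_nonneg (neg_nonneg.2 hg) hu3.le)]
      · have hT1 : T u = Real.exp (-(s * u ^ 2 / 2)) * (u ^ 3)⁻¹ :=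
          Set.indicator_of_mem (s := Set.Ioi Real.pi) hup' _
        have hr : 0 ≤ |Real.cos u| ^ s := Real.rpow_nonneg (abs_nonneg _) _
        have hx := Real.exp_pos (-(s * u ^ 2 / 2))
        rw [hT1]
        unfold gaussCosGap
        have h1 := mul_le_mul_of_nonneg_left hm (mul_nonneg hr hu3.le)
        have h2 := mul_pos (mul_pos hx hu3) hup
        nlinarith
  have hc := setIntegral_mono_on ((hgi.sub hTi'.integrableOn).const_mul (c ^ (-(p - 2))))
    (integrableOn_gaussCosGap_mul_rpow hs (by linarith) h4) measurableSet_Ioi key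
  refine le_trans ?_ hc
  rw [integral_const_mul]
  refine mul_nonneg (Real.rpow_nonneg hc0.le _) ?_
  have := integral_sub hgi hTi'.integrableOn
  simp only [Pi.sub_apply] at this ⊢
  rw [this, hTint]; linarith

/-- The Gaussian tail that the single-crossing argument gives away is tiny. -/
theorem integral_exp_neg_mul_inv_cube_le (hs : 5 / 3 ≤ s) :
    ∫ u in Set.Ioi Real.pi, Real.exp (-(s * u ^ 2 / 2)) * (u ^ 3)⁻¹ ≤ 1 / 15000 := by
  have hpi := Real.pi_gt_three
  have hpi0 := Real.pi_pos
  have h7 : Real.exp (-7) ≤ 1 / 1000 := by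
    have h := pow_le_pow_left₀ (by norm_num) Real.exp_one_gt_d9.le 7
    rw [← Real.exp_nat_mul, show ((7:ℕ):ℝ) * 1 = 7 by norm_num] at h
    rw [Real.exp_neg, inv_le_comm₀ (Real.exp_pos _) (by norm_num)]
    refine le_trans ?_ h
    norm_num
  calc _ ≤ ∫ u in Set.Ioi Real.pi, 1 / 1000 * (u ^ 3)⁻¹ := by
        refine setIntegral_mono_on (integrableOn_exp_neg_mul_inv_cube (by linarith))
          ((integrableOn_Ioi_inv_cube hpi0).const_mul _) measurableSet_Ioi fun u hu => ?_
        have hu0 : 0 < u := hpi0.trans hu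
        refine mul_le_mul_of_nonneg_right (le_trans (Real.exp_le_exp.2 ?_) h7) (by positivity)
        have hu' : Real.pi < u := hu
        have : 9 < u ^ 2 := by nlinarith
        nlinarith
    _ ≤ 1 / 15000 := by
        rw [integral_const_mul, integral_Ioi_inv_cube hpi0]
        have : 9 < Real.pi ^ 2 := by nlinarith
        rw [div_mul_div_comm, div_le_div_iff₀ (by positivity) (by norm_num)]
        linarith

/-- Continuity in the exponent, from the right at `2`, of the moment integrals. -/
theorem tendsto_integral_mul_rpow {φ : ℝ → ℝ} (hm : Measurable φ) {C : ℝ} (hC : 0 ≤ C)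
    (h0 : ∀ u, 0 < u → u ≤ 1 → |φ u| ≤ C * u ^ 4) (h1 : ∀ u, 1 < u → |φ u| ≤ C) :
    Filter.Tendsto (fun p : ℝ => ∫ u in Set.Ioi 0, φ u * u ^ (-p - 1)) (nhdsWithin (2:ℝ) (Set.Ioi 2))
      (nhds (∫ u in Set.Ioi 0, φ u * (u ^ 3)⁻¹)) := by
  have hb : IntegrableOn (fun u : ℝ => (if u ≤ 1 then C else 0) + (if 1 < u then C * (u ^ 3)⁻¹ else 0))
      (Set.Ioi 0) := by
    rw [← Set.Ioc_union_Ioi_eq_Ioi (zero_le_one' ℝ)]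
    refine IntegrableOn.union ?_ ?_
    · refine IntegrableOn.congr_fun (f := fun _ => C) (by simp) (fun u hu => ?_) measurableSet_Ioc
      simp [hu.2, not_lt.2 hu.2]
    · refine IntegrableOn.congr_fun ((integrableOn_Ioi_inv_cube one_pos).const_mul C)
        (fun u hu => ?_) measurableSet_Ioi
      simp [not_le.2 (show 1 < u from hu), show 1 < u from hu]
  refine tendsto_integral_filter_of_dominated_convergence
    (μ := volume.restrict (Set.Ioi 0)) (F := fun (p u : ℝ) => φ u * u ^ (-p - 1))
    (f := fun u => φ u * (u ^ 3)⁻¹) _ ?_ ?_ hb ?_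
  · exact Filter.Eventually.of_forall fun p => by fun_prop
  · filter_upwards [Ioo_mem_nhdsGT (show (2:ℝ) < 3 by norm_num)] with p hp
    filter_upwards [ae_restrict_mem measurableSet_Ioi] with u hu
    have hu0 : 0 < u := hu
    rw [norm_mul, Real.norm_eq_abs, Real.norm_of_nonneg (Real.rpow_nonneg hu0.le _)]
    rcases le_or_gt u 1 with h | h
    · rw [if_pos h, if_neg (not_lt.2 h), add_zero]
      calc |φ u| * u ^ (-p - 1) ≤ C * u ^ 4 * u ^ (-p - 1) :=
            mul_le_mul_of_nonneg_right (h0 u hu0 h) (Real.rpow_nonneg hu0.le _)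
        _ = C * u ^ (4 + (-p - 1)) := by
            rw [mul_assoc, ← Real.rpow_natCast, ← Real.rpow_add hu0]; norm_num
        _ ≤ C * 1 := mul_le_mul_of_nonneg_left
            (Real.rpow_le_one hu0.le h (by linarith [hp.2])) hC
        _ = C := mul_one C
    · rw [if_neg (not_le.2 h), if_pos h, zero_add, ← rpow_neg_two_sub_one hu0]
      exact mul_le_mul (h1 u h) (Real.rpow_le_rpow_of_exponent_le h.le (by linarith [hp.1]))
        (Real.rpow_nonneg hu0.le _) hC
  · filter_upwards [ae_restrict_mem measurableSet_Ioi] with u hu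
    have hu0 : 0 < u := hu
    rw [← rpow_neg_two_sub_one hu0]
    have : ContinuousAt (fun p : ℝ => φ u * u ^ (-p - 1)) 2 := by
      have := (Real.continuous_const_rpow hu0.ne').comp
        (show Continuous fun p : ℝ => -p - 1 by fun_prop)
      exact (continuous_const.mul this).continuousAt
    exact this.tendsto.mono_left nhdsWithin_le_nhds

end GaussCosGap

/-! ### Explicit integrals of trigonometric polynomials -/

theorem cosKernel_le_pow_four' {u : ℝ} (h0 : 0 ≤ u) : cosKernel u ≤ u ^ 4 := by
  rcases le_total u 1 with h | h
  · exact cosKernel_le_pow_four h0 h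
  · exact (cosKernel_le_sq u).trans (pow_le_pow_right₀ h (by norm_num))

/-- The pole of `cosConst` at `2` has residue `1 / 2`. -/
theorem tendsto_sub_two_mul_cosConst :
    Filter.Tendsto (fun p : ℝ => (p - 2) * cosConst p) (nhdsWithin 2 (Set.Ioi 2))
      (nhds (1 / 2)) := by
  -- The pole comes from `u ^ 2 / 2` on `(1, ∞)`, which contributes `1 / (2 * (p - 2))`.
  set ψ : ℝ → ℝ := fun u => cosKernel u - if 1 < u then u ^ 2 / 2 else 0 with hψ
  have hm : Measurable ψ := continuous_cosKernel.measurable.sub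
    (Measurable.ite measurableSet_Ioi (by fun_prop) measurable_const)
  have h0 : ∀ u, 0 < u → u ≤ 1 → |ψ u| ≤ 2 * u ^ 4 := fun u h0 h1 => by
    simp only [hψ, if_neg (not_lt.2 h1), sub_zero]
    rw [abs_of_nonneg (cosKernel_nonneg u)]
    have : 0 ≤ u ^ 4 := by positivity
    linarith [cosKernel_le_pow_four h0.le h1]
  have h1 : ∀ u, 1 < u → |ψ u| ≤ 2 := fun u h1 => by
    simp only [hψ, if_pos h1, cosKernel]
    rw [abs_le]
    constructor <;> linarith [Real.cos_le_one u, Real.neg_one_le_cos u]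
  have ht := tendsto_integral_mul_rpow hm (by norm_num) h0 h1
  have hid : Filter.Tendsto (fun p : ℝ => p - 2) (nhdsWithin 2 (Set.Ioi 2)) (nhds 0) := by
    have : ContinuousAt (fun p : ℝ => p - 2) 2 := by fun_prop
    have := this.tendsto.mono_left (nhdsWithin_le_nhds (s := Set.Ioi 2))
    rwa [sub_self] at this
  have hlim := (hid.mul ht).const_add (1 / 2)
  rw [zero_mul, add_zero] at hlim
  refine hlim.congr' ?_
  filter_upwards [Ioo_mem_nhdsGT (show (2:ℝ) < 4 by norm_num)] with p hp
  have hp2 : 0 < p - 2 := sub_pos.2 hp.1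
  have hi1 : IntegrableOn (fun u => ψ u * u ^ (-p - 1)) (Set.Ioi 0) :=
    integrableOn_mul_rpow (C := 2) (m := 4) (n := 0) hm h0
      (fun u hu => by rw [pow_zero, mul_one]; exact h1 u hu)
      (by have := hp.1; push_cast; linarith) (by exact_mod_cast hp.2)
  have hr : ∀ u ∈ Set.Ioi (1:ℝ), u ^ (-p + 1) / 2 = u ^ 2 / 2 * u ^ (-p - 1) := fun u hu => by
    have hu0 : 0 < u := one_pos.trans hu
    rw [show -p + 1 = 2 + (-p - 1) by ring, Real.rpow_add hu0, Real.rpow_two]; ring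
  have hi2 : IntegrableOn (fun u : ℝ => u ^ 2 / 2 * u ^ (-p - 1)) (Set.Ioi 1) :=
    IntegrableOn.congr_fun ((integrableOn_Ioi_rpow_of_lt (by linarith) one_pos).div_const 2) hr
      measurableSet_Ioi
  have hv : ∫ u in Set.Ioi 1, u ^ 2 / 2 * u ^ (-p - 1) = 1 / (2 * (p - 2)) := by
    rw [← setIntegral_congr_fun measurableSet_Ioi hr, integral_div,
      integral_Ioi_rpow_of_lt (by linarith) one_pos, Real.one_rpow]
    have : -p + 1 + 1 ≠ 0 := by linarith
    have : p - 2 ≠ 0 := hp2.ne'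
    rw [show -p + 1 + 1 = -(p - 2) by ring]
    field_simp
  have hi3 : Integrable ((Set.Ioi 1).indicator fun u : ℝ => u ^ 2 / 2 * u ^ (-p - 1)) :=
    hi2.integrable_indicator measurableSet_Ioi
  have hsplit : cosConst p = (∫ u in Set.Ioi 0, ψ u * u ^ (-p - 1)) + 1 / (2 * (p - 2)) := by
    rw [← hv, ← Set.inter_eq_right.2 (Set.Ioi_subset_Ioi (zero_le_one' ℝ)),
      ← setIntegral_indicator measurableSet_Ioi, ← integral_add hi1 hi3.integrableOn]
    refine setIntegral_congr_fun measurableSet_Ioi fun u _ => ?_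
    rcases le_or_gt u 1 with h | h
    · rw [Set.indicator_of_notMem (by simpa using h)]
      simp only [hψ, if_neg (not_lt.2 h), sub_zero, add_zero]
    · rw [Set.indicator_of_mem (by simpa using h)]
      simp only [hψ, if_pos h]; ring
  rw [hsplit]
  field_simp
  ring

theorem integral_exp_kernel_mul_rpow {s : ℝ} (hs : 0 < s) {p : ℝ} (h2 : 2 < p) (h4 : p < 4) :
    ∫ u in Set.Ioi 0, (Real.exp (-(s * u ^ 2 / 2)) - 1 + s * u ^ 2 / 2) * u ^ (-p - 1)
      = cosConst p * (gaussMoment p * s ^ (p / 2)) := by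
  have h := integral_comp_mul_rpow (fun t => Real.exp (-t ^ 2 / 2) - 1 + t ^ 2 / 2)
    (Real.sqrt_pos.2 hs) p
  rw [← cosConst_mul_gaussMoment h2 h4, Real.sqrt_eq_rpow, ← Real.rpow_mul hs.le,
    show 1 / 2 * p = p / 2 by ring, ← Real.sqrt_eq_rpow] at h
  rw [mul_comm (gaussMoment p), ← mul_assoc, mul_comm (cosConst p), mul_assoc, ← h]
  refine setIntegral_congr_fun measurableSet_Ioi fun u _ => ?_
  rw [mul_pow, Real.sq_sqrt hs.le, neg_div]

theorem exp_kernel_nonneg (x : ℝ) : 0 ≤ Real.exp (-x) - 1 + x := by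
  linarith [Real.add_one_le_exp (-x)]

theorem integrableOn_exp_kernel {s : ℝ} (hs : 0 < s) {p : ℝ} (h2 : 2 < p) (h4 : p < 4) :
    IntegrableOn (fun u => (Real.exp (-(s * u ^ 2 / 2)) - 1 + s * u ^ 2 / 2) * u ^ (-p - 1))
      (Set.Ioi 0) := by
  refine integrableOn_mul_rpow (φ := fun u => Real.exp (-(s * u ^ 2 / 2)) - 1 + s * u ^ 2 / 2)
    (C := s ^ 2 + s) (m := 4) (n := 2) (by fun_prop) (fun u h0 _ => ?_)
    (fun u h1 => ?_) (by exact_mod_cast h2) (by exact_mod_cast h4)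
  · rw [abs_of_nonneg (exp_kernel_nonneg _)]
    have := exp_neg_le_quadratic (x := s * u ^ 2 / 2) (by positivity)
    have h1 : 0 ≤ s ^ 2 * u ^ 4 := by positivity
    have h2 : 0 ≤ s * u ^ 4 := by positivity
    nlinarith
  · rw [abs_of_nonneg (exp_kernel_nonneg _)]
    have : Real.exp (-(s * u ^ 2 / 2)) ≤ 1 := Real.exp_le_one_iff.2 (by
      have := mul_nonneg hs.le (sq_nonneg u); linarith)
    have h1 : 0 ≤ s ^ 2 * u ^ 2 := by positivity
    have h2 : 0 ≤ s * u ^ 2 := by positivity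
    nlinarith

theorem gauss_sub_cosCubic_eq {s c₁ c₂ c₃ : ℝ} (hsum : c₁ + c₂ + c₃ = 1)
    (hsq : c₁ + 2 * c₂ + 3 * c₃ = s) (u : ℝ) :
    Real.exp (-(s * u ^ 2 / 2)) - c₁ * Real.cos u - c₂ * Real.cos u ^ 2
        - c₃ * Real.cos u ^ 3
      = (Real.exp (-(s * u ^ 2 / 2)) - 1 + s * u ^ 2 / 2)
        - (c₁ + 3 / 4 * c₃) * cosKernel (1 * u) - c₂ / 2 * cosKernel (2 * u)
        - c₃ / 4 * cosKernel (3 * u) := by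
  simp only [cosKernel, Real.cos_two_mul, Real.cos_three_mul, one_mul]
  rw [← hsq, show c₁ = 1 - c₂ - c₃ by linarith]
  ring

theorem exists_abs_gauss_sub_cosCubic_le {s c₁ c₂ c₃ : ℝ} (hs : 0 < s) (hsum : c₁ + c₂ + c₃ = 1)
    (hsq : c₁ + 2 * c₂ + 3 * c₃ = s) : ∃ C, 0 ≤ C ∧
    (∀ u, 0 < u → u ≤ 1 → |Real.exp (-(s * u ^ 2 / 2)) - c₁ * Real.cos u - c₂ * Real.cos u ^ 2
        - c₃ * Real.cos u ^ 3| ≤ C * u ^ 4) ∧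
    ∀ u, 1 < u → |Real.exp (-(s * u ^ 2 / 2)) - c₁ * Real.cos u - c₂ * Real.cos u ^ 2
        - c₃ * Real.cos u ^ 3| ≤ C := by
  set C := s ^ 2 + 1 + |c₁| + 16 * |c₂| + 100 * |c₃| with hC
  refine ⟨C, by positivity, ?_, ?_⟩
  · intro u h0 _
    rw [gauss_sub_cosCubic_eq hsum hsq]
    have e0 := exp_kernel_nonneg (s * u ^ 2 / 2)
    have e1 := exp_neg_le_quadratic (x := s * u ^ 2 / 2) (by positivity)
    have k : ∀ a c : ℝ, 0 ≤ a → |c * cosKernel (a * u)| ≤ |c| * (a ^ 4 * u ^ 4) := by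
      intro a c ha
      rw [abs_mul, abs_of_nonneg (cosKernel_nonneg _), ← mul_pow]
      exact mul_le_mul_of_nonneg_left (cosKernel_le_pow_four' (by positivity)) (abs_nonneg c)
    have k1 := k 1 (c₁ + 3 / 4 * c₃) (by norm_num)
    have k2 := k 2 (c₂ / 2) (by norm_num)
    have k3 := k 3 (c₃ / 4) (by norm_num)
    have a1 : |c₁ + 3 / 4 * c₃| ≤ |c₁| + 3 / 4 * |c₃| := by
      refine (abs_add_le _ _).trans (le_of_eq ?_); rw [abs_mul]; norm_num
    have a2 : |c₂ / 2| = |c₂| / 2 := by rw [abs_div]; norm_num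
    have a3 : |c₃ / 4| = |c₃| / 4 := by rw [abs_div]; norm_num
    have hu : 0 ≤ u ^ 4 := by positivity
    rw [a2] at k2; rw [a3] at k3
    have k1' := k1.trans (mul_le_mul_of_nonneg_right a1 (by positivity))
    have n0 : 0 ≤ s ^ 2 * u ^ 4 := by positivity
    have n1 := mul_nonneg (abs_nonneg c₁) hu
    have n2 := mul_nonneg (abs_nonneg c₂) hu
    have n3 := mul_nonneg (abs_nonneg c₃) hu
    rw [abs_le] at k1' k2 k3
    rw [hC, abs_le]
    constructor <;> nlinarith
  · intro u _
    have e1 : Real.exp (-(s * u ^ 2 / 2)) ≤ 1 := Real.exp_le_one_iff.2 (by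
      have := mul_nonneg hs.le (sq_nonneg u); linarith)
    have e0 := Real.exp_pos (-(s * u ^ 2 / 2))
    have k : ∀ (n : ℕ) (c : ℝ), |c * Real.cos u ^ n| ≤ |c| := fun n c => by
      rw [abs_mul, abs_pow]
      exact mul_le_of_le_one_right (abs_nonneg c)
        (pow_le_one₀ (abs_nonneg _) (Real.abs_cos_le_one u))
    have k1 := k 1 c₁
    rw [pow_one] at k1
    have k2 := k 2 c₂
    have k3 := k 3 c₃
    have n0 := sq_nonneg s
    have n2 := abs_nonneg c₂
    have n3 := abs_nonneg c₃
    rw [abs_le] at k1 k2 k3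
    rw [hC, abs_le]
    constructor <;> linarith

theorem integrableOn_gauss_sub_cosCubic {s c₁ c₂ c₃ : ℝ} (hs : 0 < s) (hsum : c₁ + c₂ + c₃ = 1)
    (hsq : c₁ + 2 * c₂ + 3 * c₃ = s) :
    IntegrableOn (fun u => (Real.exp (-(s * u ^ 2 / 2)) - c₁ * Real.cos u - c₂ * Real.cos u ^ 2
        - c₃ * Real.cos u ^ 3) * (u ^ 3)⁻¹) (Set.Ioi 0) := by
  obtain ⟨C, -, h0, h1⟩ := exists_abs_gauss_sub_cosCubic_le hs hsum hsq
  refine IntegrableOn.congr_fun (integrableOn_mul_rpow (p := 2) (C := C) (m := 4) (n := 0)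
    (by fun_prop) h0 (fun u hu => by rw [pow_zero, mul_one]; exact h1 u hu) (by norm_num)
    (by norm_num)) (fun u hu => ?_) measurableSet_Ioi
  rw [rpow_neg_two_sub_one hu]

/-- When a cubic polynomial in `cos` agrees with the Gaussian characteristic function to second order
at `0`, their difference has an explicit integral against `u ^ (-3)`: the limit `p ↓ 2` of the Fourier
formula for absolute moments. -/
theorem integral_gauss_sub_cosCubic {s c₁ c₂ c₃ : ℝ} (hs : 0 < s) (hsum : c₁ + c₂ + c₃ = 1)
    (hsq : c₁ + 2 * c₂ + 3 * c₃ = s) :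
    ∫ u in Set.Ioi 0, (Real.exp (-(s * u ^ 2 / 2)) - c₁ * Real.cos u - c₂ * Real.cos u ^ 2
        - c₃ * Real.cos u ^ 3) * (u ^ 3)⁻¹
      = 1 / 2 * (s * (gaussSlope + 1 / 2 * Real.log s) - 2 * c₂ * Real.log 2
        - 9 / 4 * c₃ * Real.log 3) := by
  set Θ : ℝ → ℝ := fun u => Real.exp (-(s * u ^ 2 / 2)) - c₁ * Real.cos u - c₂ * Real.cos u ^ 2
        - c₃ * Real.cos u ^ 3 with hΘ
  have hm : Measurable Θ := by fun_prop
  obtain ⟨C, hC0, h0, h1⟩ := exists_abs_gauss_sub_cosCubic_le hs hsum hsq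
  have ht := tendsto_integral_mul_rpow hm hC0 h0 h1
  set B : ℝ → ℝ := fun p => gaussMoment p * s ^ (p / 2) - (c₁ + 3 / 4 * c₃) - c₂ / 2 * 2 ^ p
    - c₃ / 4 * 3 ^ p with hB
  have hB2 : B 2 = 0 := by
    simp only [hB, gaussMoment_two, div_self (two_ne_zero' ℝ), Real.rpow_one, Real.rpow_two]
    linarith
  have hBd : HasDerivAt B (s * (gaussSlope + 1 / 2 * Real.log s) - 2 * c₂ * Real.log 2
        - 9 / 4 * c₃ * Real.log 3) 2 := by
    have d1 : HasDerivAt (fun p : ℝ => s ^ (p / 2)) (Real.log s * (1 / 2) * s ^ ((2:ℝ) / 2)) 2 :=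
      ((hasDerivAt_id (2:ℝ)).div_const 2).const_rpow hs
    have d2 : HasDerivAt (fun p : ℝ => (2:ℝ) ^ p) (Real.log 2 * 1 * 2 ^ (2:ℝ)) 2 :=
      (hasDerivAt_id (2:ℝ)).const_rpow two_pos
    have d3 : HasDerivAt (fun p : ℝ => (3:ℝ) ^ p) (Real.log 3 * 1 * 3 ^ (2:ℝ)) 2 :=
      (hasDerivAt_id (2:ℝ)).const_rpow three_pos
    refine ((((hasDerivAt_gaussMoment_two.mul d1).sub_const _).sub (d2.const_mul (c₂ / 2))).sub
      (d3.const_mul (c₃ / 4))).congr_deriv ?_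
    rw [gaussMoment_two, div_self (two_ne_zero' ℝ), Real.rpow_one, Real.rpow_two, Real.rpow_two]
    ring
  have hslope := (hasDerivAt_iff_tendsto_slope.1 hBd).mono_left
    (nhdsWithin_mono (2:ℝ) (show Set.Ioi (2:ℝ) ⊆ {2}ᶜ from fun x hx => ne_of_gt hx))
  have hprod := tendsto_sub_two_mul_cosConst.mul hslope
  refine tendsto_nhds_unique ht (hprod.congr' ?_)
  filter_upwards [Ioo_mem_nhdsGT (show (2:ℝ) < 4 by norm_num)] with p hp
  have hp2 : p - 2 ≠ 0 := (sub_pos.2 hp.1).ne'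
  have hp0 : p ≠ 0 := by linarith [hp.1]
  rw [slope_def_field, hB2, sub_zero]
  have hi0 := integrableOn_exp_kernel hs hp.1 hp.2
  have hi := fun a : ℝ => integrableOn_cosKernel_mul hp.1 hp.2 a
  calc (p - 2) * cosConst p * (B p / (p - 2)) = cosConst p * B p := by field_simp
    _ = (∫ u in Set.Ioi 0, (Real.exp (-(s * u ^ 2 / 2)) - 1 + s * u ^ 2 / 2) * u ^ (-p - 1))
        - (c₁ + 3 / 4 * c₃) * (∫ u in Set.Ioi 0, cosKernel (1 * u) * u ^ (-p - 1))
        - c₂ / 2 * (∫ u in Set.Ioi 0, cosKernel (2 * u) * u ^ (-p - 1))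
        - c₃ / 4 * (∫ u in Set.Ioi 0, cosKernel (3 * u) * u ^ (-p - 1)) := by
      rw [integral_exp_kernel_mul_rpow hs hp.1 hp.2, integral_cosKernel_mul hp0,
        integral_cosKernel_mul hp0, integral_cosKernel_mul hp0, abs_one, Real.one_rpow,
        abs_of_pos two_pos, abs_of_pos three_pos]
      simp only [hB]; ring
    _ = ∫ u in Set.Ioi 0, Θ u * u ^ (-p - 1) := by
      have j1 : IntegrableOn (fun u =>
          (Real.exp (-(s * u ^ 2 / 2)) - 1 + s * u ^ 2 / 2) * u ^ (-p - 1)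
            - (c₁ + 3 / 4 * c₃) * (cosKernel (1 * u) * u ^ (-p - 1))) (Set.Ioi 0) :=
        hi0.sub ((hi 1).const_mul _)
      have j2 : IntegrableOn (fun u =>
          (Real.exp (-(s * u ^ 2 / 2)) - 1 + s * u ^ 2 / 2) * u ^ (-p - 1)
            - (c₁ + 3 / 4 * c₃) * (cosKernel (1 * u) * u ^ (-p - 1))
            - c₂ / 2 * (cosKernel (2 * u) * u ^ (-p - 1))) (Set.Ioi 0) :=
        j1.sub ((hi 2).const_mul _)
      rw [← integral_const_mul, ← integral_const_mul, ← integral_const_mul,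
        ← integral_sub hi0 ((hi 1).const_mul _), ← integral_sub j1 ((hi 2).const_mul _),
        ← integral_sub j2 ((hi 3).const_mul _)]
      refine setIntegral_congr_fun measurableSet_Ioi fun u _ => ?_
      simp only [hΘ, gauss_sub_cosCubic_eq hsum hsq]; ring

/-! ### Polynomial bounds for powers of the cosine -/

/-- Second order Taylor polynomial of `y ^ δ` at `y = 1`; the remainder is negative. -/
theorem rpow_le_one_sub_quadratic {y δ : ℝ} (hy0 : 0 < y) (hy1 : y ≤ 1) (h0 : 0 ≤ δ) (h1 : δ ≤ 1) :
    y ^ δ ≤ 1 - δ * (1 - y) - δ * (1 - δ) / 2 * (1 - y) ^ 2 := by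
  have hd : ∀ x : ℝ, 0 < x → HasDerivAt
      (fun x => 1 - δ * (1 - x) - δ * (1 - δ) / 2 * (1 - x) ^ 2 - x ^ δ)
      (δ + δ * (1 - δ) * (1 - x) - δ * x ^ (δ - 1)) x := by
    intro x hx
    have hl : HasDerivAt (fun x : ℝ => 1 - x) (-1) x := (hasDerivAt_id x).const_sub 1
    refine ((((hl.const_mul δ).const_sub 1).sub ((hl.pow 2).const_mul (δ * (1 - δ) / 2))).sub
      (Real.hasDerivAt_rpow_const (Or.inl hx.ne'))).congr_deriv ?_
    norm_num; ring
  have hanti : AntitoneOn (fun x => 1 - δ * (1 - x) - δ * (1 - δ) / 2 * (1 - x) ^ 2 - x ^ δ)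
      (Set.Icc y 1) := by
    have hpos : ∀ x ∈ Set.Icc y 1, 0 < x := fun x hx => hy0.trans_le hx.1
    refine antitoneOn_of_deriv_nonpos (convex_Icc _ _)
      (fun x hx => (hd x (hpos x hx)).continuousAt.continuousWithinAt)
      (fun x hx => (hd x (hpos x (interior_subset hx))).differentiableAt.differentiableWithinAt)
      fun x hx => ?_
    have hx' := interior_subset hx
    have hx0 := hpos x hx'
    rw [(hd x hx0).deriv]
    have hb := rpow_one_add_le_one_add_mul_self (s := x - 1) (by linarith) (p := 1 - δ)
      (by linarith) (by linarith)
    rw [add_sub_cancel] at hb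
    have hxp : 0 < x ^ (1 - δ) := Real.rpow_pos_of_pos hx0 _
    have hge : 1 + (1 - δ) * (1 - x) ≤ x ^ (δ - 1) := by
      rw [show δ - 1 = -(1 - δ) by ring, Real.rpow_neg hx0.le, le_inv_comm₀ (by nlinarith [hx'.2]) hxp]
      refine hb.trans ?_
      rw [← one_div, le_div_iff₀ (by nlinarith [hx'.2])]
      nlinarith [sq_nonneg ((1 - δ) * (1 - x))]
    nlinarith
  have := hanti ⟨le_rfl, hy1⟩ ⟨hy1, le_rfl⟩ hy1
  simp only [sub_self, mul_zero, sub_zero, Real.one_rpow] at this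
  norm_num at this
  linarith

/-- The interpolation polynomial of `s ↦ y ^ s` at the nodes `1, 2, 3` lies above it on `[1, 2]`. -/
theorem rpow_le_cubic_interpolation {y s : ℝ} (hy0 : 0 ≤ y) (hy1 : y ≤ 1) (h1 : 1 ≤ s)
    (h2 : s ≤ 2) : y ^ s ≤ (2 - s) * (3 - s) / 2 * y + (s - 1) * (3 - s) * y ^ 2
      + -((s - 1) * (2 - s) / 2) * y ^ 3 := by
  rcases hy0.eq_or_lt with rfl | hy
  · rw [Real.zero_rpow (by linarith)]; norm_num
  · have h := mul_le_mul_of_nonneg_left (rpow_le_one_sub_quadratic hy hy1 (δ := s - 1)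
      (by linarith) (by linarith)) hy.le
    calc y ^ s = y * y ^ (s - 1) := by rw [← Real.rpow_one_add' hy.le (by linarith)]; congr 1; ring
      _ ≤ _ := h
      _ = _ := by ring

/-- On `[2, 3]` the chord of the convex function `s ↦ y ^ s` suffices. -/
theorem rpow_le_sq_cube_interpolation {y s : ℝ} (hy0 : 0 ≤ y) (hy1 : y ≤ 1) (h2 : 2 ≤ s)
    (h3 : s ≤ 3) : y ^ s ≤ (3 - s) * y ^ 2 + (s - 2) * y ^ 3 := by
  rcases hy0.eq_or_lt with rfl | hy
  · rw [Real.zero_rpow (by linarith)]; norm_num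
  · have h := rpow_one_add_le_one_add_mul_self (s := y - 1) (by linarith) (p := s - 2)
      (by linarith) (by linarith)
    rw [add_sub_cancel] at h
    have h := mul_le_mul_of_nonneg_left h (sq_nonneg y)
    calc y ^ s = y ^ 2 * y ^ (s - 2) := by
          rw [← Real.rpow_two, ← Real.rpow_add hy]; congr 1; ring
      _ ≤ _ := h
      _ = _ := by ring

/-- Third order Taylor polynomial of `x log x` at `2`. -/
theorem taylor_le_mul_log {δ : ℝ} (hδ : -2 < δ) :
    2 * Real.log 2 + (1 + Real.log 2) * δ + δ ^ 2 / 4 - δ ^ 3 / 24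
      ≤ (2 + δ) * Real.log (2 + δ) := by
  set f : ℝ → ℝ := fun x => (2 + x) * Real.log (2 + x)
    - (2 * Real.log 2 + (1 + Real.log 2) * x + x ^ 2 / 4 - x ^ 3 / 24) with hf
  set f' : ℝ → ℝ := fun x => Real.log (2 + x) - Real.log 2 - x / 2 + x ^ 2 / 8 with hf'
  have hl : ∀ x : ℝ, -2 < x → HasDerivAt (fun x => Real.log (2 + x)) (1 / (2 + x)) x := fun x hx =>
    ((hasDerivAt_id x).const_add 2).log (by simp only [id]; linarith)
  have hd : ∀ x, -2 < x → HasDerivAt f (f' x) x := by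
    intro x hx
    refine ((((hasDerivAt_id x).const_add 2).mul (hl x hx)).sub
      (((((hasDerivAt_id x).const_mul (1 + Real.log 2)).const_add (2 * Real.log 2)).add
      ((hasDerivAt_pow 2 x).div_const 4)).sub ((hasDerivAt_pow 3 x).div_const 24))).congr_deriv ?_
    have : 2 + x ≠ 0 := by linarith
    simp only [id, hf']; norm_num; field_simp; ring
  have hd' : ∀ x, -2 < x → HasDerivAt f' (x ^ 2 / (4 * (2 + x))) x := by
    intro x hx
    refine ((((hl x hx).sub_const _).sub ((hasDerivAt_id x).div_const 2)).add
      ((hasDerivAt_pow 2 x).div_const 8)).congr_deriv ?_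
    have : 2 + x ≠ 0 := by linarith
    norm_num; field_simp; ring
  have hmono : MonotoneOn f' (Set.Ioi (-2)) := by
    refine monotoneOn_of_deriv_nonneg (convex_Ioi _)
      (fun x hx => (hd' x hx).continuousAt.continuousWithinAt)
      (fun x hx => (hd' x (interior_subset hx)).differentiableAt.differentiableWithinAt)
      fun x hx => ?_
    have hx' : -2 < x := interior_subset hx
    rw [(hd' x hx').deriv]
    have : 0 < 2 + x := by linarith
    positivity
  have hf0 : f 0 = 0 := by simp [hf]
  have hf'0 : f' 0 = 0 := by simp [hf']
  suffices 0 ≤ f δ by simp only [hf] at this; linarith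
  rcases le_total 0 δ with h | h
  · have hm : MonotoneOn f (Set.Icc 0 δ) := by
      have hpos : ∀ x ∈ Set.Icc 0 δ, -2 < x := fun x hx => by linarith [hx.1]
      refine monotoneOn_of_deriv_nonneg (convex_Icc _ _)
        (fun x hx => (hd x (hpos x hx)).continuousAt.continuousWithinAt)
        (fun x hx => (hd x (hpos x (interior_subset hx))).differentiableAt.differentiableWithinAt)
        fun x hx => ?_
      have hx' := interior_subset hx
      rw [(hd x (hpos x hx')).deriv, ← hf'0]
      exact hmono (by simp) (hpos x hx') hx'.1
    rw [← hf0]; exact hm ⟨le_rfl, h⟩ ⟨h, le_rfl⟩ h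
  · have hm : AntitoneOn f (Set.Icc δ 0) := by
      have hpos : ∀ x ∈ Set.Icc δ 0, -2 < x := fun x hx => by linarith [hx.1]
      refine antitoneOn_of_deriv_nonpos (convex_Icc _ _)
        (fun x hx => (hd x (hpos x hx)).continuousAt.continuousWithinAt)
        (fun x hx => (hd x (hpos x (interior_subset hx))).differentiableAt.differentiableWithinAt)
        fun x hx => ?_
      have hx' := interior_subset hx
      rw [(hd x (hpos x hx')).deriv, ← hf'0]
      exact hmono (hpos x hx') (by simp) hx'.2
    rw [← hf0]; exact hm ⟨le_rfl, h⟩ ⟨h, le_rfl⟩ h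

/-- The negative part of the cosine. -/
noncomputable def cosNeg (u : ℝ) : ℝ := max (-Real.cos u) 0

theorem continuous_cosNeg : Continuous cosNeg := by unfold cosNeg; fun_prop

theorem cosNeg_nonneg (u : ℝ) : 0 ≤ cosNeg u := le_max_right _ _

theorem cosNeg_le_abs_cos (u : ℝ) : cosNeg u ≤ |Real.cos u| :=
  max_le (neg_le_abs _) (abs_nonneg _)

theorem cosNeg_le_one (u : ℝ) : cosNeg u ≤ 1 := (cosNeg_le_abs_cos u).trans (Real.abs_cos_le_one u)

theorem cosNeg_eq_zero {u : ℝ} (h : 0 ≤ Real.cos u) : cosNeg u = 0 :=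
  max_eq_right (by linarith)

theorem integrableOn_Ioi_mul_inv_cube {f : ℝ → ℝ} (hf : Continuous f) (h1 : ∀ u, |f u| ≤ 1) {x₀ : ℝ}
    (h0 : 0 < x₀) : IntegrableOn (fun u => f u * (u ^ 3)⁻¹) (Set.Ioi x₀) := by
  refine (integrableOn_Ioi_inv_cube h0).mono' (by fun_prop) ?_
  filter_upwards [ae_restrict_mem measurableSet_Ioi] with u hu
  have hu0 : 0 < u := h0.trans hu
  have h3 : 0 < (u ^ 3)⁻¹ := by positivity
  rw [norm_mul, Real.norm_of_nonneg h3.le]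
  exact mul_le_of_le_one_left h3.le (h1 u)

theorem abs_cosNeg_pow_le_one (k : ℕ) (u : ℝ) : |cosNeg u ^ k| ≤ 1 := by
  rw [abs_of_nonneg (pow_nonneg (cosNeg_nonneg u) k)]
  exact pow_le_one₀ (cosNeg_nonneg u) (cosNeg_le_one u)

theorem cosNeg_pow_mul_eq_zero {k : ℕ} (hk : k ≠ 0) {u : ℝ} (h0 : 0 ≤ u) (h1 : u ≤ Real.pi / 2) :
    cosNeg u ^ k * (u ^ 3)⁻¹ = 0 := by
  rw [cosNeg_eq_zero (Real.cos_nonneg_of_mem_Icc ⟨by linarith [Real.pi_pos], h1⟩), zero_pow hk,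
    zero_mul]

theorem integrableOn_cosNeg_pow {k : ℕ} (hk : k ≠ 0) :
    IntegrableOn (fun u => cosNeg u ^ k * (u ^ 3)⁻¹) (Set.Ioi 0) := by
  have hpi : 0 < Real.pi / 2 := by positivity
  rw [← Set.Ioc_union_Ioi_eq_Ioi hpi.le]
  refine IntegrableOn.union ?_
    (integrableOn_Ioi_mul_inv_cube (continuous_cosNeg.pow k) (abs_cosNeg_pow_le_one k) hpi)
  exact IntegrableOn.congr_fun integrableOn_zero
    (fun u hu => (cosNeg_pow_mul_eq_zero hk hu.1.le hu.2).symm) measurableSet_Ioc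

/-- The negative part of `cos` lives on the bump over `[π / 2, 3π / 2]` and beyond `5π / 2`. -/
theorem integral_cosNeg_pow_eq {k : ℕ} (hk : k ≠ 0) :
    ∫ u in Set.Ioi 0, cosNeg u ^ k * (u ^ 3)⁻¹
      = (∫ u in (Real.pi / 2)..(3 * Real.pi / 2), Real.cos (u - Real.pi) ^ k * (u ^ 3)⁻¹)
        + ∫ u in Set.Ioi (5 * Real.pi / 2), cosNeg u ^ k * (u ^ 3)⁻¹ := by
  have hpi := Real.pi_pos
  have hi : ∀ {x : ℝ}, 0 < x →
      IntegrableOn (fun u => cosNeg u ^ k * (u ^ 3)⁻¹) (Set.Ioi x) := fun {x} hx =>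
    integrableOn_Ioi_mul_inv_cube (continuous_cosNeg.pow k) (abs_cosNeg_pow_le_one k) hx
  have i1 := hi (x := Real.pi / 2) (by positivity)
  have i2 := hi (x := 3 * Real.pi / 2) (by positivity)
  have i3 := hi (x := 5 * Real.pi / 2) (by positivity)
  have z1 : ∫ u in (0:ℝ)..(Real.pi / 2), cosNeg u ^ k * (u ^ 3)⁻¹ = 0 := by
    rw [intervalIntegral.integral_congr (g := fun _ => 0), intervalIntegral.integral_zero]
    intro u hu
    rw [Set.uIcc_of_le (by positivity)] at hu
    exact cosNeg_pow_mul_eq_zero hk hu.1 hu.2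
  have z2 : ∫ u in (3 * Real.pi / 2)..(5 * Real.pi / 2), cosNeg u ^ k * (u ^ 3)⁻¹ = 0 := by
    rw [intervalIntegral.integral_congr (g := fun _ => 0), intervalIntegral.integral_zero]
    intro u hu
    rw [Set.uIcc_of_le (by linarith)] at hu
    beta_reduce
    rw [cosNeg_eq_zero, zero_pow hk, zero_mul]
    rw [← Real.cos_sub_two_pi]
    exact Real.cos_nonneg_of_mem_Icc ⟨by linarith [hu.1], by linarith [hu.2]⟩
  have z3 : ∫ u in (Real.pi / 2)..(3 * Real.pi / 2), cosNeg u ^ k * (u ^ 3)⁻¹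
      = ∫ u in (Real.pi / 2)..(3 * Real.pi / 2), Real.cos (u - Real.pi) ^ k * (u ^ 3)⁻¹ := by
    refine intervalIntegral.integral_congr fun u hu => ?_
    rw [Set.uIcc_of_le (by linarith)] at hu
    rw [Real.cos_sub_pi, cosNeg, max_eq_left]
    have := Real.cos_nonpos_of_pi_div_two_le_of_le hu.1 (by linarith [hu.2])
    linarith
  rw [← intervalIntegral.integral_interval_add_Ioi (integrableOn_cosNeg_pow hk) i1, z1, zero_add,
    ← intervalIntegral.integral_interval_add_Ioi i1 i2, z3,
    ← intervalIntegral.integral_interval_add_Ioi i2 i3, z2, zero_add]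

theorem integral_cosNeg_le :
    ∫ u in Set.Ioi 0, cosNeg u ^ 1 * (u ^ 3)⁻¹ ≤ 73 / 800 + 2 / (25 * Real.pi ^ 2) := by
  have hpi := Real.pi_pos
  rw [integral_cosNeg_pow_eq one_ne_zero]
  simp only [pow_one]
  refine add_le_add integral_bump_cos_le ?_
  calc _ ≤ ∫ u in Set.Ioi (5 * Real.pi / 2), (u ^ 3)⁻¹ := by
        have h0 : 0 < 5 * Real.pi / 2 := by positivity
        refine setIntegral_mono_on ?_ (integrableOn_Ioi_inv_cube h0) measurableSet_Ioi
          fun u hu => ?_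
        · simpa only [pow_one] using integrableOn_Ioi_mul_inv_cube (continuous_cosNeg.pow 1)
            (abs_cosNeg_pow_le_one 1) h0
        · have hu0 : 0 < u := h0.trans hu
          exact mul_le_of_le_one_left (by positivity) (cosNeg_le_one u)
    _ = _ := by rw [integral_Ioi_inv_cube (by positivity)]; field_simp; norm_num

theorem integral_cosNeg_cube_le :
    ∫ u in Set.Ioi 0, cosNeg u ^ 3 * (u ^ 3)⁻¹ ≤ 32 / 625 + 1 / (25 * Real.pi ^ 2) := by
  have hpi := Real.pi_pos
  have h0 : 0 < 5 * Real.pi / 2 := by positivity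
  have hc : Real.cos (5 * Real.pi / 2) = 0 := by
    rw [← Real.cos_sub_two_pi, show 5 * Real.pi / 2 - 2 * Real.pi = Real.pi / 2 by ring,
      Real.cos_pi_div_two]
  rw [integral_cosNeg_pow_eq three_ne_zero]
  refine add_le_add integral_bump_cos_cube_bounds.2 ?_
  calc _ ≤ ∫ u in Set.Ioi (5 * Real.pi / 2), Real.cos u ^ 2 * (u ^ 3)⁻¹ := by
        refine setIntegral_mono_on (integrableOn_Ioi_mul_inv_cube (continuous_cosNeg.pow 3)
          (abs_cosNeg_pow_le_one 3) h0) (integrableOn_Ioi_mul_inv_cube (by fun_prop)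
          (fun u => by rw [abs_of_nonneg (sq_nonneg _)]; exact Real.cos_sq_le_one u) h0)
          measurableSet_Ioi fun u hu => ?_
        have hu0 : 0 < u := h0.trans hu
        refine mul_le_mul_of_nonneg_right ?_ (by positivity)
        calc cosNeg u ^ 3 ≤ cosNeg u ^ 2 :=
              pow_le_pow_of_le_one (cosNeg_nonneg u) (cosNeg_le_one u) (by norm_num)
          _ ≤ |Real.cos u| ^ 2 := pow_le_pow_left₀ (cosNeg_nonneg u) (cosNeg_le_abs_cos u) 2
          _ = _ := sq_abs _
    _ ≤ 1 / (4 * (5 * Real.pi / 2) ^ 2) := integral_Ioi_cos_sq_div_cube_le h0 hc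
    _ = _ := by field_simp; norm_num

theorem le_integral_cosNeg_cube :
    247 / 5000 ≤ ∫ u in Set.Ioi 0, cosNeg u ^ 3 * (u ^ 3)⁻¹ := by
  rw [integral_cosNeg_pow_eq three_ne_zero]
  have := integral_bump_cos_cube_bounds.1
  have : 0 ≤ ∫ u in Set.Ioi (5 * Real.pi / 2), cosNeg u ^ 3 * (u ^ 3)⁻¹ := by
    refine setIntegral_nonneg measurableSet_Ioi fun u hu => ?_
    have hu0 : 0 < u := (show (0:ℝ) < 5 * Real.pi / 2 by positivity).trans hu
    have := cosNeg_nonneg u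
    positivity
  linarith

/-- Replacing the power `|cos| ^ s` by a cubic in `|cos|`, and `|cos|` by `cos + 2 * cosNeg`, leaves the
explicit integral of a trigonometric polynomial and two corrections. -/
theorem le_integral_gaussCosGap_of_cubic {s c₁ c₂ c₃ : ℝ} (hs : 1 ≤ s) (hsum : c₁ + c₂ + c₃ = 1)
    (hsq : c₁ + 2 * c₂ + 3 * c₃ = s)
    (h : ∀ y, 0 ≤ y → y ≤ 1 → y ^ s ≤ c₁ * y + c₂ * y ^ 2 + c₃ * y ^ 3) :
    1 / 2 * (s * (gaussSlope + 1 / 2 * Real.log s) - 2 * c₂ * Real.log 2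
        - 9 / 4 * c₃ * Real.log 3) - 2 * c₁ * (∫ u in Set.Ioi 0, cosNeg u ^ 1 * (u ^ 3)⁻¹)
        - 2 * c₃ * (∫ u in Set.Ioi 0, cosNeg u ^ 3 * (u ^ 3)⁻¹)
      ≤ ∫ u in Set.Ioi 0, gaussCosGap s u * (u ^ 3)⁻¹ := by
  have hs0 : 0 < s := by linarith
  have i0 := integrableOn_gauss_sub_cosCubic hs0 hsum hsq
  have i1 := (integrableOn_cosNeg_pow one_ne_zero).const_mul (2 * c₁)
  have i3 := (integrableOn_cosNeg_pow three_ne_zero).const_mul (2 * c₃)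
  rw [← integral_gauss_sub_cosCubic hs0 hsum hsq, ← integral_const_mul, ← integral_const_mul]
  have e1 := integral_sub i0 i1
  have e2 := integral_sub (i0.sub i1) i3
  simp only [Pi.sub_apply] at e2
  rw [← e1, ← e2]
  refine setIntegral_mono_on ((i0.sub i1).sub i3) (integrableOn_gaussCosGap hs) measurableSet_Ioi
    fun u hu => ?_
  have hu0 : 0 < u := hu
  have h3 : 0 < (u ^ 3)⁻¹ := by positivity
  have hy := h |Real.cos u| (abs_nonneg _) (Real.abs_cos_le_one u)
  have a1 : |Real.cos u| = Real.cos u + 2 * cosNeg u := by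
    unfold cosNeg
    rcases le_total 0 (Real.cos u) with h | h
    · rw [abs_of_nonneg h, max_eq_right (by linarith)]; ring
    · rw [abs_of_nonpos h, max_eq_left (by linarith)]; ring
  have a3 : |Real.cos u| ^ 3 = Real.cos u ^ 3 + 2 * cosNeg u ^ 3 := by
    unfold cosNeg
    rcases le_total 0 (Real.cos u) with h | h
    · rw [abs_of_nonneg h, max_eq_right (by linarith)]; ring
    · rw [abs_of_nonpos h, max_eq_left (by linarith)]; ring
  rw [a3, sq_abs] at hy
  have hy' : |Real.cos u| ^ s ≤ c₁ * (Real.cos u + 2 * cosNeg u) + c₂ * Real.cos u ^ 2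
      + c₃ * (Real.cos u ^ 3 + 2 * cosNeg u ^ 3) := by rw [← a1]; exact hy
  simp only [pow_one]
  unfold gaussCosGap
  nlinarith [mul_le_mul_of_nonneg_right hy' h3.le]

/-! ### Positivity of the gap integral -/

section GaussCosGap

variable {s : ℝ}

theorem integral_abs_cos_cube_le :
    ∫ u in Set.Ioi (Real.pi / 2), |Real.cos u| ^ 3 * (u ^ 3)⁻¹
      ≤ 32 / 625 + 1 / (9 * Real.pi ^ 2) := by
  have hpi := Real.pi_pos
  have hb : ∀ u, |(|Real.cos u| ^ 3)| ≤ 1 := fun u => by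
    rw [abs_of_nonneg (by positivity)]
    exact pow_le_one₀ (abs_nonneg _) (Real.abs_cos_le_one u)
  have hi : ∀ {x : ℝ}, 0 < x →
      IntegrableOn (fun u => |Real.cos u| ^ 3 * (u ^ 3)⁻¹) (Set.Ioi x) := fun {x} hx =>
    integrableOn_Ioi_mul_inv_cube (by fun_prop) hb hx
  have h0 : 0 < 3 * Real.pi / 2 := by positivity
  have hc : Real.cos (3 * Real.pi / 2) = 0 := by
    rw [show 3 * Real.pi / 2 = Real.pi / 2 + Real.pi by ring, Real.cos_add_pi,
      Real.cos_pi_div_two, neg_zero]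
  rw [← intervalIntegral.integral_interval_add_Ioi (hi (x := Real.pi / 2) (by positivity)) (hi h0)]
  refine add_le_add (le_trans (le_of_eq ?_) integral_bump_cos_cube_bounds.2) ?_
  · refine intervalIntegral.integral_congr fun u hu => ?_
    rw [Set.uIcc_of_le (by linarith)] at hu
    rw [Real.cos_sub_pi, abs_of_nonpos
      (Real.cos_nonpos_of_pi_div_two_le_of_le hu.1 (by linarith [hu.2]))]
  · calc _ ≤ ∫ u in Set.Ioi (3 * Real.pi / 2), Real.cos u ^ 2 * (u ^ 3)⁻¹ := by
          refine setIntegral_mono_on (hi h0) (integrableOn_Ioi_mul_inv_cube (by fun_prop)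
            (fun u => by rw [abs_of_nonneg (sq_nonneg _)]; exact Real.cos_sq_le_one u) h0)
            measurableSet_Ioi fun u hu => ?_
          have hu0 : 0 < u := h0.trans hu
          refine mul_le_mul_of_nonneg_right ?_ (by positivity)
          rw [← sq_abs (Real.cos u)]
          exact pow_le_pow_of_le_one (abs_nonneg _) (Real.abs_cos_le_one u) (by norm_num)
      _ ≤ 1 / (4 * (3 * Real.pi / 2) ^ 2) := integral_Ioi_cos_sq_div_cube_le h0 hc
      _ = _ := by field_simp; norm_num

theorem integrableOn_exp_neg_mul_quintic (hs : 0 < s) (A B : ℝ) :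
    IntegrableOn (fun u : ℝ => Real.exp (-(s * u ^ 2 / 2)) * (A * u + B * u ^ 5)) (Set.Ioi 0) := by
  have h1 := (integrableOn_rpow_mul_exp_neg_mul_sq (b := s / 2) (by positivity) (s := (1:ℕ))
    (by norm_num)).const_mul A
  have h5 := (integrableOn_rpow_mul_exp_neg_mul_sq (b := s / 2) (by positivity) (s := (5:ℕ))
    (by norm_num)).const_mul B
  refine IntegrableOn.congr_fun (h1.add h5) (fun u _ => ?_) measurableSet_Ioi
  simp only [Pi.add_apply, Real.rpow_natCast]
  rw [show -(s / 2) * u ^ 2 = -(s * u ^ 2 / 2) by ring]; ring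

theorem integral_exp_neg_mul_quintic (hs : 0 < s) (A B : ℝ) :
    ∫ u in Set.Ioi 0, Real.exp (-(s * u ^ 2 / 2)) * (A * u + B * u ^ 5)
      = A / s + B * (8 / s ^ 3) := by
  have i1 := (integrableOn_rpow_mul_exp_neg_mul_sq (b := s / 2) (by positivity) (s := (1:ℕ))
    (by norm_num)).const_mul A
  have i5 := (integrableOn_rpow_mul_exp_neg_mul_sq (b := s / 2) (by positivity) (s := (5:ℕ))
    (by norm_num)).const_mul B
  have h1 := integral_rpow_mul_exp_neg_mul_rpow (p := 2) (q := (1:ℕ)) (b := s / 2) two_pos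
    (by norm_num) (by positivity)
  have h5 := integral_rpow_mul_exp_neg_mul_rpow (p := 2) (q := (5:ℕ)) (b := s / 2) two_pos
    (by norm_num) (by positivity)
  rw [show (((1:ℕ):ℝ) + 1) / 2 = 1 by norm_num, Real.Gamma_one,
    show -(((1:ℕ):ℝ) + 1) / 2 = -(1:ℕ) by norm_num, Real.rpow_neg (by positivity),
    Real.rpow_natCast] at h1
  rw [show (((5:ℕ):ℝ) + 1) / 2 = (2:ℕ) + 1 by norm_num, Real.Gamma_nat_eq_factorial,
    show -(((5:ℕ):ℝ) + 1) / 2 = -(3:ℕ) by norm_num, Real.rpow_neg (by positivity),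
    Real.rpow_natCast] at h5
  simp only [Real.rpow_two] at h1 h5
  have hadd := integral_add i1 i5
  rw [integral_const_mul, integral_const_mul, h1, h5] at hadd
  calc _ = _ := setIntegral_congr_fun measurableSet_Ioi fun u _ => by
          simp only [Real.rpow_natCast]
          rw [show -(s / 2) * u ^ 2 = -(s * u ^ 2 / 2) by ring]; ring
    _ = _ := hadd
    _ = _ := by norm_num [Nat.factorial]; field_simp; norm_num

/-- For `s ≥ 3` the gap near the origin alone is worth `1 / 12 - 1 / (36 * s)`, and beyond `π / 2` the
power `|cos| ^ s` is at most `|cos| ^ 3`. -/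
theorem le_integral_gaussCosGap_of_three_le (hs : 3 ≤ s) :
    1 / 15000 ≤ ∫ u in Set.Ioi 0, gaussCosGap s u * (u ^ 3)⁻¹ := by
  have hs0 : 0 < s := by linarith
  have hpi := Real.pi_pos
  have hT : IntegrableOn (fun u => |Real.cos u| ^ 3 * (u ^ 3)⁻¹) (Set.Ioi (Real.pi / 2)) :=
    integrableOn_Ioi_mul_inv_cube (by fun_prop) (fun u => by
      rw [abs_of_nonneg (by positivity)]
      exact pow_le_one₀ (abs_nonneg _) (Real.abs_cos_le_one u)) (by positivity)
  have hT' := hT.integrable_indicator measurableSet_Ioi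
  set T := (Set.Ioi (Real.pi / 2)).indicator fun u => |Real.cos u| ^ 3 * (u ^ 3)⁻¹ with hTdef
  have hTint : ∫ u in Set.Ioi 0, T u
      = ∫ u in Set.Ioi (Real.pi / 2), |Real.cos u| ^ 3 * (u ^ 3)⁻¹ := by
    rw [hTdef, setIntegral_indicator measurableSet_Ioi,
      Set.inter_eq_right.2 (Set.Ioi_subset_Ioi (by positivity))]
  have hM := integrableOn_exp_neg_mul_quintic hs0 (s / 12) (-(s ^ 2 / 288))
  -- Beyond `π / 2` the same Gaussian lower bound is used, because `x - x ^ 2 / 2 ≤ 1`.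
  have key : ∫ u in Set.Ioi 0, (Real.exp (-(s * u ^ 2 / 2)) * (s / 12 * u + -(s ^ 2 / 288) * u ^ 5)
      - T u) ≤ ∫ u in Set.Ioi 0, gaussCosGap s u * (u ^ 3)⁻¹ := by
    refine setIntegral_mono_on (hM.sub hT'.integrableOn) (integrableOn_gaussCosGap (by linarith))
      measurableSet_Ioi fun u hu => ?_
    have hu0 : 0 < u := hu
    have h3 : 0 < (u ^ 3)⁻¹ := by positivity
    set x := s * u ^ 4 / 12 with hx
    have hx0 : 0 ≤ x := by positivity
    have hE := Real.exp_pos (-(s * u ^ 2 / 2))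
    have e : Real.exp (-(s * u ^ 2 / 2)) * (s / 12 * u + -(s ^ 2 / 288) * u ^ 5)
        = Real.exp (-(s * u ^ 2 / 2)) * (x - x ^ 2 / 2) * (u ^ 3)⁻¹ := by
      rw [hx]; field_simp; ring
    rw [e]
    rcases le_or_gt u (Real.pi / 2) with h | h
    · rw [hTdef, Set.indicator_of_notMem (by simpa using h), sub_zero]
      refine mul_le_mul_of_nonneg_right ?_ h3.le
      have hc := cos_le_exp_neg_sq_add_pow_four hu0.le h
      have hc0 := Real.cos_nonneg_of_mem_Icc (x := u) ⟨by linarith, h⟩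
      have hr := Real.rpow_le_rpow hc0 hc hs0.le
      rw [← Real.exp_mul, show -(u ^ 2 / 2 + u ^ 4 / 12) * s = -(s * u ^ 2 / 2) + -x by
        rw [hx]; ring, Real.exp_add] at hr
      unfold gaussCosGap
      rw [abs_of_nonneg hc0]
      have := mul_le_mul_of_nonneg_left (exp_neg_le_quadratic hx0) hE.le
      linarith
    · rw [hTdef, Set.indicator_of_mem (show u ∈ Set.Ioi (Real.pi / 2) from h), ← sub_mul]
      refine mul_le_mul_of_nonneg_right ?_ h3.le
      have hr : |Real.cos u| ^ s ≤ |Real.cos u| ^ 3 := by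
        rcases (abs_nonneg (Real.cos u)).eq_or_lt with h0 | h0
        · rw [← h0, Real.zero_rpow hs0.ne']; norm_num
        · rw [← Real.rpow_natCast]
          exact Real.rpow_le_rpow_of_exponent_ge h0 (Real.abs_cos_le_one u) (by exact_mod_cast hs)
      unfold gaussCosGap
      have : x - x ^ 2 / 2 ≤ 1 := by nlinarith [sq_nonneg (x - 1)]
      have := mul_le_mul_of_nonneg_left this hE.le
      linarith
  have hsub := integral_sub hM hT'.integrableOn
  rw [integral_exp_neg_mul_quintic hs0, hTint] at hsub
  refine le_trans ?_ key
  refine le_trans ?_ hsub.ge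
  have h1 := integral_abs_cos_cube_le
  have h2 : 1 / (9 * Real.pi ^ 2) ≤ 1 / 81 := by
    refine one_div_le_one_div_of_le (by norm_num) ?_
    nlinarith [Real.pi_gt_three]
  have h3 : s / 12 / s + -(s ^ 2 / 288) * (8 / s ^ 3) = 1 / 12 - 1 / (36 * s) := by
    field_simp; ring
  have h4 : 1 / (36 * s) ≤ 1 / 108 := one_div_le_one_div_of_le (by norm_num) (by linarith)
  rw [h3]
  linarith

theorem le_integral_gaussCosGap_of_le_two (h1 : 5 / 3 ≤ s) (h2 : s ≤ 2) :
    1 / 15000 ≤ ∫ u in Set.Ioi 0, gaussCosGap s u * (u ^ 3)⁻¹ := by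
  obtain ⟨δ, rfl⟩ : ∃ δ, s = 2 + δ := ⟨s - 2, by ring⟩
  have hd0 : 0 ≤ δ + 1 / 3 := by linarith
  have hd1 : 0 ≤ -δ := by linarith
  refine le_trans ?_ (le_integral_gaussCosGap_of_cubic (by linarith) (by ring) (by ring)
    fun y h0 hy => rpow_le_cubic_interpolation h0 hy (by linarith) h2)
  have hI1 := integral_cosNeg_le
  have hI3 := le_integral_cosNeg_cube
  set I1 := ∫ u in Set.Ioi 0, cosNeg u ^ 1 * (u ^ 3)⁻¹
  set I3 := ∫ u in Set.Ioi 0, cosNeg u ^ 3 * (u ^ 3)⁻¹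
  have hpi : 2 / (25 * Real.pi ^ 2) ≤ 0.00812 := by
    rw [div_le_iff₀ (by positivity)]
    have := Real.pi_gt_d2
    norm_num at this ⊢; nlinarith
  have hg := gaussSlope_gt
  have hL := Real.log_two_gt_d9
  have hL' := Real.log_two_lt_d9
  have hl3 := Real.log_three_gt_d9
  have ht := taylor_le_mul_log (δ := δ) (by linarith)
  have hc1 : 0 ≤ (2 - (2 + δ)) * (3 - (2 + δ)) / 2 := by nlinarith
  have hc2 : 0 ≤ (2 + δ - 1) * (3 - (2 + δ)) := by nlinarith
  have hc3 : 0 ≤ (2 + δ - 1) * (2 - (2 + δ)) / 2 := by nlinarith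
  have m1 := mul_le_mul_of_nonneg_left (hI1.trans (add_le_add_right hpi _)) hc1
  have m3 := mul_le_mul_of_nonneg_left hI3 hc3
  have m2 := mul_le_mul_of_nonneg_left hL'.le hc2
  have m4 := mul_le_mul_of_nonneg_left hl3.le hc3
  have m5 := mul_le_mul_of_nonneg_left hg.le (show (0:ℝ) ≤ 2 + δ by linarith)
  have m6 := mul_le_mul_of_nonneg_left hL'.le hd1
  -- What is left is a cubic inequality in `δ` on `[-1 / 3, 0]`, tightest at `-1 / 3`.
  norm_num at m1 m2 m3 m4 m5 m6 hL ⊢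
  nlinarith [mul_nonneg hd0 hd1, mul_nonneg (mul_nonneg hd0 hd1) hd1]

theorem le_integral_gaussCosGap_of_two_le (h1 : 2 ≤ s) (h2 : s ≤ 3) :
    1 / 15000 ≤ ∫ u in Set.Ioi 0, gaussCosGap s u * (u ^ 3)⁻¹ := by
  obtain ⟨δ, rfl⟩ : ∃ δ, s = 2 + δ := ⟨s - 2, by ring⟩
  have hd0 : 0 ≤ δ := by linarith
  have hd1 : 0 ≤ 1 - δ := by linarith
  refine le_trans ?_ (le_integral_gaussCosGap_of_cubic (c₁ := 0) (c₂ := 3 - (2 + δ))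
    (c₃ := 2 + δ - 2) (by linarith) (by ring) (by ring) fun y h0 hy =>
    (rpow_le_sq_cube_interpolation h0 hy (by linarith) h2).trans_eq (by ring))
  have hI3 := integral_cosNeg_cube_le
  set I3 := ∫ u in Set.Ioi 0, cosNeg u ^ 3 * (u ^ 3)⁻¹
  have hpi : 1 / (25 * Real.pi ^ 2) ≤ 0.00406 := by
    rw [div_le_iff₀ (by positivity)]
    have := Real.pi_gt_d2
    norm_num at this ⊢; nlinarith
  have hg := gaussSlope_gt
  have hL := Real.log_two_gt_d9
  have hL' := Real.log_two_lt_d9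
  have hl3 := Real.log_three_lt_d9
  have ht := taylor_le_mul_log (δ := δ) (by linarith)
  have m3 := mul_le_mul_of_nonneg_left (hI3.trans (add_le_add_right hpi _)) hd0
  have m4 := mul_le_mul_of_nonneg_left hl3.le hd0
  have m5 := mul_le_mul_of_nonneg_left hg.le (show (0:ℝ) ≤ 2 + δ by linarith)
  have m6 := mul_le_mul_of_nonneg_left hL.le hd0
  -- What is left is a cubic inequality in `δ` on `[0, 1]`, tightest near `9 / 20`.
  norm_num at m3 m4 m5 m6 hL' ⊢
  nlinarith [mul_nonneg hd0 hd1, mul_nonneg (mul_nonneg hd0 hd0) hd1, sq_nonneg (δ - 9 / 20),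
    mul_nonneg hd0 (sq_nonneg (δ - 9 / 20))]

/-- The one-dimensional comparison behind the upper bound for coefficients with `b ^ 2 ≤ 3 / 5`. -/
theorem integral_gaussCosGap_nonneg (hs : 5 / 3 ≤ s) {p : ℝ} (h2 : 2 < p) (h4 : p < 4) :
    0 ≤ ∫ u in Set.Ioi 0, gaussCosGap s u * u ^ (-p - 1) := by
  refine integral_gaussCosGap_mul_rpow_nonneg (by linarith)
    ((integral_exp_neg_mul_inv_cube_le hs).trans ?_) h2 h4
  rcases le_total s 2 with h | h
  · exact le_integral_gaussCosGap_of_le_two hs h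
  rcases le_total s 3 with h' | h'
  · exact le_integral_gaussCosGap_of_two_le h h'
  · exact le_integral_gaussCosGap_of_three_le h'

end GaussCosGap

/-! ### Sharp Khintchine inequality and the main comparison -/

theorem gaussCosGap_abs_mul (s b t : ℝ) : gaussCosGap s (|b| * t) = gaussCosGap s (b * t) := by
  unfold gaussCosGap
  rw [mul_pow, mul_pow, sq_abs, ← Real.cos_abs (|b| * t), ← Real.cos_abs (b * t), abs_mul, abs_mul,
    abs_abs]

theorem integrableOn_gaussCosGap_comp_mul {s b p : ℝ} (hs : 1 ≤ s) (hb : b ≠ 0) (h0 : 0 < p)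
    (h4 : p < 4) : IntegrableOn (fun t => gaussCosGap s (b * t) * t ^ (-p - 1)) (Set.Ioi 0) := by
  have hc : 0 < |b| := abs_pos.2 hb
  have h := ((integrableOn_Ioi_comp_mul_left_iff (fun u => gaussCosGap s u * u ^ (-p - 1)) 0 hc).2
    (by rw [mul_zero]; exact integrableOn_gaussCosGap_mul_rpow hs h0 h4)).const_mul (|b| ^ (p + 1))
  refine IntegrableOn.congr_fun h (fun t ht => ?_) measurableSet_Ioi
  have ht0 : 0 < t := ht
  have e : |b| ^ (p + 1) * |b| ^ (-p - 1) = 1 := by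
    rw [← Real.rpow_add hc]; simp
  simp only [gaussCosGap_abs_mul]
  rw [Real.mul_rpow hc.le ht0.le]
  linear_combination gaussCosGap s (b * t) * t ^ (-p - 1) * e

theorem exp_sub_prod_cos_ge {b : ℕ → ℝ} {k : ℕ} (hsum : ∑ i ∈ Finset.range k, b i ^ 2 = 1) (t : ℝ) :
    ∑ i ∈ Finset.range k, b i ^ 2 * gaussCosGap (1 / b i ^ 2) (b i * t)
      ≤ Real.exp (-t ^ 2 / 2) - ∏ i ∈ Finset.range k, Real.cos (b i * t) := by
  have e : ∀ i ∈ Finset.range k, b i ^ 2 * gaussCosGap (1 / b i ^ 2) (b i * t)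
      = b i ^ 2 * Real.exp (-t ^ 2 / 2) - b i ^ 2 * |Real.cos (b i * t)| ^ (1 / b i ^ 2) := by
    intro i _
    by_cases h : b i = 0
    · simp [h]
    · unfold gaussCosGap
      rw [show -(1 / b i ^ 2 * (b i * t) ^ 2 / 2) = -t ^ 2 / 2 by field_simp]; ring
  rw [Finset.sum_congr rfl e, Finset.sum_sub_distrib, ← Finset.sum_mul, hsum, one_mul]
  refine sub_le_sub_left ?_ _
  have h := Real.geom_mean_le_arith_mean_weighted (Finset.range k) (fun i => b i ^ 2)
    (fun i => |Real.cos (b i * t)| ^ (1 / b i ^ 2)) (fun i _ => sq_nonneg _) hsum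
    (fun i _ => Real.rpow_nonneg (abs_nonneg _) _)
  refine le_trans (le_trans (le_abs_self _) (le_of_eq ?_)) h
  rw [Finset.abs_prod]
  refine Finset.prod_congr rfl fun i _ => ?_
  by_cases h : b i = 0
  · simp [h]
  · rw [← Real.rpow_mul (abs_nonneg _), one_div_mul_cancel (pow_ne_zero 2 h), Real.rpow_one]

/-- When no coefficient is dominant, the weighted arithmetic-geometric mean inequality splits the
product of cosines into one-dimensional problems. -/
theorem radE_abs_rpow_le_of_small {b : ℕ → ℝ} {k : ℕ} {p : ℝ} (h2 : 2 < p) (h4 : p < 4)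
    (hsum : ∑ i ∈ Finset.range k, b i ^ 2 = 1) (hb : ∀ i ∈ Finset.range k, b i ^ 2 ≤ 3 / 5) :
    radE b k (fun x => |x| ^ p) ≤ gaussMoment p := by
  have hν := hasMoments_signLaw.sumLaw b k
  have hcos : ∀ t, ∫ x, Real.cos (t * x) ∂(sumLaw signLaw b k)
      = ∏ i ∈ Finset.range k, Real.cos (b i * t) := fun t => by
    rw [integral_sumLaw_signLaw b k
      (PolyGrowth.of_bounded (by fun_prop) fun x => Real.abs_cos_le_one _), radE_cos]
  have hsq : ∫ x, x ^ 2 ∂(sumLaw signLaw b k) = 1 := by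
    rw [integral_sumLaw_signLaw b k (PolyGrowth.id.pow 2), radE_sq, hsum]
  have i1 := integrableOn_charFun_kernel hν h2 h4
  have i2 := integrableOn_charFun_kernel hasMoments_gaussianReal h2 h4
  have e1 := cosConst_mul_integral_abs_rpow hν h2 h4
  rw [integral_sumLaw_signLaw b k (PolyGrowth.abs_rpow (by linarith))] at e1
  have e2 := cosConst_mul_integral_abs_rpow hasMoments_gaussianReal h2 h4
  simp only [hcos, hsq, one_mul] at i1 e1
  simp only [integral_cos_gaussianReal, integral_sq_gaussianReal, one_mul] at i2 e2
  have hs : ∀ i ∈ Finset.range k, b i ≠ 0 → 5 / 3 ≤ 1 / b i ^ 2 := fun i hi h => by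
    have hp : 0 < b i ^ 2 := by positivity
    rw [le_div_iff₀ hp]; linarith [hb i hi]
  have hterm : ∀ i ∈ Finset.range k, IntegrableOn
      (fun t => b i ^ 2 * (gaussCosGap (1 / b i ^ 2) (b i * t) * t ^ (-p - 1))) (Set.Ioi 0) := by
    intro i hi
    by_cases h : b i = 0
    · simp [h]
    · exact (integrableOn_gaussCosGap_comp_mul (by linarith [hs i hi h]) h (by linarith)
        h4).const_mul _
  refine le_of_mul_le_mul_left ?_ (cosConst_pos h2 h4)
  rw [← sub_nonneg]
  have e2' : cosConst p * gaussMoment p = _ := e2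
  rw [e1, e2', ← integral_sub i2 i1]
  calc (0:ℝ) ≤ ∑ i ∈ Finset.range k, ∫ t in Set.Ioi 0,
        b i ^ 2 * (gaussCosGap (1 / b i ^ 2) (b i * t) * t ^ (-p - 1)) := by
        refine Finset.sum_nonneg fun i hi => ?_
        by_cases h : b i = 0
        · simp [h]
        rw [integral_const_mul]
        refine mul_nonneg (sq_nonneg _) ?_
        simp only [← gaussCosGap_abs_mul _ (b i)]
        rw [integral_comp_mul_rpow _ (abs_pos.2 h)]
        exact mul_nonneg (Real.rpow_nonneg (abs_nonneg _) _)
          (integral_gaussCosGap_nonneg (hs i hi h) h2 h4)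
    _ = ∫ t in Set.Ioi 0, ∑ i ∈ Finset.range k,
        b i ^ 2 * (gaussCosGap (1 / b i ^ 2) (b i * t) * t ^ (-p - 1)) :=
        (integral_finsetSum _ hterm).symm
    _ ≤ _ := by
        refine setIntegral_mono_on (integrable_finsetSum _ hterm) (i2.sub i1) measurableSet_Ioi
          fun t ht => ?_
        have ht0 : 0 ≤ t ^ (-p - 1) := Real.rpow_nonneg (le_of_lt ht) _
        have h := mul_le_mul_of_nonneg_right (exp_sub_prod_cos_ge hsum t) ht0
        rw [Finset.sum_mul] at h
        simp only [mul_assoc] at h ⊢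
        refine h.trans (le_of_eq ?_)
        ring

theorem radE_comp_const_mul (b : ℕ → ℝ) (k : ℕ) (c : ℝ) (F : ℝ → ℝ) :
    radE b k (fun x => F (c * x)) = radE (fun i => c * b i) k F := by
  induction k generalizing F with
  | zero => simp [radE]
  | succ k ih =>
    simp only [radE, mul_add, mul_sub]
    rw [ih fun x => F (x + c * b k), ih fun x => F (x - c * b k)]

theorem radE_eq_apply_zero {b : ℕ → ℝ} {k : ℕ} (h : ∀ i < k, b i = 0) (F : ℝ → ℝ) :
    radE b k F = F 0 := by
  induction k generalizing F with
  | zero => rfl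
  | succ k ih =>
    simp only [radE, h k k.lt_succ_self, add_zero, sub_zero]
    rw [ih fun i hi => h i (hi.trans k.lt_succ_self)]; ring

/-- Khintchine's inequality with the sharp Gaussian constant. -/
theorem radE_abs_rpow_le_gaussMoment_mul {b : ℕ → ℝ} (hb : ∀ i j, i ≤ j → |b j| ≤ |b i|) (k : ℕ)
    (p : ℝ) (hp : 2 ≤ p) : radE b k (fun x => |x| ^ p)
      ≤ gaussMoment p * (∑ i ∈ Finset.range k, b i ^ 2) ^ (p / 2) := by
  set σ := ∑ i ∈ Finset.range k, b i ^ 2 with hσ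
  have hσ0 : 0 ≤ σ := Finset.sum_nonneg fun i _ => sq_nonneg _
  refine induction_by_two (Φ := fun p => radE b k (fun x => |x| ^ p)
      ≤ gaussMoment p * σ ^ (p / 2)) ?_ ?_ p hp
  · intro p h2 h4
    rcases h2.eq_or_lt with rfl | h2
    · simp only [Real.rpow_two, sq_abs]
      rw [radE_sq, gaussMoment_two, div_self two_ne_zero, Real.rpow_one, one_mul]
    rcases hσ0.eq_or_lt with h0 | h0
    · have hz : ∀ i < k, b i = 0 := fun i hi => by
        have := (Finset.sum_eq_zero_iff_of_nonneg fun i _ => sq_nonneg (b i)).1 (hσ ▸ h0.symm) i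
          (Finset.mem_range.2 hi)
        exact pow_eq_zero_iff two_ne_zero |>.1 this
      rw [radE_eq_apply_zero hz, abs_zero, Real.zero_rpow (by linarith), ← h0,
        Real.zero_rpow (by linarith), mul_zero]
    have hr : 0 < √σ := Real.sqrt_pos.2 h0
    set c := (√σ)⁻¹ with hc
    have hc0 : 0 < c := by positivity
    have hc2 : c ^ 2 * σ = 1 := by
      rw [hc, inv_pow, Real.sq_sqrt hσ0, inv_mul_cancel₀ h0.ne']
    have hsum : ∑ i ∈ Finset.range k, (c * b i) ^ 2 = 1 := by
      simp only [mul_pow]; rw [← Finset.mul_sum, ← hσ, hc2]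
    have key : radE (fun i => c * b i) k (fun x => |x| ^ p) ≤ gaussMoment p := by
      by_cases hl : 3 / 5 ≤ (c * b 0) ^ 2
      · obtain ⟨m, rfl⟩ : ∃ m, k = m + 1 := Nat.exists_eq_succ_of_ne_zero fun e => by
          rw [e] at hsum; simp at hsum
        exact radE_abs_rpow_le_of_large h2 h4 hsum hl
      · refine radE_abs_rpow_le_of_small h2 h4 hsum fun i _ => ?_
        refine le_trans ?_ (not_le.1 hl).le
        rw [mul_pow, mul_pow]
        exact mul_le_mul_of_nonneg_left (sq_le_sq.2 (hb 0 i i.zero_le)) (sq_nonneg c)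
    rw [← radE_comp_const_mul] at key
    simp only [abs_mul, Real.mul_rpow (abs_nonneg _) (abs_nonneg _)] at key
    rw [radE_const_mul, abs_of_pos hc0, hc, Real.inv_rpow hr.le, inv_mul_le_iff₀ (by positivity),
      Real.sqrt_eq_rpow, ← Real.rpow_mul hσ0, show 1 / 2 * p = p / 2 by ring, mul_comm] at key
    exact key
  · intro p h4 ih
    refine (radE_abs_rpow_le h4 b k).trans ?_
    rw [gaussMoment_eq_mul (by linarith), ← hσ]
    calc (p - 1) * σ * radE b k (fun x => |x| ^ (p - 2))
        ≤ (p - 1) * σ * (gaussMoment (p - 2) * σ ^ ((p - 2) / 2)) :=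
          mul_le_mul_of_nonneg_left ih (mul_nonneg (by linarith) hσ0)
      _ = (p - 1) * gaussMoment (p - 2) * (σ ^ ((p - 2) / 2) * σ) := by ring
      _ = _ := by
          rw [show p / 2 = (p - 2) / 2 + 1 by ring, Real.rpow_add_one' hσ0 (by linarith)]

theorem sum_fin_tail_eq_sum_range {n : ℕ} (f : Fin n → ℝ) (g : ℕ → ℝ) (hfg : ∀ i : Fin n, f i = g i)
    (m : ℕ) : ∑ i : Fin n with m ≤ i.val, f i = ∑ j ∈ Finset.range (n - m), g (m + j) := by
  rw [Finset.sum_filter]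
  simp only [hfg]
  rw [Fin.sum_univ_eq_sum_range (fun i => if m ≤ i then g i else 0) n, ← Finset.sum_filter,
    ← Finset.sum_Ico_eq_sum_range]
  congr 1
  ext i; simp [and_comm]

theorem HasMoments.integrable_comp_hasLaw {Ω : Type*} [MeasurableSpace Ω] {P : Measure Ω}
    {Y : Ω → ℝ} {ν : Measure ℝ} [IsFiniteMeasure ν] (hY : HasLaw Y ν P) (hν : HasMoments ν)
    {F : ℝ → ℝ} (hF : PolyGrowth F) : Integrable (fun ω => F (Y ω)) P := by
  have h := hν.integrable hF
  rw [← hY.map_eq] at h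
  exact h.comp_aemeasurable hY.aemeasurable

theorem theorem1 {Ω Ω' : Type*} [MeasurableSpace Ω] [MeasurableSpace Ω']
    (P : Measure Ω) [IsProbabilityMeasure P] (Q : Measure Ω') [IsProbabilityMeasure Q]
    (n : ℕ) (a : Fin n → ℝ) (ha : ∀ i j : Fin n, i ≤ j → |a j| ≤ |a i|)
    (p : ℝ) (hp : 2 ≤ p)
    -- independent symmetric random signs
    (ε : Fin n → Ω → ℝ) (hε : ∀ i, HasLaw (ε i) signLaw P) (hεind : iIndepFun ε P)
    -- independent symmetric exponential variables of variance one
    (X : Fin n → Ω' → ℝ) (hX : ∀ i, HasLaw (X i) symmExpLaw Q) (hXind : iIndepFun X Q) :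
    -- both moments are finite; `i : Fin n` carries the one-based index `i + 1`
    Integrable (fun ω => |∑ i, a i * ε i ω| ^ p) P ∧
    Integrable (fun ω => |∑ i with ⌈p / 2⌉₊ ≤ i.val + 1, a i * X i ω| ^ p) Q ∧
    ∫ ω, |∑ i, a i * ε i ω| ^ p ∂P ≤ gammaNorm p ^ p * (∑ i, a i ^ 2) ^ (p / 2) ∧
    ∫ ω, |∑ i with ⌈p / 2⌉₊ ≤ i.val + 1, a i * X i ω| ^ p ∂Q
      ≤ ∫ ω, |∑ i, a i * ε i ω| ^ p ∂P ∧
    gammaNorm p ^ p * (∑ i with ⌈p / 2⌉₊ ≤ i.val + 1, a i ^ 2) ^ (p / 2)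
      ≤ ∫ ω, |∑ i with ⌈p / 2⌉₊ ≤ i.val + 1, a i * X i ω| ^ p ∂Q := by
  have hp0 : 0 ≤ p := by linarith
  -- Extending the coefficients by zero keeps `|a|` nonincreasing.
  set A : ℕ → ℝ := fun j => if h : j < n then a ⟨j, h⟩ else 0 with hA
  have hAa : ∀ i : Fin n, A i = a i := fun i => by simp [hA]
  have hmono : ∀ i j, i ≤ j → |A j| ≤ |A i| := by
    intro i j hij
    by_cases hj : j < n
    · simp only [hA, dif_pos hj, dif_pos (hij.trans_lt hj)]
      exact ha _ _ hij
    · simp only [hA, dif_neg hj, abs_zero]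
      exact abs_nonneg _
  set m := ⌈p / 2⌉₊ - 1 with hm
  have hiff : ∀ i : Fin n, ⌈p / 2⌉₊ ≤ i.val + 1 ↔ m ≤ i.val := fun i => by omega
  simp only [hiff]
  have hlawε := hasLaw_tail_sum A hε hεind 0 n le_rfl
  have hlawX := hasLaw_tail_sum A hX hXind m n le_rfl
  simp only [hAa, Nat.zero_le, Fin.is_lt, and_true, Finset.filter_true, zero_add, tsub_zero]
    at hlawε hlawX
  have hpow : PolyGrowth fun x : ℝ => |x| ^ p := PolyGrowth.abs_rpow hp0
  have hmε := hasMoments_signLaw.sumLaw A n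
  have hmX := hasMoments_symmExpLaw.sumLaw (fun j => A (m + j)) (n - m)
  have eε : ∫ ω, |∑ i, a i * ε i ω| ^ p ∂P = radE A n fun x => |x| ^ p := by
    rw [← integral_sumLaw_signLaw A n hpow]
    exact hlawε.integral_comp hpow.1.aestronglyMeasurable
  have eX : ∫ ω, |∑ i : Fin n with m ≤ i.val, a i * X i ω| ^ p ∂Q
      = ∫ x, |x| ^ p ∂(sumLaw symmExpLaw (fun j => A (m + j)) (n - m)) :=
    hlawX.integral_comp hpow.1.aestronglyMeasurable
  have sε : ∑ i, a i ^ 2 = ∑ j ∈ Finset.range n, A j ^ 2 := by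
    rw [← Fin.sum_univ_eq_sum_range]; simp only [hAa]
  have sX := sum_fin_tail_eq_sum_range (fun i => a i ^ 2) (fun j => A j ^ 2)
    (fun i => by simp only [hAa]) m
  rw [eε, eX, sε, sX, gammaNorm_rpow (by linarith)]
  exact ⟨HasMoments.integrable_comp_hasLaw hlawε hmε hpow,
    HasMoments.integrable_comp_hasLaw hlawX hmX hpow,
    radE_abs_rpow_le_gaussMoment_mul hmono n p hp, integral_symmExpLaw_le_radE hmono p hp n,
    gaussMoment_mul_le_integral_symmExpLaw _ p hp _⟩
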